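/- Let $d\ge 1$. For real numbers $a,b$ with $-d<b<a$ and $a>0$, let $$W_{a,b}(x)=\frac{|x|^a}{a}-\frac{|x|^b}{b},\qquad x\in\mathbb{R}^d,$$ where $\frac{|x|^0}{0}$ is understood as $\ln|x|$ and where $W_{a,b}(0)=+\infty$ if $b\le 0$ and $W_{a,b}(0)=0$ if $b>0$. For a Borel probability measure $\rho$ on $\mathbb{R}^d$ let $$E_{a,b}[\rho]=\frac12\int_{\mathbb{R}^d}\int_{\mathbb{R}^d}W_{a,b}(x-y)\,d\rho(y)\,d\rho(x)\in\mathbb{R}\cup\{+\infty\}.$$ A minimizer of $E_{a,b}$ is a Borel probability measure $\rho$ with $E_{a,b}[\rho]\le E_{a,b}[\sigma]$ for every Borel probability measure $\sigma$ on $\mathbb{R}^d$. **Theorem.** For every $b$ with $-d<b<2$ there exists $a_+(b)>4$ (depending only on $d$ and $b$) such that, for every $a$ with $4<a<a_+(b)$, the energy $E_{a,b}$ has a minimizer, and it is unique up to translation: any two minimizers of $E_{a,b}$ are translates of each other. -/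

import Mathlib

open MeasureTheory

noncomputable section

/-- The function `t ↦ t ^ s / s` for `t > 0`, understood as `ln t` when `s = 0`. -/
def powerProfile (s t : ℝ) : ℝ :=
  if s = 0 then Real.log t else t ^ s / s

/-- The power-law potential `W_{a,b}(x) = |x|^a / a - |x|^b / b` on `ℝ^d`, for `b < a`, with values
in `ℝ ∪ {∞}`. At the origin it takes the value of its limit there, namely `∞` if `b ≤ 0` and `0`
if `b > 0`. -/
def powerPotential (d : ℕ) (a b : ℝ) (x : EuclideanSpace ℝ (Fin d)) : EReal :=
  if x = 0 then (if b ≤ 0 then ⊤ else 0)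
  else ((powerProfile a ‖x‖ - powerProfile b ‖x‖ : ℝ) : EReal)

/-- The integral of an extended-real-valued function, `∫ f⁺ dμ - ∫ f⁻ dμ`. It is the usual
(possibly infinite) integral as soon as the negative part has a finite integral, in particular
when `μ` is finite and `f` is measurable and bounded from below. -/
def extIntegral {α : Type*} [MeasurableSpace α] (μ : Measure α) (f : α → EReal) : EReal :=
  ((∫⁻ x, (f x).toENNReal ∂μ : ENNReal) : EReal)
    - ((∫⁻ x, (-f x).toENNReal ∂μ : ENNReal) : EReal)

/-- The interaction energy `E[ρ] = (1/2) ∬ W(x - y) dρ(y) dρ(x)`, with values in `ℝ ∪ {∞}` for a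
probability measure `ρ` and a potential `W` that is bounded from below. -/
def interactionEnergy {d : ℕ} (W : EuclideanSpace ℝ (Fin d) → EReal)
    (ρ : Measure (EuclideanSpace ℝ (Fin d))) : EReal :=
  ((1 / 2 : ℝ) : EReal) * extIntegral (ρ.prod ρ) (fun p => W (p.1 - p.2))

/-- `ρ` minimizes the interaction energy of `W` among all Borel probability measures on `ℝ^d`. -/
def IsEnergyMinimizer {d : ℕ} (W : EuclideanSpace ℝ (Fin d) → EReal)
    (ρ : Measure (EuclideanSpace ℝ (Fin d))) : Prop :=
  IsProbabilityMeasure ρ ∧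
    ∀ σ : Measure (EuclideanSpace ℝ (Fin d)), IsProbabilityMeasure σ →
      interactionEnergy W ρ ≤ interactionEnergy W σ

end

noncomputable section
open Set Filter Topology

/-! ### Calculus of the power profiles -/

/-! Uniqueness comes from strict positivity of the energy on differences `ρ - σ` of measures with
the same mean and support in a fixed ball. For `b < 2` the profile `-powerProfile b` is, up to
constants, a positive mixture of Gaussians (`lintegral_mixture`), so it contributes a positive
multiple of `repEnergy b`. On such differences `|x|^2` contributes nothing, while `|x|^4`
contributes a nonnegative square of second moments (`quadForm_norm_sub_pow_four`). Hence the case `a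
= 4` is convex, and the task is to perturb to `a` slightly above 4.

For `4 < a < 6`, `|x|^a` is a mixture with weight `t^(-a/2-1)` of Taylor remainders of `exp
(-t|x|^2)`, whose normalization `attractionConst a` is at least `1 / (4 (a - 4))` when `a < 5`. Its
quadratic form is thus `(attractionConst a)⁻¹` times an integral of `t^2/2 * Q₄ - gaussForm t`,
where `Q₄` is the quartic form. For `t ≥ 1` the negative part is absorbed by `repEnergy b`. For `t ≤
1` a Taylor expansion of the characteristic functions bounds it by `t^(5/2)` times a squared
negative Sobolev norm (`exists_gaussForm_le`), which `repEnergy b` controls in turn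
(`exists_sobolevSq_le_repEnergy`). The form of `|x|^a` is therefore at least `-C (a - 4) repEnergy
b`, and repulsion wins when `a - 4` is small (`exists_eq_of_quadForm_nonpos`).

The constant `C` depends on the ball, so the supports of minimizers must be bounded uniformly in
`a`. After a shift the kernel dominates `|x|`. The Euler–Lagrange equation (`ae_lintegral_eq`) then
bounds the distance from the mean by the least energy, which a fixed trial measure bounds uniformly
in `a`. The first variation inequalities of two centered minimizers make the form of their
difference nonpositive, so they coincide. Existence is the direct method: lower semicontinuity, and
tightness after translation. -/

lemma hasDerivAt_powerProfile (b : ℝ) {r : ℝ} (hr : 0 < r) :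
    HasDerivAt (powerProfile b) (r ^ (b - 1)) r := by
  unfold powerProfile
  by_cases hb : b = 0
  · subst hb
    simpa [Real.rpow_neg_one] using Real.hasDerivAt_log hr.ne'
  · simp only [hb, if_false]
    have := (Real.hasDerivAt_rpow_const (p := b) (Or.inl hr.ne')).div_const b
    convert! this using 1
    field_simp

/-- The logarithmic case needs no exception: `1 / 0 = 0` agrees with `log 1 = 0`. -/
lemma powerProfile_one (b : ℝ) : powerProfile b 1 = 1 / b := by
  by_cases hb : b = 0 <;> simp [powerProfile, hb]

lemma powerProfile_zero (b : ℝ) : powerProfile b 0 = 0 := by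
  by_cases hb : b = 0 <;> simp [powerProfile, hb, Real.zero_rpow]

lemma powerProfile_of_ne_zero {s : ℝ} (hs : s ≠ 0) (t : ℝ) : powerProfile s t = t ^ s / s := by
  simp [powerProfile, hs]

lemma measurable_powerProfile (b : ℝ) : Measurable (powerProfile b) := by
  unfold powerProfile
  by_cases hb : b = 0 <;> simp only [hb, if_true, if_false] <;> fun_prop

lemma powerProfile_mono (b : ℝ) {r s : ℝ} (hr : 0 < r) (hrs : r ≤ s) :
    powerProfile b r ≤ powerProfile b s := by
  have h : MonotoneOn (powerProfile b) (Ioi 0) := by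
    apply monotoneOn_of_deriv_nonneg (convex_Ioi 0)
    · exact fun x hx => (hasDerivAt_powerProfile b hx).continuousAt.continuousWithinAt
    · intro x hx
      rw [interior_Ioi] at hx
      exact (hasDerivAt_powerProfile b hx).differentiableAt.differentiableWithinAt
    · intro x hx
      rw [interior_Ioi] at hx
      rw [(hasDerivAt_powerProfile b hx).deriv]
      exact Real.rpow_nonneg (le_of_lt hx) _
  exact h hr (lt_of_lt_of_le hr hrs) hrs

/-- The two sides agree at `r = 1`, and beyond it the derivatives compare as `r ^ (b - 1) ≤ r`. -/
lemma powerProfile_le_sq {b : ℝ} (hb : b ≤ 2) {r : ℝ} (hr : 1 ≤ r) :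
    powerProfile b r ≤ 1 / b + (r ^ 2 - 1) / 2 := by
  have h : MonotoneOn (fun r => (r ^ 2 - 1) / 2 - powerProfile b r) (Ici 1) := by
    have hd : ∀ x : ℝ, 1 ≤ x → HasDerivAt (fun r => (r ^ 2 - 1) / 2 - powerProfile b r)
        (x - x ^ (b - 1)) x := by
      intro x hx
      have := ((((hasDerivAt_id x).pow 2).sub_const 1).div_const 2).sub
        (hasDerivAt_powerProfile b (lt_of_lt_of_le one_pos hx))
      convert! this using 1
      simp
    apply monotoneOn_of_deriv_nonneg (convex_Ici 1)
    · exact fun x hx => (hd x hx).continuousAt.continuousWithinAt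
    · intro x hx
      rw [interior_Ici] at hx
      exact (hd x (le_of_lt hx)).differentiableAt.differentiableWithinAt
    · intro x hx
      rw [interior_Ici] at hx
      have hx' : (1 : ℝ) ≤ x := le_of_lt hx
      rw [(hd x hx').deriv]
      have := Real.rpow_le_rpow_of_exponent_le hx' (show b - 1 ≤ 1 by linarith)
      rw [Real.rpow_one] at this
      linarith
  have := h (mem_Ici.2 le_rfl) (mem_Ici.2 hr) hr
  simp only [powerProfile_one] at this
  linarith

/-- The attractive-repulsive profile grows at least linearly, uniformly in `a ∈ (4, 5)`. -/
lemma le_powerProfile_sub {a b : ℝ} (ha : 4 < a) (ha' : a < 5) (hb : b ≤ 2) {r : ℝ} (hr : 0 < r) :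
    r - (|1 / b| + 2) ≤ powerProfile a r - powerProfile b r := by
  have hb1 := le_abs_self (1 / b)
  rw [powerProfile_of_ne_zero (by linarith : a ≠ 0)]
  rcases le_total r 1 with h | h
  · have h1 := powerProfile_mono b hr h
    rw [powerProfile_one] at h1
    have h2 : 0 ≤ r ^ a / a := by positivity
    linarith
  · have h1 := powerProfile_le_sq hb h
    have h2 : r ^ 4 / 5 ≤ r ^ a / a := by
      have h3 : r ^ (4 : ℕ) ≤ r ^ a := by
        rw [← Real.rpow_natCast]
        exact Real.rpow_le_rpow_of_exponent_le h (by norm_num; linarith)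
      gcongr
    -- What remains is `r ^ 4 / 5 - r ^ 2 / 2 - r + 5 / 2 ≥ 0`; the 2 added to `|1 / b|` makes this
    -- true.
    nlinarith [sq_nonneg (r ^ 2 - 3), sq_nonneg (r - 1), sq_nonneg (r ^ 2 - 2)]

/-! ### The repulsive profile as a mixture of Gaussians -/

/-- The profile is an antiderivative of `s ^ (b - 1)`, which fails to be integrable at 0 exactly
when `b ≤ 0`. The infinite branch thus matches the value of the potential at the origin. -/
lemma lintegral_rpow_sub_one {b r L : ℝ} (hr : 0 ≤ r) (hrL : r ≤ L) (hL : 0 < L) :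
    ∫⁻ s in Ioo r L, ENNReal.ofReal (s ^ (b - 1)) =
      if r = 0 ∧ b ≤ 0 then ⊤ else ENNReal.ofReal (powerProfile b L - powerProfile b r) := by
  have hnn : ∀ᵐ s ∂(volume.restrict (Ioo r L)), 0 ≤ s ^ (b - 1) := by
    refine ae_restrict_of_forall_mem measurableSet_Ioo fun s hs => ?_
    exact Real.rpow_nonneg (hr.trans hs.1.le) _
  split_ifs with h
  · obtain ⟨rfl, hb⟩ := h
    by_contra hne
    have := (lintegral_ofReal_ne_top_iff_integrable
      (by exact (measurable_id.pow_const _).aestronglyMeasurable) hnn).1 hne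
    have := (intervalIntegral.integrableOn_Ioo_rpow_iff hL).1 this
    linarith
  · have hint : IntervalIntegrable (fun s : ℝ => s ^ (b - 1)) volume r L := by
      rcases hr.eq_or_lt with rfl | hr
      · apply intervalIntegral.intervalIntegrable_rpow'
        have : 0 < b := by
          by_contra hb
          exact h ⟨rfl, not_lt.1 hb⟩
        linarith
      · apply intervalIntegral.intervalIntegrable_rpow
        right
        rw [uIcc_of_le hrL]
        exact fun h => absurd h.1 (not_le.2 hr)
    rw [← ofReal_integral_eq_lintegral_ofReal _ hnn]
    · congr 1
      rw [← integral_Ioc_eq_integral_Ioo, ← intervalIntegral.integral_of_le hrL]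
      rcases hr.eq_or_lt with rfl | hr
      · have hb : 0 < b := by
          by_contra hb
          exact h ⟨rfl, not_lt.1 hb⟩
        rw [integral_rpow (Or.inl (by linarith)), powerProfile_zero,
          powerProfile_of_ne_zero hb.ne', sub_add_cancel, Real.zero_rpow hb.ne', sub_zero, sub_zero]
      · refine intervalIntegral.integral_eq_sub_of_hasDerivAt (fun x hx => ?_) hint
        rw [uIcc_of_le hrL] at hx
        exact hasDerivAt_powerProfile b (hr.trans_le hx.1)
    · exact ((intervalIntegrable_iff_integrableOn_Ioc_of_le hrL).1 hint).mono_set Ioo_subset_Ioc_self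

/-- The normalization in the Gaussian mixture representation of `powerProfile b`. -/
def mixtureConst (b : ℝ) : ℝ := 1 / (2 * Real.Gamma (1 - b / 2))

lemma mixtureConst_pos {b : ℝ} (hb : b < 2) : 0 < mixtureConst b := by
  have := Real.Gamma_pos_of_pos (show 0 < 1 - b / 2 by linarith)
  unfold mixtureConst
  positivity

/-- A Gamma integral, convergent at `t = 0` because `b < 2`; it dictates the value of
`mixtureConst`. -/
lemma lintegral_mixture_deriv {b : ℝ} (hb : b < 2) {s : ℝ} (hs : 0 < s) :
    ∫⁻ t in Ioi (0 : ℝ), ENNReal.ofReal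
      (2 * mixtureConst b * t ^ (-b / 2) * (s * Real.exp (-t * s ^ 2))) =
      ENNReal.ofReal (s ^ (b - 1)) := by
  have hG := Real.Gamma_pos_of_pos (show 0 < 1 - b / 2 by linarith)
  have hint : IntegrableOn (fun t : ℝ => t ^ (-b / 2) * Real.exp (-(s ^ 2) * t)) (Ioi 0) := by
    have := integrableOn_rpow_mul_exp_neg_mul_rpow (s := -b / 2) (p := 1) (b := s ^ 2)
      (by linarith) one_pos (by positivity)
    simpa using this
  have hval : ∫ t in Ioi (0 : ℝ), t ^ (-b / 2) * Real.exp (-(s ^ 2) * t) =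
      s ^ (b - 2) * Real.Gamma (1 - b / 2) := by
    have := Real.integral_rpow_mul_exp_neg_mul_Ioi (show 0 < 1 - b / 2 by linarith)
      (show 0 < s ^ 2 by positivity)
    convert this using 2
    · ext t
      ring_nf
    · rw [one_div, Real.inv_rpow (by positivity), ← Real.rpow_natCast, ← Real.rpow_mul hs.le,
        ← Real.rpow_neg hs.le]
      congr 1
      push_cast
      ring
  have hfun : ∀ t : ℝ, 2 * mixtureConst b * t ^ (-b / 2) * (s * Real.exp (-t * s ^ 2)) =
      2 * mixtureConst b * s * (t ^ (-b / 2) * Real.exp (-(s ^ 2) * t)) := by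
    intro t
    rw [show -t * s ^ 2 = -(s ^ 2) * t by ring]
    ring
  simp_rw [hfun]
  rw [← ofReal_integral_eq_lintegral_ofReal (hint.const_mul _)]
  · rw [integral_const_mul, hval]
    congr 1
    rw [show b - 1 = (b - 2) + 1 by ring, Real.rpow_add_one hs.ne']
    have := hG.ne'
    rw [mixtureConst]
    generalize Real.Gamma (1 - b / 2) = c at *
    field_simp
  · refine ae_restrict_of_forall_mem measurableSet_Ioi fun t ht => ?_
    have := mixtureConst_pos hb
    have : (0 : ℝ) < t := ht
    simp only [Pi.zero_apply]
    positivity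

lemma lintegral_mul_exp_sq {b : ℝ} (hb : b < 2) {t : ℝ} (ht : 0 < t) {r L : ℝ} (hr : 0 ≤ r)
    (hrL : r ≤ L) :
    ∫⁻ s in Ioo r L, ENNReal.ofReal
      (2 * mixtureConst b * t ^ (-b / 2) * (s * Real.exp (-t * s ^ 2))) =
      ENNReal.ofReal (mixtureConst b * t ^ (-b / 2 - 1) *
        (Real.exp (-t * r ^ 2) - Real.exp (-t * L ^ 2))) := by
  have hc : Continuous
      (fun s : ℝ => 2 * mixtureConst b * t ^ (-b / 2) * (s * Real.exp (-t * s ^ 2))) := by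
    fun_prop
  have := mixtureConst_pos hb
  rw [← ofReal_integral_eq_lintegral_ofReal]
  · congr 1
    rw [← integral_Ioc_eq_integral_Ioo, ← intervalIntegral.integral_of_le hrL,
      intervalIntegral.integral_eq_sub_of_hasDerivAt
        (f := fun s => - (mixtureConst b * t ^ (-b / 2 - 1)) * Real.exp (-t * s ^ 2))
        (fun x _ => ?_) (hc.intervalIntegrable _ _)]
    · ring
    · have h1 : HasDerivAt (fun s : ℝ => Real.exp (-t * s ^ 2))
          (Real.exp (-t * x ^ 2) * (-t * (2 * x))) x := by
        have := (((hasDerivAt_id x).pow 2).const_mul (-t)).exp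
        simpa using this
      convert! h1.const_mul (- (mixtureConst b * t ^ (-b / 2 - 1))) using 1
      rw [show -b / 2 = (-b / 2 - 1) + 1 by ring, Real.rpow_add_one ht.ne']
      ring_nf
  · exact (hc.integrableOn_Icc (a := r) (b := L)).mono_set Ioo_subset_Icc_self
  · refine ae_restrict_of_forall_mem measurableSet_Ioo fun s hs => ?_
    have : (0 : ℝ) ≤ s := hr.trans hs.1.le
    simp only [Pi.zero_apply]
    positivity

/-- The repulsive profile is a mixture of Gaussians, up to an additive constant. -/
theorem lintegral_mixture {b : ℝ} (hb : b < 2) {r L : ℝ} (hr : 0 ≤ r) (hrL : r ≤ L) (hL : 0 < L) :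
    ∫⁻ t in Ioi (0 : ℝ), ENNReal.ofReal (mixtureConst b * t ^ (-b / 2 - 1) *
        (Real.exp (-t * r ^ 2) - Real.exp (-t * L ^ 2))) =
      if r = 0 ∧ b ≤ 0 then ⊤ else ENNReal.ofReal (powerProfile b L - powerProfile b r) := by
  rw [← lintegral_rpow_sub_one hr hrL hL]
  have h1 : ∀ t ∈ Ioi (0 : ℝ), ENNReal.ofReal (mixtureConst b * t ^ (-b / 2 - 1) *
        (Real.exp (-t * r ^ 2) - Real.exp (-t * L ^ 2))) = ∫⁻ s in Ioo r L, ENNReal.ofReal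
      (2 * mixtureConst b * t ^ (-b / 2) * (s * Real.exp (-t * s ^ 2))) :=
    fun t ht => (lintegral_mul_exp_sq hb ht hr hrL).symm
  -- Tonelli in `(s, t)` on the derivative of the Gaussian. Lebesgue integrals also cover the
  -- infinite value. Subtracting the value at `L` gives convergence at `t = 0`, where `t ^ (-b / 2 -
  -- 1)` alone is not integrable if `b ≥ 0`.
  rw [setLIntegral_congr_fun measurableSet_Ioi h1, lintegral_lintegral_swap]
  · exact setLIntegral_congr_fun measurableSet_Ioo
      fun s hs => lintegral_mixture_deriv hb (hr.trans_lt hs.1)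
  · apply Measurable.aemeasurable
    apply ENNReal.measurable_ofReal.comp
    fun_prop

/-! ### The attractive profile -/

/-- The remainder of the second order Taylor expansion of `exp (-s)` at `0`. -/
def expRemainder (s : ℝ) : ℝ := 1 - s + s ^ 2 / 2 - Real.exp (-s)

lemma continuous_expRemainder : Continuous expRemainder := by
  unfold expRemainder
  fun_prop

lemma hasDerivAt_exp_neg (s : ℝ) : HasDerivAt (fun s => Real.exp (-s)) (-Real.exp (-s)) s := by
  simpa using (hasDerivAt_id s).neg.exp

lemma expRemainder_nonneg {s : ℝ} (hs : 0 ≤ s) : 0 ≤ expRemainder s := by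
  have hd : ∀ x : ℝ, HasDerivAt expRemainder (-1 + x + Real.exp (-x)) x := by
    intro x
    have := ((((hasDerivAt_id x).const_sub 1).add
      (((hasDerivAt_id x).pow 2).div_const 2))).sub (hasDerivAt_exp_neg x)
    convert! this using 1
    simp
  have h : MonotoneOn expRemainder (Ici 0) := by
    apply monotoneOn_of_deriv_nonneg (convex_Ici 0) continuous_expRemainder.continuousOn
    · exact fun x _ => (hd x).differentiableAt.differentiableWithinAt
    · intro x _
      rw [(hd x).deriv]
      linarith [Real.add_one_le_exp (-x)]
  have := h (mem_Ici.2 le_rfl) (mem_Ici.2 hs) hs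
  simpa [expRemainder] using this

/-- The derivative of the gap `s ^ 3 / 6 - expRemainder s` is `expRemainder s` itself, so
nonnegativity bootstraps. -/
lemma expRemainder_le_cube {s : ℝ} (hs : 0 ≤ s) : expRemainder s ≤ s ^ 3 / 6 := by
  have hd : ∀ x : ℝ, HasDerivAt (fun s => s ^ 3 / 6 - expRemainder s) (expRemainder x) x := by
    intro x
    have := (((hasDerivAt_id x).pow 3).div_const 6).sub
      (((((hasDerivAt_id x).const_sub 1).add
      (((hasDerivAt_id x).pow 2).div_const 2))).sub (hasDerivAt_exp_neg x))
    convert! this using 1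
    simp [expRemainder]
    ring
  have h : MonotoneOn (fun s => s ^ 3 / 6 - expRemainder s) (Ici 0) := by
    apply monotoneOn_of_deriv_nonneg (convex_Ici 0)
    · exact fun x _ => (hd x).continuousAt.continuousWithinAt
    · exact fun x _ => (hd x).differentiableAt.differentiableWithinAt
    · intro x hx
      rw [interior_Ici] at hx
      rw [(hd x).deriv]
      exact expRemainder_nonneg (le_of_lt hx)
  have := h (mem_Ici.2 le_rfl) (mem_Ici.2 hs) hs
  simp [expRemainder] at this
  simp only [expRemainder]
  linarith

lemma expRemainder_le_sq {s : ℝ} : expRemainder s ≤ s ^ 2 / 2 := by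
  unfold expRemainder
  linarith [Real.add_one_le_exp (-s)]

lemma le_expRemainder {s : ℝ} (hs : 0 ≤ s) : s ^ 2 / 2 - s ≤ expRemainder s := by
  unfold expRemainder
  have := Real.exp_le_one_iff.2 (show -s ≤ 0 by linarith)
  linarith

/-- The cubic bound near 0 uses `a < 6`, the quadratic bound at infinity uses `4 < a`. The tail is
what diverges as `a` decreases to 4. -/
lemma integrableOn_rpow_mul_expRemainder {a : ℝ} (ha : 4 < a) (ha' : a < 6) :
    IntegrableOn (fun t => t ^ (-a / 2 - 1) * expRemainder t) (Ioi 0) := by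
  have hm : Measurable (fun t : ℝ => t ^ (-a / 2 - 1) * expRemainder t) :=
    (measurable_id.pow_const _).mul continuous_expRemainder.measurable
  rw [← Ioc_union_Ioi_eq_Ioi zero_le_one]
  refine IntegrableOn.union ?_ ?_
  · have h1 : IntegrableOn (fun t : ℝ => t ^ (2 - a / 2)) (Ioc 0 1) := by
      rw [← intervalIntegrable_iff_integrableOn_Ioc_of_le zero_le_one]
      exact intervalIntegral.intervalIntegrable_rpow' (by linarith)
    refine Integrable.mono' h1 hm.aestronglyMeasurable ?_
    refine ae_restrict_of_forall_mem measurableSet_Ioc fun t ht => ?_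
    have h0 := expRemainder_nonneg ht.1.le
    rw [Real.norm_of_nonneg (mul_nonneg (Real.rpow_nonneg ht.1.le _) h0)]
    calc t ^ (-a / 2 - 1) * expRemainder t ≤ t ^ (-a / 2 - 1) * t ^ (3 : ℝ) := by
          have := expRemainder_le_cube ht.1.le
          have h3 : t ^ (3 : ℝ) = t ^ 3 := by exact_mod_cast Real.rpow_natCast t 3
          have : 0 ≤ t ^ 3 := pow_nonneg ht.1.le _
          have := Real.rpow_nonneg ht.1.le (-a / 2 - 1)
          rw [h3]
          gcongr
          linarith
      _ = t ^ (2 - a / 2) := by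
          rw [← Real.rpow_add ht.1]
          ring_nf
  · have h1 := integrableOn_Ioi_rpow_of_lt (show 1 - a / 2 < -1 by linarith) one_pos
    refine Integrable.mono' h1 hm.aestronglyMeasurable ?_
    refine ae_restrict_of_forall_mem measurableSet_Ioi fun t ht => ?_
    have ht0 : (0 : ℝ) < t := one_pos.trans ht
    have h0 := expRemainder_nonneg ht0.le
    rw [Real.norm_of_nonneg (mul_nonneg (Real.rpow_nonneg ht0.le _) h0)]
    calc t ^ (-a / 2 - 1) * expRemainder t ≤ t ^ (-a / 2 - 1) * t ^ (2 : ℝ) := by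
          have := expRemainder_le_sq (s := t)
          have h3 : t ^ (2 : ℝ) = t ^ 2 := by exact_mod_cast Real.rpow_natCast t 2
          have : 0 ≤ t ^ 2 := pow_nonneg ht0.le _
          rw [h3]
          gcongr
          linarith
      _ = t ^ (1 - a / 2) := by
          rw [← Real.rpow_add ht0]
          ring_nf

/-- The normalization in the Gaussian mixture representation of `r ^ a` for `4 < a < 6`. -/
def attractionConst (a : ℝ) : ℝ := ∫ t in Ioi (0 : ℝ), t ^ (-a / 2 - 1) * expRemainder t

/-- The normalization blows up as `a` decreases to `4`. -/
lemma le_attractionConst {a : ℝ} (ha : 4 < a) (ha' : a < 5) :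
    1 / (4 * (a - 4)) ≤ attractionConst a := by
  have hI := integrableOn_rpow_mul_expRemainder ha (by linarith)
  -- For `t ≥ 4` the remainder is at least `t ^ 2 / 2 - t ≥ t ^ 2 / 4`, and the tail alone yields
  -- the blow-up.
  have h1 : ∫ t in Ioi (4 : ℝ), (1 / 4) * t ^ (1 - a / 2) ≤ attractionConst a := by
    unfold attractionConst
    refine le_trans ?_ (setIntegral_mono_set hI ?_ (Ioi_subset_Ioi zero_le_four).eventuallyLE)
    · refine setIntegral_mono_on
        ((integrableOn_Ioi_rpow_of_lt (by linarith) four_pos).const_mul _)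
        (hI.mono_set (Ioi_subset_Ioi zero_le_four)) measurableSet_Ioi fun t ht => ?_
      have ht4 : (4 : ℝ) < t := ht
      have ht0 : (0 : ℝ) < t := by linarith
      have h3 : t ^ (2 : ℝ) = t ^ 2 := by exact_mod_cast Real.rpow_natCast t 2
      rw [show (1 : ℝ) - a / 2 = (-a / 2 - 1) + 2 by ring, Real.rpow_add ht0, h3]
      have := le_expRemainder ht0.le
      have := Real.rpow_nonneg ht0.le (-a / 2 - 1)
      calc 1 / 4 * (t ^ (-a / 2 - 1) * t ^ 2) = t ^ (-a / 2 - 1) * (t ^ 2 / 4) := by ring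
        _ ≤ _ := by
          gcongr
          nlinarith
    · refine ae_restrict_of_forall_mem measurableSet_Ioi fun t ht => ?_
      exact mul_nonneg (Real.rpow_nonneg (le_of_lt ht) _) (expRemainder_nonneg (le_of_lt ht))
  refine le_trans ?_ h1
  rw [integral_const_mul, integral_Ioi_rpow_of_lt (by linarith) four_pos]
  have h2 : (1 : ℝ) / 2 ≤ 4 ^ (1 - a / 2 + 1) := by
    have : ((4 : ℝ)) ^ (-(1 / 2) : ℝ) ≤ 4 ^ (1 - a / 2 + 1) :=
      Real.rpow_le_rpow_of_exponent_le (by norm_num) (by linarith)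
    refine le_trans (le_of_eq ?_) this
    rw [Real.rpow_neg (by norm_num), ← Real.sqrt_eq_rpow,
      show (4 : ℝ) = 2 ^ 2 by norm_num, Real.sqrt_sq (by norm_num)]
    norm_num
  rw [show -(4 : ℝ) ^ (1 - a / 2 + 1) / (1 - a / 2 + 1) = 4 ^ (1 - a / 2 + 1) / ((a - 4) / 2) by
    rw [show 1 - a / 2 + 1 = -((a - 4) / 2) by ring, neg_div_neg_eq]]
  have h4 : 0 < a - 4 := by linarith
  calc 1 / (4 * (a - 4)) = 1 / 4 * ((1 / 2) / ((a - 4) / 2)) := by field_simp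
    _ ≤ _ := by gcongr

lemma attractionConst_pos {a : ℝ} (ha : 4 < a) (ha' : a < 5) : 0 < attractionConst a :=
  lt_of_lt_of_le (by have : 0 < a - 4 := by linarith
                     positivity) (le_attractionConst ha ha')

/-- Preparation for the substitution `t ↦ t * r ^ 2`, whose Jacobian turns `r ^ (a + 2)` into `r ^
a`. -/
lemma attraction_mixture_aux {a r t : ℝ} (hr : 0 < r) (ht : 0 < t) :
    t ^ (-a / 2 - 1) * expRemainder (t * r ^ 2) =
      r ^ (a + 2) * ((t * r ^ 2) ^ (-a / 2 - 1) * expRemainder (t * r ^ 2)) := by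
  rw [Real.mul_rpow ht.le (by positivity), ← Real.rpow_natCast r 2, ← Real.rpow_mul hr.le]
  have : r ^ (a + 2) * r ^ ((2 : ℕ) * (-a / 2 - 1)) = 1 := by
    rw [← Real.rpow_add hr]
    push_cast
    ring_nf
    simp
  calc t ^ (-a / 2 - 1) * _ = (r ^ (a + 2) * r ^ ((2 : ℕ) * (-a / 2 - 1))) *
        (t ^ (-a / 2 - 1) * expRemainder (t * r ^ ((2 : ℕ) : ℝ))) := by rw [this, one_mul]
    _ = _ := by ring

lemma integrableOn_attraction_mixture {a : ℝ} (ha : 4 < a) (ha' : a < 6) {r : ℝ} (hr : 0 ≤ r) :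
    IntegrableOn (fun t => t ^ (-a / 2 - 1) * expRemainder (t * r ^ 2)) (Ioi 0) := by
  rcases hr.eq_or_lt with rfl | hr
  · simp [expRemainder]
  rw [integrableOn_congr_fun (fun t (ht : t ∈ Ioi 0) => attraction_mixture_aux (a := a) hr ht)
    measurableSet_Ioi]
  apply Integrable.const_mul
  have := (integrableOn_Ioi_comp_mul_right_iff
    (fun t => t ^ (-a / 2 - 1) * expRemainder t) 0 (show 0 < r ^ 2 by positivity)).2
  rw [zero_mul] at this
  exact this (integrableOn_rpow_mul_expRemainder ha ha')

theorem integral_attraction_mixture {a : ℝ} (ha : 4 < a) {r : ℝ} (hr : 0 ≤ r) :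
    ∫ t in Ioi (0 : ℝ), t ^ (-a / 2 - 1) * expRemainder (t * r ^ 2) =
      attractionConst a * r ^ a := by
  rcases hr.eq_or_lt with rfl | hr
  · simp [expRemainder, Real.zero_rpow (show a ≠ 0 by linarith)]
  rw [setIntegral_congr_fun measurableSet_Ioi (fun t ht => attraction_mixture_aux hr ht),
    integral_const_mul, integral_comp_mul_right_Ioi
      (fun t => t ^ (-a / 2 - 1) * expRemainder t) 0 (show 0 < r ^ 2 by positivity), zero_mul]
  rw [smul_eq_mul, Real.rpow_add hr, attractionConst]
  have : r ^ (2 : ℝ) = r ^ 2 := by exact_mod_cast Real.rpow_natCast r 2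
  rw [this]
  field_simp

end

noncomputable section
open Set Filter Topology
open scoped RealInnerProductSpace

/-! ### A Gaussian measure and its moments -/

/-- The density of the centered Gaussian measure whose characteristic function is
`exp (-‖w‖ ^ 2)`. -/
def gaussDensity (d : ℕ) (x : EuclideanSpace ℝ (Fin d)) : ℝ :=
  (4 * Real.pi) ^ (-(d / 2 : ℝ)) * Real.exp (-(1 / 4) * ‖x‖ ^ 2)

lemma gaussDensity_pos (d : ℕ) (x : EuclideanSpace ℝ (Fin d)) : 0 < gaussDensity d x := by
  unfold gaussDensity
  positivity

lemma continuous_gaussDensity (d : ℕ) : Continuous (gaussDensity d) := by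
  unfold gaussDensity
  fun_prop

/-- The centered Gaussian measure whose characteristic function is `exp (-‖w‖ ^ 2)`. -/
def gaussMeasure (d : ℕ) : Measure (EuclideanSpace ℝ (Fin d)) :=
  volume.withDensity fun x => ENNReal.ofReal (gaussDensity d x)

lemma integral_gaussMeasure {d : ℕ} {F : Type*} [NormedAddCommGroup F] [NormedSpace ℝ F]
    (f : EuclideanSpace ℝ (Fin d) → F) :
    ∫ x, f x ∂(gaussMeasure d) = ∫ x, gaussDensity d x • f x := by
  rw [gaussMeasure, integral_withDensity_eq_integral_toReal_smul
    (continuous_gaussDensity d).measurable.ennreal_ofReal (by simp)]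
  simp_rw [ENNReal.toReal_ofReal (gaussDensity_pos d _).le]

lemma charFun_gaussMeasure {d : ℕ} (w : EuclideanSpace ℝ (Fin d)) :
    charFun (gaussMeasure d) w = Complex.exp (-(‖w‖ ^ 2 : ℝ)) := by
  rw [charFun_apply, integral_gaussMeasure]
  have h := GaussianFourier.integral_cexp_neg_mul_sq_norm_add (V := EuclideanSpace ℝ (Fin d))
    (b := (1 / 4 : ℂ)) (by norm_num) Complex.I w
  have h2 : ∀ x : EuclideanSpace ℝ (Fin d),
      gaussDensity d x • Complex.exp ((⟪x, w⟫ : ℝ) * Complex.I) =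
      ((4 * Real.pi : ℝ) ^ (-(d / 2 : ℝ)) : ℝ) *
        Complex.exp (-(1 / 4) * ‖x‖ ^ 2 + Complex.I * (⟪w, x⟫ : ℝ)) := by
    intro x
    rw [Complex.exp_add, Complex.real_smul, gaussDensity, Complex.ofReal_mul, Complex.ofReal_exp,
      real_inner_comm]
    push_cast
    ring_nf
  simp_rw [h2]
  rw [integral_const_mul, h]
  have h3 : (Real.pi / (1 / 4) : ℂ) ^ (Module.finrank ℝ (EuclideanSpace ℝ (Fin d)) / 2 : ℂ) =
      (((4 * Real.pi : ℝ) ^ (d / 2 : ℝ) : ℝ) : ℂ) := by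
    rw [Complex.ofReal_cpow (by positivity)]
    simp
    ring_nf
  rw [h3, ← mul_assoc, ← Complex.ofReal_mul, ← Real.rpow_add (by positivity)]
  simp

instance isProbabilityMeasure_gaussMeasure (d : ℕ) : IsProbabilityMeasure (gaussMeasure d) := by
  have hfin : IsFiniteMeasure (gaussMeasure d) := by
    have hi : Integrable (gaussDensity d) := by
      -- The Fourier formula at 0 already forces integrability: a nonintegrable density would have
      -- Bochner integral 0 instead of 1.
      by_contra hne
      have h := charFun_gaussMeasure (0 : EuclideanSpace ℝ (Fin d))
      rw [charFun_apply, integral_gaussMeasure] at h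
      simp only [inner_zero_right, Complex.ofReal_zero, zero_mul, Complex.exp_zero,
        Complex.real_smul, mul_one] at h
      rw [integral_complex_ofReal, integral_undef hne] at h
      simp at h
    exact isFiniteMeasure_withDensity_ofReal hi.2
  have h := charFun_gaussMeasure (0 : EuclideanSpace ℝ (Fin d))
  rw [charFun_zero] at h
  simp only [norm_zero, ne_eq, OfNat.ofNat_ne_zero, not_false_eq_true, zero_pow,
    Complex.ofReal_zero, neg_zero, Complex.exp_zero, Complex.ofReal_eq_one] at h
  exact ⟨by rwa [measureReal_def, ENNReal.toReal_eq_one_iff] at h⟩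

/-- The variance is 2 in each direction; this identification imports finiteness of all moments. -/
lemma gaussMeasure_eq_map (d : ℕ) :
    gaussMeasure d = (ProbabilityTheory.stdGaussian (EuclideanSpace ℝ (Fin d))).map
      (fun x => Real.sqrt 2 • x) := by
  have : IsFiniteMeasure ((ProbabilityTheory.stdGaussian (EuclideanSpace ℝ (Fin d))).map
      (fun x => Real.sqrt 2 • x)) := Measure.isFiniteMeasure_map _ _
  apply Measure.ext_of_charFun
  ext w
  rw [charFun_map_smul, ProbabilityTheory.charFun_stdGaussian, charFun_gaussMeasure, norm_smul]
  congr 1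
  rw [Real.norm_of_nonneg (Real.sqrt_nonneg 2)]
  have : ((Real.sqrt 2 : ℝ) : ℂ) ^ 2 = 2 := by
    rw [← Complex.ofReal_pow, Real.sq_sqrt zero_le_two]
    simp
  push_cast
  rw [mul_pow, this]
  ring

lemma memLp_id_gaussMeasure (d n : ℕ) : MemLp id n (gaussMeasure d) := by
  rw [gaussMeasure_eq_map, memLp_map_measure_iff (by fun_prop) (by fun_prop)]
  exact (ProbabilityTheory.IsGaussian.memLp_id _ _ (ENNReal.natCast_ne_top n)).const_smul
    (Real.sqrt 2)

lemma integrable_norm_pow_gaussMeasure (d n : ℕ) :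
    Integrable (fun x => ‖x‖ ^ n) (gaussMeasure d) :=
  (memLp_id_gaussMeasure d n).integrable_norm_pow'

/-- Polynomials times a Gaussian are stable under differentiation; iterating this update rule gives
the fourth derivative. -/
lemma deriv_mul_exp_sq (c : ℝ) (p p' : ℝ → ℂ) (hp : ∀ s, HasDerivAt p (p' s) s) :
    deriv (fun s : ℝ => p s * Complex.exp (-(c * s ^ 2 : ℝ))) =
      fun s => (p' s - 2 * c * s * p s) * Complex.exp (-(c * s ^ 2 : ℝ)) := by
  ext s
  have h1 : HasDerivAt (fun s : ℝ => c * s ^ 2) (c * (2 * s)) s := by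
    simpa using ((hasDerivAt_id s).pow 2).const_mul c
  have h2 := (hp s).mul (h1.ofReal_comp.neg.cexp)
  have h3 := h2.deriv
  refine h3.trans ?_
  simp only [Pi.neg_apply]
  push_cast
  ring

lemma hasDerivAt_ofReal_pow (n : ℕ) (s : ℝ) :
    HasDerivAt (fun s : ℝ => (s : ℂ) ^ n) (n * (s : ℂ) ^ (n - 1)) s := by
  simpa using (hasDerivAt_pow n s).ofReal_comp

lemma iteratedDeriv_four_exp_sq (c : ℝ) :
    iteratedDeriv 4 (fun s : ℝ => Complex.exp (-(c * s ^ 2 : ℝ))) 0 = 12 * c ^ 2 := by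
  have h1 := deriv_mul_exp_sq c (fun _ => 1) (fun _ => 0) (fun s => hasDerivAt_const s 1)
  have h2 := deriv_mul_exp_sq c (fun s => -2 * c * s) (fun _ => -2 * c)
    (fun s => by simpa using (hasDerivAt_ofReal_pow 1 s).const_mul (-2 * c : ℂ))
  have h3 := deriv_mul_exp_sq c (fun s => 4 * c ^ 2 * s ^ 2 - 2 * c) (fun s => 4 * c ^ 2 * (2 * s))
    (fun s => by simpa using (hasDerivAt_ofReal_pow 2 s).const_mul (4 * c ^ 2 : ℂ))
  have h4 := deriv_mul_exp_sq c (fun s => 12 * c ^ 2 * s - 8 * c ^ 3 * s ^ 3)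
    (fun s => 12 * c ^ 2 - 8 * c ^ 3 * (3 * s ^ 2))
    (fun s => by
      simpa using! ((hasDerivAt_ofReal_pow 1 s).const_mul (12 * c ^ 2 : ℂ)).sub
        ((hasDerivAt_ofReal_pow 3 s).const_mul (8 * c ^ 3 : ℂ)))
  rw [iteratedDeriv_succ', iteratedDeriv_succ', iteratedDeriv_succ', iteratedDeriv_succ',
    iteratedDeriv_zero]
  simp only [one_mul] at h1
  rw [h1]
  have e1 : (fun s : ℝ => (0 - 2 * (c : ℂ) * s * 1) * Complex.exp (-(c * s ^ 2 : ℝ))) =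
      fun s : ℝ => (-2 * c * s) * Complex.exp (-(c * s ^ 2 : ℝ)) := by
    ext s; ring
  rw [e1, h2]
  have e2 : (fun s : ℝ => (-2 * (c : ℂ) - 2 * c * s * (-2 * c * s)) *
      Complex.exp (-(c * s ^ 2 : ℝ))) =
      fun s : ℝ => (4 * c ^ 2 * s ^ 2 - 2 * c) * Complex.exp (-(c * s ^ 2 : ℝ)) := by
    ext s; ring
  rw [e2, h3]
  have e3 : (fun s : ℝ => (4 * (c : ℂ) ^ 2 * (2 * s) - 2 * c * s * (4 * c ^ 2 * s ^ 2 - 2 * c)) *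
      Complex.exp (-(c * s ^ 2 : ℝ))) =
      fun s : ℝ => (12 * c ^ 2 * s - 8 * c ^ 3 * s ^ 3) * Complex.exp (-(c * s ^ 2 : ℝ)) := by
    ext s; ring
  rw [e3, h4]
  simp

lemma charFun_map_inner {d : ℕ} (μ : Measure (EuclideanSpace ℝ (Fin d)))
    (x : EuclideanSpace ℝ (Fin d)) (s : ℝ) :
    charFun (μ.map fun y => ⟪y, x⟫) s = charFun μ (s • x) := by
  rw [charFun_apply, charFun_apply, integral_map (by fun_prop) (by fun_prop)]
  simp [inner_smul_right, mul_comm]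

/-- The fourth moments of the Gaussian measure. -/
lemma integral_inner_pow_four_gaussMeasure {d : ℕ} (x : EuclideanSpace ℝ (Fin d)) :
    ∫ ξ, ⟪ξ, x⟫ ^ 4 ∂(gaussMeasure d) = 12 * ‖x‖ ^ 4 := by
  have hm : IsProbabilityMeasure ((gaussMeasure d).map fun y => ⟪y, x⟫) :=
    Measure.isProbabilityMeasure_map (by fun_prop)
  have hL : MemLp id (4 : ℕ) ((gaussMeasure d).map fun y => ⟪y, x⟫) := by
    rw [memLp_map_measure_iff (by fun_prop) (by fun_prop)]
    refine MemLp.of_le_mul (c := ‖x‖) (memLp_id_gaussMeasure d 4) (by fun_prop) ?_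
    refine ae_of_all _ fun y => ?_
    simp only [Function.comp, id]
    rw [mul_comm]
    exact norm_inner_le_norm y x
  have h := iteratedDeriv_charFun_zero hL
  have h2 : charFun ((gaussMeasure d).map fun y => ⟪y, x⟫) =
      fun s : ℝ => Complex.exp (-(‖x‖ ^ 2 * s ^ 2 : ℝ)) := by
    ext s
    rw [charFun_map_inner, charFun_gaussMeasure, norm_smul]
    congr 2
    rw [mul_pow, Real.norm_eq_abs, sq_abs, mul_comm]
  rw [h2, iteratedDeriv_four_exp_sq, integral_map (by fun_prop) (by fun_prop)] at h
  have h3 : Complex.I ^ 4 = 1 := Complex.I_pow_four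
  rw [h3, one_mul] at h
  have h4 : ((12 * ‖x‖ ^ 4 : ℝ) : ℂ) = ((∫ ξ, ⟪ξ, x⟫ ^ 4 ∂(gaussMeasure d) : ℝ) : ℂ) := by
    rw [← h]
    push_cast
    ring
  exact (Complex.ofReal_injective h4).symm

end

noncomputable section
open Set Filter Topology
open scoped RealInnerProductSpace SchwartzMap FourierTransform

variable {d : ℕ}

/-! ### A negative Sobolev norm of the difference of two measures -/

/-- The difference of the characteristic functions of two measures. -/
def charDiff (ρ σ : Measure (EuclideanSpace ℝ (Fin d))) (k : EuclideanSpace ℝ (Fin d)) : ℂ :=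
  charFun ρ k - charFun σ k

/-- The squared norm of `ρ - σ` in the Sobolev space of order `-(d + 1)`. -/
def sobolevSq (ρ σ : Measure (EuclideanSpace ℝ (Fin d))) : ℝ :=
  ∫ k, ((1 + ‖k‖ ^ 2) ^ (d + 1))⁻¹ * ‖charDiff ρ σ k‖ ^ 2

section
variable (ρ σ : Measure (EuclideanSpace ℝ (Fin d)))
  [IsProbabilityMeasure ρ] [IsProbabilityMeasure σ]

lemma measurable_charDiff : Measurable (charDiff ρ σ) :=
  measurable_charFun.sub measurable_charFun

lemma norm_charDiff_le (k : EuclideanSpace ℝ (Fin d)) : ‖charDiff ρ σ k‖ ≤ 2 :=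
  (norm_sub_le _ _).trans ((add_le_add (norm_charFun_le_one k) (norm_charFun_le_one k)).trans
    (by norm_num))

/-- The order is negative enough, `2 (d + 1) > d`, that boundedness of characteristic functions
suffices. -/
lemma integrable_sobolevSq :
    Integrable (fun k => ((1 + ‖k‖ ^ 2) ^ (d + 1))⁻¹ * ‖charDiff ρ σ k‖ ^ 2) := by
  have h := integrable_rpow_neg_one_add_norm_sq (E := EuclideanSpace ℝ (Fin d)) (μ := volume)
    (r := 2 * (d + 1)) (by simp; linarith)
  refine Integrable.mono' (h.mul_const 4) ?_ (ae_of_all _ fun k => ?_)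
  · have := measurable_charDiff ρ σ
    exact Measurable.aestronglyMeasurable (by fun_prop)
  · have h1 : (1 + ‖k‖ ^ 2) ^ (-(2 * ((d : ℝ) + 1)) / 2) = ((1 + ‖k‖ ^ 2) ^ (d + 1))⁻¹ := by
      rw [show -(2 * ((d : ℝ) + 1)) / 2 = -((d + 1 : ℕ) : ℝ) by push_cast; ring,
        Real.rpow_neg (by positivity), Real.rpow_natCast]
    rw [h1, Real.norm_of_nonneg (by positivity)]
    have := norm_charDiff_le ρ σ k
    gcongr
    nlinarith [norm_nonneg (charDiff ρ σ k)]

end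

lemma integral_mul_le_sqrt_mul_sqrt {α : Type*} [MeasurableSpace α] {μ : Measure α} {f g : α → ℝ}
    (hf0 : 0 ≤ f) (hg0 : 0 ≤ g) (hfm : AEStronglyMeasurable f μ) (hgm : AEStronglyMeasurable g μ)
    (hf : Integrable (fun x => f x ^ 2) μ) (hg : Integrable (fun x => g x ^ 2) μ) :
    ∫ x, f x * g x ∂μ ≤ √(∫ x, f x ^ 2 ∂μ) * √(∫ x, g x ^ 2 ∂μ) := by
  have h := integral_mul_le_Lp_mul_Lq_of_nonneg Real.HolderConjugate.two_two
    (ae_of_all μ hf0) (ae_of_all μ hg0)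
    (by simpa using (memLp_two_iff_integrable_sq hfm).2 hf)
    (by simpa using (memLp_two_iff_integrable_sq hgm).2 hg)
  simpa [Real.sqrt_eq_rpow] using h

/-- Peetre's inequality: it splits the Sobolev weight at a shifted frequency into a weight on the
test function and a weight on the shift. -/
lemma one_add_norm_add_sq_le {V : Type*} [SeminormedAddCommGroup V] (x y : V) :
    1 + ‖x + y‖ ^ 2 ≤ 2 * (1 + ‖x‖ ^ 2) * (1 + ‖y‖ ^ 2) := by
  have h := norm_add_le x y
  have h2 : ‖x + y‖ ^ 2 ≤ (‖x‖ + ‖y‖) ^ 2 := by gcongr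
  nlinarith [sq_nonneg (‖x‖ - ‖y‖), mul_nonneg (sq_nonneg ‖x‖) (sq_nonneg ‖y‖)]

lemma integrable_sq_mul_schwartz (φ : 𝓢(EuclideanSpace ℝ (Fin d), ℂ)) (m : ℕ) :
    Integrable (fun v => ‖φ v‖ ^ 2 * (2 * (1 + ‖(2 * Real.pi) • v‖ ^ 2)) ^ m) := by
  set B := SchwartzMap.seminorm ℝ 0 0 φ
  have h0 := φ.integrable_pow_mul volume 0
  have h1 := φ.integrable_pow_mul volume (2 * m)
  have hI := (h0.const_mul (B * (2 ^ m * 2 ^ (m - 1)))).add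
    (h1.const_mul (B * (2 ^ m * 2 ^ (m - 1) * (2 * Real.pi) ^ (2 * m))))
  refine Integrable.mono' hI ?_ (ae_of_all _ fun v => ?_)
  · have := φ.continuous
    exact Continuous.aestronglyMeasurable (by fun_prop)
  · rw [Real.norm_of_nonneg (by positivity), norm_smul, Real.norm_of_nonneg (by positivity)]
    have hB : ‖φ v‖ ≤ B := SchwartzMap.norm_le_seminorm ℝ φ v
    have h2 := add_pow_le zero_le_one (sq_nonneg (2 * Real.pi * ‖v‖)) m
    simp only [Pi.add_apply]
    calc ‖φ v‖ ^ 2 * (2 * (1 + (2 * Real.pi * ‖v‖) ^ 2)) ^ m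
        = ‖φ v‖ * ‖φ v‖ * (2 ^ m * (1 + (2 * Real.pi * ‖v‖) ^ 2) ^ m) := by rw [mul_pow]; ring
      _ ≤ B * ‖φ v‖ * (2 ^ m * (2 ^ (m - 1) * (1 ^ m + ((2 * Real.pi * ‖v‖) ^ 2) ^ m))) := by
          gcongr
      _ = _ := by
          rw [← pow_mul, mul_pow (2 * Real.pi)]
          ring

/-- Fourier inversion and Fubini. The factor `2 * π` reconciles the normalizations of `𝓕` and
`charFun`. -/
lemma integral_schwartz_mul_char (ψ : 𝓢(EuclideanSpace ℝ (Fin d), ℂ))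
    (ρ : Measure (EuclideanSpace ℝ (Fin d))) [IsProbabilityMeasure ρ]
    (κ : EuclideanSpace ℝ (Fin d)) :
    ∫ x, ψ x * Complex.exp ((⟪x, κ⟫ : ℝ) * Complex.I) ∂ρ =
      ∫ v, 𝓕 ψ v * charFun ρ ((2 * Real.pi) • v + κ) := by
  set φ : 𝓢(EuclideanSpace ℝ (Fin d), ℂ) := 𝓕 ψ with hφ
  have hinv : ∀ x, ψ x = ∫ v, Complex.exp ((2 * Real.pi * ⟪v, x⟫ : ℝ) * Complex.I) * φ v := by
    intro x
    have h1 : ψ = 𝓕⁻ φ := (FourierTransform.fourierInv_fourier_eq ψ).symm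
    conv_lhs => rw [h1]
    rw [SchwartzMap.fourierInv_coe, Real.fourierInv_eq']
    simp
  have hswap : Integrable (Function.uncurry fun (x v : EuclideanSpace ℝ (Fin d)) =>
      φ v * Complex.exp ((⟪x, (2 * Real.pi) • v + κ⟫ : ℝ) * Complex.I)) (ρ.prod volume) := by
    refine Integrable.mono' (φ.integrable.norm.comp_snd ρ) ?_ (ae_of_all _ fun p => ?_)
    · have := φ.continuous
      refine Continuous.aestronglyMeasurable ?_
      simp only [Function.uncurry_def]
      fun_prop
    · simp [Function.uncurry_def, Complex.norm_exp_ofReal_mul_I]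
  calc ∫ x, ψ x * Complex.exp ((⟪x, κ⟫ : ℝ) * Complex.I) ∂ρ
      = ∫ x, (∫ v, φ v * Complex.exp ((⟪x, (2 * Real.pi) • v + κ⟫ : ℝ) * Complex.I)) ∂ρ := by
        congr 1
        ext x
        rw [hinv x, ← integral_mul_const]
        congr 1
        ext v
        rw [inner_add_right, inner_smul_right, real_inner_comm, Complex.ofReal_add, add_mul,
          Complex.exp_add]
        ring
    _ = ∫ v, (∫ x, φ v * Complex.exp ((⟪x, (2 * Real.pi) • v + κ⟫ : ℝ) * Complex.I) ∂ρ) :=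
        integral_integral_swap hswap
    _ = _ := by
        congr 1
        ext v
        rw [integral_const_mul, charFun_apply]

/-- Duality between Schwartz functions and the negative Sobolev norm. -/
lemma exists_schwartz_dual (ψ : 𝓢(EuclideanSpace ℝ (Fin d), ℂ)) :
    ∃ C : ℝ, 0 ≤ C ∧ ∀ (ρ σ : Measure (EuclideanSpace ℝ (Fin d))), IsProbabilityMeasure ρ →
      IsProbabilityMeasure σ → ∀ κ : EuclideanSpace ℝ (Fin d),
      ‖∫ x, ψ x * Complex.exp ((⟪x, κ⟫ : ℝ) * Complex.I) ∂ρ -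
        ∫ x, ψ x * Complex.exp ((⟪x, κ⟫ : ℝ) * Complex.I) ∂σ‖ ≤
        C * (1 + ‖κ‖) ^ (d + 1) * √(sobolevSq ρ σ) := by
  set φ : 𝓢(EuclideanSpace ℝ (Fin d), ℂ) := 𝓕 ψ with hφ
  have hI := integrable_sq_mul_schwartz φ (d + 1)
  refine ⟨√(∫ v, ‖φ v‖ ^ 2 * (2 * (1 + ‖(2 * Real.pi) • v‖ ^ 2)) ^ (d + 1)), Real.sqrt_nonneg _,
    fun ρ σ _ _ κ => ?_⟩
  have hφc := φ.continuous
  have hDm := measurable_charDiff ρ σ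
  have hint : ∀ (τ : Measure (EuclideanSpace ℝ (Fin d))), IsProbabilityMeasure τ →
      Integrable fun v => φ v * charFun τ ((2 * Real.pi) • v + κ) := by
    intro τ hτ
    refine Integrable.mono' φ.integrable.norm ?_ (ae_of_all _ fun v => ?_)
    · exact hφc.aestronglyMeasurable.mul
        ((measurable_charFun.comp (by fun_prop)).aestronglyMeasurable)
    · rw [norm_mul]
      exact mul_le_of_le_one_right (norm_nonneg _) (norm_charFun_le_one _)
  rw [integral_schwartz_mul_char, integral_schwartz_mul_char,
    ← integral_sub (hint ρ inferInstance) (hint σ inferInstance)]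
  -- Cauchy–Schwarz with the weight split evenly: `f` carries its positive root together with the
  -- test function, and `H` is the integrand of `sobolevSq`.
  set f : EuclideanSpace ℝ (Fin d) → ℝ := fun v =>
    ‖φ v‖ * √((1 + ‖(2 * Real.pi) • v + κ‖ ^ 2) ^ (d + 1)) with hf
  set H : EuclideanSpace ℝ (Fin d) → ℝ := fun k =>
    ((1 + ‖k‖ ^ 2) ^ (d + 1))⁻¹ * ‖charDiff ρ σ k‖ ^ 2 with hH
  have hH0 : ∀ k, 0 ≤ H k := fun k => by positivity
  have hHi : Integrable H := integrable_sobolevSq ρ σ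
  have hHm : Measurable H := by fun_prop
  have hHi2 : Integrable fun v => H ((2 * Real.pi) • v + κ) :=
    (hHi.comp_add_right κ).comp_smul (by positivity : 2 * Real.pi ≠ 0)
  have hHle : ∫ v, H ((2 * Real.pi) • v + κ) ≤ sobolevSq ρ σ := by
    rw [Measure.integral_comp_smul volume (fun u => H (u + κ)) (2 * Real.pi),
      integral_add_right_eq_self H κ, smul_eq_mul]
    have h1 : |((2 * Real.pi) ^ Module.finrank ℝ (EuclideanSpace ℝ (Fin d)))⁻¹| ≤ 1 := by
      rw [abs_of_nonneg (by positivity)]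
      exact inv_le_one_of_one_le₀ (one_le_pow₀ (by linarith [Real.pi_gt_three]))
    exact mul_le_of_le_one_left (integral_nonneg hH0) h1
  have hf2 : ∀ v, f v ^ 2 ≤
      (‖φ v‖ ^ 2 * (2 * (1 + ‖(2 * Real.pi) • v‖ ^ 2)) ^ (d + 1)) * ((1 + ‖κ‖) ^ (d + 1)) ^ 2 := by
    intro v
    simp only [hf, mul_pow, Real.sq_sqrt (show 0 ≤ (1 + ‖(2 * Real.pi) • v + κ‖ ^ 2) ^ (d + 1) by
      positivity)]
    have h1 := one_add_norm_add_sq_le ((2 * Real.pi) • v) κ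
    have h2 : 1 + ‖κ‖ ^ 2 ≤ (1 + ‖κ‖) ^ 2 := by nlinarith [norm_nonneg κ]
    calc ‖φ v‖ ^ 2 * (1 + ‖(2 * Real.pi) • v + κ‖ ^ 2) ^ (d + 1)
        ≤ ‖φ v‖ ^ 2 * (2 * (1 + ‖(2 * Real.pi) • v‖ ^ 2) * (1 + ‖κ‖) ^ 2) ^ (d + 1) := by
          gcongr
          exact h1.trans (by gcongr)
      _ = _ := by
        rw [mul_pow, mul_pow, ← pow_mul, ← pow_mul, mul_comm 2 (d + 1)]
        ring
  have hfm : Continuous f := by fun_prop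
  have hfi : Integrable fun v => f v ^ 2 := by
    refine Integrable.mono' (hI.mul_const (((1 + ‖κ‖) ^ (d + 1)) ^ 2))
      (by fun_prop) (ae_of_all _ fun v => ?_)
    rw [Real.norm_of_nonneg (sq_nonneg _)]
    exact hf2 v
  calc ‖∫ v, (φ v * charFun ρ ((2 * Real.pi) • v + κ) - φ v * charFun σ ((2 * Real.pi) • v + κ))‖
      ≤ ∫ v, ‖φ v * charFun ρ ((2 * Real.pi) • v + κ) - φ v * charFun σ ((2 * Real.pi) • v + κ)‖ :=
        norm_integral_le_integral_norm _
    _ = ∫ v, f v * √(H ((2 * Real.pi) • v + κ)) := by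
        congr 1
        ext v
        rw [← mul_sub, norm_mul, hf, hH]
        simp only
        rw [mul_assoc, ← Real.sqrt_mul (by positivity), ← mul_assoc, mul_inv_cancel₀ (by positivity),
          one_mul, Real.sqrt_sq (norm_nonneg _), charDiff]
    _ ≤ √(∫ v, f v ^ 2) * √(∫ v, √(H ((2 * Real.pi) • v + κ)) ^ 2) := by
        apply integral_mul_le_sqrt_mul_sqrt
        · exact fun v => by positivity
        · exact fun v => Real.sqrt_nonneg _
        · exact hfm.aestronglyMeasurable
        · exact ((hHm.comp (by fun_prop)).sqrt).aestronglyMeasurable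
        · exact hfi
        · simp_rw [Real.sq_sqrt (hH0 _)]
          exact hHi2
    _ ≤ √((∫ v, ‖φ v‖ ^ 2 * (2 * (1 + ‖(2 * Real.pi) • v‖ ^ 2)) ^ (d + 1)) *
          ((1 + ‖κ‖) ^ (d + 1)) ^ 2) * √(sobolevSq ρ σ) := by
        simp_rw [Real.sq_sqrt (hH0 _)]
        gcongr
        rw [← integral_mul_const]
        exact integral_mono hfi (hI.mul_const _) hf2
    _ = _ := by
        rw [Real.sqrt_mul' _ (sq_nonneg _), Real.sqrt_sq (by positivity)]

/-- The oscillating moments of a difference of measures on a ball are controlled by its negative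
Sobolev norm. -/
lemma exists_moment_dual (d : ℕ) {R : ℝ} (hR : 0 < R) (n : ℕ) :
    ∃ C : ℝ, 0 ≤ C ∧ ∀ (ρ σ : Measure (EuclideanSpace ℝ (Fin d))), IsProbabilityMeasure ρ →
      IsProbabilityMeasure σ → (∀ᵐ x ∂ρ, ‖x‖ ≤ R) → (∀ᵐ x ∂σ, ‖x‖ ≤ R) →
      ∀ k κ : EuclideanSpace ℝ (Fin d),
      ‖∫ x, ((⟪x, k⟫ ^ n : ℝ) : ℂ) * Complex.exp ((⟪x, κ⟫ : ℝ) * Complex.I) ∂ρ -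
        ∫ x, ((⟪x, k⟫ ^ n : ℝ) : ℂ) * Complex.exp ((⟪x, κ⟫ : ℝ) * Complex.I) ∂σ‖ ≤
        C * ‖k‖ ^ n * (1 + ‖κ‖) ^ (d + 1) * √(sobolevSq ρ σ) := by
  -- The cutoff equals 1 on the supports, so it makes monomials Schwartz without changing the
  -- integrals.
  let χ : ContDiffBump (0 : EuclideanSpace ℝ (Fin d)) := ⟨R, R + 1, hR, by linarith⟩
  let g : (Fin n → Fin d) → EuclideanSpace ℝ (Fin d) → ℂ :=
    fun p x => ((χ x * ∏ j, x (p j) : ℝ) : ℂ)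
  have hgs : ∀ p, HasCompactSupport (g p) := by
    intro p
    have : HasCompactSupport fun x => χ x * ∏ j, x (p j) := χ.hasCompactSupport.mul_right
    exact this.comp_left (g := Complex.ofReal) Complex.ofReal_zero
  have hgd : ∀ p, ContDiff ℝ (⊤ : ℕ∞) (g p) := by
    intro p
    refine Complex.ofRealCLM.contDiff.comp (χ.contDiff.mul ?_)
    exact contDiff_prod fun j _ => by fun_prop
  let ψ : (Fin n → Fin d) → 𝓢(EuclideanSpace ℝ (Fin d), ℂ) :=
    fun p => (hgs p).toSchwartzMap (hgd p)
  have hψ : ∀ p x, ‖x‖ ≤ R → ψ p x = ((∏ j, x (p j) : ℝ) : ℂ) := by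
    intro p x hx
    have : χ x = 1 := χ.one_of_mem_closedBall (by simpa using hx)
    change ((χ x * ∏ j, x (p j) : ℝ) : ℂ) = _
    rw [this, one_mul]
  choose C hC0 hC using fun p => exists_schwartz_dual (ψ p)
  refine ⟨∑ p, C p, Finset.sum_nonneg fun p _ => hC0 p, fun ρ σ _ _ hρ hσ k κ => ?_⟩
  have key : ∀ (τ : Measure (EuclideanSpace ℝ (Fin d))), IsProbabilityMeasure τ →
      (∀ᵐ x ∂τ, ‖x‖ ≤ R) →
      ∫ x, ((⟪x, k⟫ ^ n : ℝ) : ℂ) * Complex.exp ((⟪x, κ⟫ : ℝ) * Complex.I) ∂τ =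
      ∑ p : Fin n → Fin d, ((∏ j, k (p j) : ℝ) : ℂ) *
        ∫ x, ψ p x * Complex.exp ((⟪x, κ⟫ : ℝ) * Complex.I) ∂τ := by
    intro τ _ hτ
    simp_rw [← integral_const_mul]
    rw [← integral_finsetSum]
    · apply integral_congr_ae
      filter_upwards [hτ] with x hx
      -- Expanding into coordinate monomials leaves finitely many test functions independent of `k`,
      -- hence a constant uniform in `k`.
      have h1 : ⟪x, k⟫ ^ n = ∑ p : Fin n → Fin d, (∏ j, k (p j)) * ∏ j, x (p j) := by
        rw [PiLp.inner_apply, Fintype.sum_pow]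
        refine Finset.sum_congr rfl fun p _ => ?_
        rw [← Finset.prod_mul_distrib]
        simp
      rw [h1, Complex.ofReal_sum, Finset.sum_mul]
      refine Finset.sum_congr rfl fun p _ => ?_
      rw [hψ p x hx]
      push_cast
      ring
    · intro p _
      apply Integrable.const_mul
      refine Integrable.mono' (integrable_const (SchwartzMap.seminorm ℝ 0 0 (ψ p))) ?_
        (ae_of_all _ fun x => ?_)
      · have := (ψ p).continuous
        exact Continuous.aestronglyMeasurable (by fun_prop)
      · rw [norm_mul, Complex.norm_exp_ofReal_mul_I, mul_one]
        exact SchwartzMap.norm_le_seminorm ℝ (ψ p) x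
  rw [key ρ inferInstance hρ, key σ inferInstance hσ, ← Finset.sum_sub_distrib]
  refine (norm_sum_le _ _).trans ?_
  simp_rw [Finset.sum_mul]
  refine Finset.sum_le_sum fun p _ => ?_
  rw [← mul_sub, norm_mul]
  have h1 : ‖((∏ j, k (p j) : ℝ) : ℂ)‖ ≤ ‖k‖ ^ n := by
    rw [Complex.norm_real, norm_prod]
    refine (Finset.prod_le_prod (fun _ _ => norm_nonneg _)
      fun j _ => PiLp.norm_apply_le k (p j)).trans ?_
    simp
  calc _ ≤ ‖k‖ ^ n * (C p * (1 + ‖κ‖) ^ (d + 1) * √(sobolevSq ρ σ)) := by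
        gcongr
        exact hC p ρ σ inferInstance inferInstance κ
    _ = _ := by ring

/-! ### Taylor expansion of the characteristic functions -/

/-- One integration step of Taylor's formula; since `s ≤ 1` the same bound can be carried through
three steps. -/
lemma norm_le_of_norm_deriv_le {f f' : ℝ → ℂ} {B : ℝ} (hf : ∀ s, HasDerivAt f (f' s) s)
    (h0 : f 0 = 0) (hB : ∀ s ∈ Icc (0 : ℝ) 1, ‖f' s‖ ≤ B) : ∀ s ∈ Icc (0 : ℝ) 1, ‖f s‖ ≤ B := by
  intro s hs
  have h := (convex_Icc (0 : ℝ) 1).norm_image_sub_le_of_norm_hasDerivWithin_le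
    (fun x _ => (hf x).hasDerivWithinAt) hB (left_mem_Icc.2 zero_le_one) hs
  rw [h0, sub_zero, sub_zero] at h
  refine h.trans ?_
  have hB0 : 0 ≤ B := (norm_nonneg _).trans (hB 0 (left_mem_Icc.2 zero_le_one))
  rw [Real.norm_of_nonneg hs.1]
  exact mul_le_of_le_one_right hB0 hs.2

/-- The difference of the second moments of two measures in the direction `k`. -/
def momentDiff (ρ σ : Measure (EuclideanSpace ℝ (Fin d))) (k : EuclideanSpace ℝ (Fin d)) : ℝ :=
  ∫ x, ⟪x, k⟫ ^ 2 ∂ρ - ∫ x, ⟪x, k⟫ ^ 2 ∂σ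

lemma memLp_id_of_norm_le {ρ : Measure (EuclideanSpace ℝ (Fin d))} [IsProbabilityMeasure ρ]
    {R : ℝ} (hρ : ∀ᵐ x ∂ρ, ‖x‖ ≤ R) (p : ENNReal) : MemLp id p ρ :=
  MemLp.of_bound (by fun_prop) R hρ

lemma memLp_map_inner {ρ : Measure (EuclideanSpace ℝ (Fin d))} [IsProbabilityMeasure ρ]
    {R : ℝ} (hρ : ∀ᵐ x ∂ρ, ‖x‖ ≤ R) (k : EuclideanSpace ℝ (Fin d)) (p : ENNReal) :
    MemLp id p (ρ.map fun y => ⟪y, k⟫) := by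
  rw [memLp_map_measure_iff (by fun_prop) (by fun_prop)]
  refine MemLp.of_le_mul (c := ‖k‖) (memLp_id_of_norm_le hρ p) (by fun_prop) ?_
  refine ae_of_all _ fun y => ?_
  simp only [Function.comp, id]
  rw [mul_comm]
  exact norm_inner_le_norm y k

/-- Along the segment from 0 to `k`, orders 0 and 1 vanish by equality of masses and means, and
order 2 gives the second moments. The third derivative is an oscillating third moment, so duality
bounds it by the Sobolev norm of the difference rather than merely by a constant. -/
lemma exists_taylor_charDiff (d : ℕ) {R : ℝ} (hR : 0 < R) :
    ∃ C : ℝ, 0 ≤ C ∧ ∀ (ρ σ : Measure (EuclideanSpace ℝ (Fin d))), IsProbabilityMeasure ρ →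
      IsProbabilityMeasure σ → (∀ᵐ x ∂ρ, ‖x‖ ≤ R) → (∀ᵐ x ∂σ, ‖x‖ ≤ R) →
      ∫ x, x ∂ρ = ∫ x, x ∂σ → ∀ k : EuclideanSpace ℝ (Fin d),
      ‖charDiff ρ σ k + (momentDiff ρ σ k / 2 : ℝ)‖ ≤
        C * ‖k‖ ^ 3 * (1 + ‖k‖) ^ (d + 1) * √(sobolevSq ρ σ) ∧
      |momentDiff ρ σ k| ≤ C * ‖k‖ ^ 2 * √(sobolevSq ρ σ) := by
  obtain ⟨C2, hC20, hC2⟩ := exists_moment_dual d hR 2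
  obtain ⟨C3, hC30, hC3⟩ := exists_moment_dual d hR 3
  refine ⟨C2 + C3, by positivity, fun ρ σ _ _ hρ hσ hmean k => ⟨?_, ?_⟩⟩
  · have hρm : IsProbabilityMeasure (ρ.map fun y => ⟪y, k⟫) :=
      Measure.isProbabilityMeasure_map (by fun_prop)
    have hσm : IsProbabilityMeasure (σ.map fun y => ⟪y, k⟫) :=
      Measure.isProbabilityMeasure_map (by fun_prop)
    have hval : ∀ (τ : Measure (EuclideanSpace ℝ (Fin d))), IsProbabilityMeasure τ →
        (∀ᵐ x ∂τ, ‖x‖ ≤ R) → ∀ (n : ℕ) (s : ℝ),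
        iteratedDeriv n (charFun (τ.map fun y => ⟪y, k⟫)) s = Complex.I ^ n *
          ∫ x, ((⟪x, k⟫ ^ n : ℝ) : ℂ) * Complex.exp ((⟪x, s • k⟫ : ℝ) * Complex.I) ∂τ := by
      intro τ _ hτ n s
      have : IsProbabilityMeasure (τ.map fun y => ⟪y, k⟫) :=
        Measure.isProbabilityMeasure_map (by fun_prop)
      rw [iteratedDeriv_charFun (memLp_map_inner hτ k n), integral_map (by fun_prop) (by fun_prop)]
      simp [inner_smul_right]
    have hder : ∀ (τ : Measure (EuclideanSpace ℝ (Fin d))), IsProbabilityMeasure τ →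
        (∀ᵐ x ∂τ, ‖x‖ ≤ R) → ∀ (n : ℕ) (s : ℝ),
        HasDerivAt (iteratedDeriv n (charFun (τ.map fun y => ⟪y, k⟫)))
          (iteratedDeriv (n + 1) (charFun (τ.map fun y => ⟪y, k⟫)) s) s := by
      intro τ _ hτ n s
      have : IsProbabilityMeasure (τ.map fun y => ⟪y, k⟫) :=
        Measure.isProbabilityMeasure_map (by fun_prop)
      have hcd : ContDiff ℝ (⊤ : ℕ∞) (charFun (τ.map fun y => ⟪y, k⟫)) :=
        contDiff_charFun' fun j => memLp_map_inner hτ k j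
      rw [iteratedDeriv_succ]
      exact ((hcd.differentiable_iteratedDeriv n (by exact_mod_cast WithTop.coe_lt_top _)) s).hasDerivAt
    set F : ℕ → ℝ → ℂ := fun n s => iteratedDeriv n (charFun (ρ.map fun y => ⟪y, k⟫)) s -
      iteratedDeriv n (charFun (σ.map fun y => ⟪y, k⟫)) s with hF
    have hFd : ∀ n s, HasDerivAt (F n) (F (n + 1) s) s := fun n s =>
      (hder ρ inferInstance hρ n s).sub (hder σ inferInstance hσ n s)
    have hF0 : F 0 0 = 0 := by
      simp [hF]
    have hF1 : F 1 0 = 0 := by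
      have hi : ∀ (τ : Measure (EuclideanSpace ℝ (Fin d))), IsProbabilityMeasure τ →
          (∀ᵐ x ∂τ, ‖x‖ ≤ R) → ∫ x, ⟪x, k⟫ ∂τ = ⟪∫ x, x ∂τ, k⟫ := by
        intro τ _ hτ
        have := integral_inner (𝕜 := ℝ) ((memLp_id_of_norm_le hτ 1).integrable le_rfl) k
        simp only [id] at this
        rw [real_inner_comm, ← this]
        simp_rw [real_inner_comm]
      simp only [hF, hval ρ inferInstance hρ, hval σ inferInstance hσ, pow_one, zero_smul,
        inner_zero_right, Complex.ofReal_zero, zero_mul, Complex.exp_zero, mul_one,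
        integral_complex_ofReal]
      rw [hi ρ inferInstance hρ, hi σ inferInstance hσ, hmean, sub_self]
    have hF2 : F 2 0 = -(momentDiff ρ σ k : ℂ) := by
      simp only [hF, hval ρ inferInstance hρ, hval σ inferInstance hσ, zero_smul,
        inner_zero_right, Complex.ofReal_zero, zero_mul, Complex.exp_zero, mul_one,
        integral_complex_ofReal, Complex.I_sq, momentDiff]
      push_cast
      ring
    set B := C3 * ‖k‖ ^ 3 * (1 + ‖k‖) ^ (d + 1) * √(sobolevSq ρ σ)
    have hF3 : ∀ s ∈ Icc (0 : ℝ) 1, ‖F 3 s‖ ≤ B := by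
      intro s hs
      simp only [hF, hval ρ inferInstance hρ, hval σ inferInstance hσ]
      rw [← mul_sub, norm_mul, norm_pow, Complex.norm_I, one_pow, one_mul]
      refine (hC3 ρ σ inferInstance inferInstance hρ hσ k (s • k)).trans ?_
      have : ‖s • k‖ ≤ ‖k‖ := by
        rw [norm_smul, Real.norm_of_nonneg hs.1]
        exact mul_le_of_le_one_left (norm_nonneg _) hs.2
      simp only [B]
      gcongr
    set M : ℂ := (momentDiff ρ σ k : ℂ) with hM
    -- Integrate three times from the third derivative, subtracting the Taylor polynomial at each
    -- stage.
    have h2 := norm_le_of_norm_deriv_le (f := fun s => F 2 s + M)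
      (fun s => (hFd 2 s).add_const M) (by simp [hF2]) hF3
    have hMd : ∀ s : ℝ, HasDerivAt (fun s : ℝ => (s : ℂ) * M) M s := fun s => by
      simpa using (Complex.ofRealCLM.hasDerivAt (x := s)).mul_const M
    have h1 := norm_le_of_norm_deriv_le (f := fun s => F 1 s + s * M)
      (fun s => (hFd 1 s).add (hMd s)) (by simp [hF1]) h2
    have hMd2 : ∀ s : ℝ, HasDerivAt (fun s : ℝ => (s : ℂ) ^ 2 * (M / 2)) (s * M) s := fun s => by
      convert! (hasDerivAt_ofReal_pow 2 s).mul_const (M / 2) using 1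
      push_cast
      ring
    have h0 := norm_le_of_norm_deriv_le (f := fun s => F 0 s + s ^ 2 * (M / 2))
      (fun s => (hFd 0 s).add (hMd2 s)) (by simp [hF0]) h1 1 (right_mem_Icc.2 zero_le_one)
    have he : F 0 1 = charDiff ρ σ k := by
      simp [hF, charDiff, charFun_map_inner]
    rw [he] at h0
    simp only [Complex.ofReal_one, one_pow, one_mul] at h0
    have h3 : ((momentDiff ρ σ k / 2 : ℝ) : ℂ) = M / 2 := by
      rw [hM]
      push_cast
      ring
    rw [h3]
    refine h0.trans ?_
    simp only [B]
    gcongr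
    linarith
  · have h := hC2 ρ σ inferInstance inferInstance hρ hσ k 0
    simp only [inner_zero_right, Complex.ofReal_zero, zero_mul, Complex.exp_zero, mul_one,
      integral_complex_ofReal, norm_zero, add_zero, one_pow] at h
    rw [← Complex.ofReal_sub, Complex.norm_real, Real.norm_eq_abs] at h
    refine h.trans ?_
    gcongr
    linarith

end

noncomputable section
open Set Filter Topology
open scoped RealInnerProductSpace

variable {d : ℕ}

/-! ### Quadratic forms of differences of measures -/

/-- The positive part `ρ ⊗ ρ + σ ⊗ σ` of `(ρ - σ) ⊗ (ρ - σ)`. -/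
def pairPos (ρ σ : Measure (EuclideanSpace ℝ (Fin d))) :
    Measure (EuclideanSpace ℝ (Fin d) × EuclideanSpace ℝ (Fin d)) :=
  ρ.prod ρ + σ.prod σ

/-- The negative part `ρ ⊗ σ + σ ⊗ ρ` of `(ρ - σ) ⊗ (ρ - σ)`. -/
def pairNeg (ρ σ : Measure (EuclideanSpace ℝ (Fin d))) :
    Measure (EuclideanSpace ℝ (Fin d) × EuclideanSpace ℝ (Fin d)) :=
  ρ.prod σ + σ.prod ρ

/-- The integral of `F` with respect to `(ρ - σ) ⊗ (ρ - σ)`. -/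
def quadForm {V : Type*} [NormedAddCommGroup V] [NormedSpace ℝ V]
    (ρ σ : Measure (EuclideanSpace ℝ (Fin d)))
    (F : EuclideanSpace ℝ (Fin d) × EuclideanSpace ℝ (Fin d) → V) : V :=
  ∫ p, F p ∂(pairPos ρ σ) - ∫ p, F p ∂(pairNeg ρ σ)

lemma ae_prod_norm_le {ρ σ : Measure (EuclideanSpace ℝ (Fin d))} [SFinite σ] {R : ℝ} (hρ : ∀ᵐ x ∂ρ, ‖x‖ ≤ R) (hσ : ∀ᵐ x ∂σ, ‖x‖ ≤ R) :
    ∀ᵐ p ∂(ρ.prod σ), ‖p.1‖ ≤ R ∧ ‖p.2‖ ≤ R :=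
  (Measure.quasiMeasurePreserving_fst.ae hρ).and (Measure.quasiMeasurePreserving_snd.ae hσ)

lemma ae_pair_norm_le {ρ σ : Measure (EuclideanSpace ℝ (Fin d))} [SFinite ρ] [SFinite σ] {R : ℝ} (hρ : ∀ᵐ x ∂ρ, ‖x‖ ≤ R) (hσ : ∀ᵐ x ∂σ, ‖x‖ ≤ R) :
    (∀ᵐ p ∂(pairPos ρ σ), ‖p.1‖ ≤ R ∧ ‖p.2‖ ≤ R) ∧
      (∀ᵐ p ∂(pairNeg ρ σ), ‖p.1‖ ≤ R ∧ ‖p.2‖ ≤ R) :=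
  ⟨ae_add_measure_iff.2 ⟨ae_prod_norm_le hρ hρ, ae_prod_norm_le hσ hσ⟩,
    ae_add_measure_iff.2 ⟨ae_prod_norm_le hρ hσ, ae_prod_norm_le hσ hρ⟩⟩

section
variable {V : Type*} [NormedAddCommGroup V] [NormedSpace ℝ V]
  (ρ σ : Measure (EuclideanSpace ℝ (Fin d)))

lemma quadForm_eq {F : EuclideanSpace ℝ (Fin d) × EuclideanSpace ℝ (Fin d) → V}
    (hF : Integrable F (pairPos ρ σ)) (hF' : Integrable F (pairNeg ρ σ)) :
    quadForm ρ σ F = (∫ p, F p ∂(ρ.prod ρ) + ∫ p, F p ∂(σ.prod σ)) -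
      (∫ p, F p ∂(ρ.prod σ) + ∫ p, F p ∂(σ.prod ρ)) := by
  obtain ⟨h1, h2⟩ := integrable_add_measure.1 hF
  obtain ⟨h3, h4⟩ := integrable_add_measure.1 hF'
  rw [quadForm, pairPos, pairNeg, integral_add_measure h1 h2, integral_add_measure h3 h4]

variable [IsProbabilityMeasure ρ] [IsProbabilityMeasure σ]

instance : IsFiniteMeasure (pairPos ρ σ) := by unfold pairPos; infer_instance
instance : IsFiniteMeasure (pairNeg ρ σ) := by unfold pairNeg; infer_instance

lemma quadForm_const (c : ℝ) : quadForm ρ σ (fun _ => c) = 0 := by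
  rw [quadForm_eq _ _ (integrable_const _) (integrable_const _)]
  simp

lemma quadForm_swap [CompleteSpace V] {α : Type*} [MeasurableSpace α] {ν : Measure α} [SFinite ν]
    {F : α → EuclideanSpace ℝ (Fin d) × EuclideanSpace ℝ (Fin d) → V}
    (h : Integrable (Function.uncurry F) (ν.prod (pairPos ρ σ)))
    (h' : Integrable (Function.uncurry F) (ν.prod (pairNeg ρ σ))) :
    Integrable (fun t => quadForm ρ σ (F t)) ν ∧
      ∫ t, quadForm ρ σ (F t) ∂ν = quadForm ρ σ (fun p => ∫ t, F t p ∂ν) := by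
  refine ⟨h.integral_prod_left.sub h'.integral_prod_left, ?_⟩
  have e := integral_sub h.integral_prod_left h'.integral_prod_left
  simp only [Function.uncurry_apply_pair] at e
  unfold quadForm
  rw [e, integral_integral_swap h, integral_integral_swap h']

/-! ### Gaussian forms -/

/-- The quadratic form of a Gaussian kernel. -/
def gaussForm (ρ σ : Measure (EuclideanSpace ℝ (Fin d))) (t : ℝ) : ℝ :=
  quadForm ρ σ fun p => Real.exp (-t * ‖p.1 - p.2‖ ^ 2)

/-- A character of `x - y` factors under product measures, so the four terms assemble into a squared
modulus. -/
lemma quadForm_char (k : EuclideanSpace ℝ (Fin d)) :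
    quadForm ρ σ (fun p => Complex.exp ((⟪k, p.1 - p.2⟫ : ℝ) * Complex.I)) =
      ((‖charDiff ρ σ k‖ ^ 2 : ℝ) : ℂ) := by
  have hc : Continuous fun p : EuclideanSpace ℝ (Fin d) × EuclideanSpace ℝ (Fin d) =>
    Complex.exp ((⟪k, p.1 - p.2⟫ : ℝ) * Complex.I) := by fun_prop
  have hi : ∀ τ : Measure (EuclideanSpace ℝ (Fin d) × EuclideanSpace ℝ (Fin d)),
      IsFiniteMeasure τ →
      Integrable (fun p : EuclideanSpace ℝ (Fin d) × EuclideanSpace ℝ (Fin d) =>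
        Complex.exp ((⟪k, p.1 - p.2⟫ : ℝ) * Complex.I)) τ := by
    intro τ _
    exact Integrable.mono' (integrable_const 1) hc.aestronglyMeasurable
      (ae_of_all _ fun p => by rw [Complex.norm_exp_ofReal_mul_I])
  have hp : ∀ τ₁ τ₂ : Measure (EuclideanSpace ℝ (Fin d)), IsProbabilityMeasure τ₁ →
      IsProbabilityMeasure τ₂ →
      ∫ p, Complex.exp ((⟪k, p.1 - p.2⟫ : ℝ) * Complex.I) ∂(τ₁.prod τ₂) =
      charFun τ₁ k * (starRingEnd ℂ) (charFun τ₂ k) := by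
    intro τ₁ τ₂ _ _
    rw [← charFun_neg, charFun_apply, charFun_apply, ← integral_prod_mul]
    congr 1
    ext p
    rw [← Complex.exp_add, ← add_mul, ← Complex.ofReal_add, inner_neg_right, inner_sub_right,
      real_inner_comm, real_inner_comm k p.2]
    rfl
  rw [quadForm_eq _ _ (hi _ inferInstance) (hi _ inferInstance), hp ρ ρ inferInstance inferInstance,
    hp σ σ inferInstance inferInstance, hp ρ σ inferInstance inferInstance,
    hp σ ρ inferInstance inferInstance, Complex.ofReal_pow, ← Complex.mul_conj', charDiff, map_sub]
  ring

/-- The Gaussian kernel is the characteristic function of `gaussMeasure` at `√t • (x - y)`; this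
gives its positive definiteness. -/
lemma gaussForm_eq_integral {t : ℝ} (ht : 0 ≤ t) :
    gaussForm ρ σ t = ∫ ξ, ‖charDiff ρ σ (√t • ξ)‖ ^ 2 ∂(gaussMeasure d) := by
  have hc : Continuous (Function.uncurry fun (ξ : EuclideanSpace ℝ (Fin d))
      (p : EuclideanSpace ℝ (Fin d) × EuclideanSpace ℝ (Fin d)) =>
      Complex.exp ((⟪√t • ξ, p.1 - p.2⟫ : ℝ) * Complex.I)) := by
    simp only [Function.uncurry_def]
    fun_prop
  have hi : ∀ τ : Measure (EuclideanSpace ℝ (Fin d) × EuclideanSpace ℝ (Fin d)),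
      IsFiniteMeasure τ →
      Integrable (Function.uncurry fun (ξ : EuclideanSpace ℝ (Fin d))
      (p : EuclideanSpace ℝ (Fin d) × EuclideanSpace ℝ (Fin d)) =>
      Complex.exp ((⟪√t • ξ, p.1 - p.2⟫ : ℝ) * Complex.I)) ((gaussMeasure d).prod τ) := by
    intro τ _
    exact Integrable.mono' (integrable_const 1) hc.aestronglyMeasurable
      (ae_of_all _ fun p => by simp only [Function.uncurry_def]; rw [Complex.norm_exp_ofReal_mul_I])
  have h := (quadForm_swap ρ σ (hi _ inferInstance) (hi _ inferInstance)).2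
  have h1 : ∀ p : EuclideanSpace ℝ (Fin d) × EuclideanSpace ℝ (Fin d),
      ∫ ξ, Complex.exp ((⟪√t • ξ, p.1 - p.2⟫ : ℝ) * Complex.I) ∂(gaussMeasure d) =
      ((Real.exp (-t * ‖p.1 - p.2‖ ^ 2) : ℝ) : ℂ) := by
    intro p
    have := charFun_gaussMeasure (√t • (p.1 - p.2))
    rw [charFun_apply] at this
    simp_rw [real_inner_smul_left, ← real_inner_smul_right]
    rw [this, norm_smul, mul_pow, Real.norm_of_nonneg (Real.sqrt_nonneg t), Real.sq_sqrt ht]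
    push_cast
    ring_nf
  simp_rw [quadForm_char, h1] at h
  rw [integral_complex_ofReal] at h
  apply Complex.ofReal_injective
  rw [h, gaussForm, quadForm, quadForm, integral_complex_ofReal, integral_complex_ofReal]
  push_cast
  rfl

lemma gaussForm_nonneg {t : ℝ} (ht : 0 ≤ t) : 0 ≤ gaussForm ρ σ t := by
  rw [gaussForm_eq_integral ρ σ ht]
  exact integral_nonneg fun _ => by positivity

lemma integrable_exp_neg_sq {t : ℝ} (ht : 0 ≤ t)
    (τ : Measure (EuclideanSpace ℝ (Fin d) × EuclideanSpace ℝ (Fin d))) [IsFiniteMeasure τ] :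
    Integrable (fun p => Real.exp (-t * ‖p.1 - p.2‖ ^ 2)) τ := by
  refine Integrable.mono' (integrable_const 1)
    (Continuous.aestronglyMeasurable (by fun_prop)) (ae_of_all _ fun p => ?_)
  rw [Real.norm_of_nonneg (Real.exp_pos _).le, Real.exp_le_one_iff]
  have : 0 ≤ t * ‖p.1 - p.2‖ ^ 2 := by positivity
  linarith

end

/-! ### Quadratic forms of polynomial kernels -/

section
variable {ρ σ : Measure (EuclideanSpace ℝ (Fin d))} [IsProbabilityMeasure ρ]
  [IsProbabilityMeasure σ] {R : ℝ}

lemma integrable_of_continuous_of_ae_le {V : Type*} [NormedAddCommGroup V] [NormedSpace ℝ V]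
    [FiniteDimensional ℝ V] {W : Type*} [NormedAddCommGroup W] [MeasurableSpace V] [BorelSpace V]
    {τ : Measure V} [IsFiniteMeasure τ] (hτ : ∀ᵐ x ∂τ, ‖x‖ ≤ R) {f : V → W} (hf : Continuous f) :
    Integrable f τ := by
  obtain ⟨C, hC⟩ := (isCompact_closedBall (0 : V) R).exists_bound_of_continuousOn hf.continuousOn
  refine Integrable.mono' (integrable_const C) hf.aestronglyMeasurable ?_
  filter_upwards [hτ] with x hx
  exact hC x (by simpa using hx)

lemma integrable_prod_of_continuous (hρ : ∀ᵐ x ∂ρ, ‖x‖ ≤ R) (hσ : ∀ᵐ x ∂σ, ‖x‖ ≤ R)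
    {W : Type*} [NormedAddCommGroup W]
    {f : EuclideanSpace ℝ (Fin d) × EuclideanSpace ℝ (Fin d) → W} (hf : Continuous f) :
    Integrable f (ρ.prod σ) := by
  refine integrable_of_continuous_of_ae_le (R := R) ?_ hf
  filter_upwards [ae_prod_norm_le hρ hσ] with p hp
  exact max_le hp.1 hp.2

lemma integrable_pair_of_continuous (hρ : ∀ᵐ x ∂ρ, ‖x‖ ≤ R) (hσ : ∀ᵐ x ∂σ, ‖x‖ ≤ R)
    {W : Type*} [NormedAddCommGroup W]
    {f : EuclideanSpace ℝ (Fin d) × EuclideanSpace ℝ (Fin d) → W} (hf : Continuous f) :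
    Integrable f (pairPos ρ σ) ∧ Integrable f (pairNeg ρ σ) :=
  ⟨(integrable_prod_of_continuous hρ hρ hf).add_measure (integrable_prod_of_continuous hσ hσ hf),
    (integrable_prod_of_continuous hρ hσ hf).add_measure (integrable_prod_of_continuous hσ hρ hf)⟩

lemma integral_prod_norm_sub_sq (hρ : ∀ᵐ x ∂ρ, ‖x‖ ≤ R) (hσ : ∀ᵐ x ∂σ, ‖x‖ ≤ R) :
    ∫ p, ‖p.1 - p.2‖ ^ 2 ∂(ρ.prod σ) =
      ∫ x, ‖x‖ ^ 2 ∂ρ - 2 * ⟪∫ x, x ∂ρ, ∫ x, x ∂σ⟫ + ∫ x, ‖x‖ ^ 2 ∂σ := by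
  have hc := fun {f : EuclideanSpace ℝ (Fin d) × EuclideanSpace ℝ (Fin d) → ℝ}
    (hf : Continuous f) => integrable_prod_of_continuous hρ hσ hf
  have h1 : ∫ p, ⟪p.1, p.2⟫ ∂(ρ.prod σ) = ⟪∫ x, x ∂ρ, ∫ x, x ∂σ⟫ := by
    rw [integral_prod _ (hc (by fun_prop))]
    have h2 : ∀ x : EuclideanSpace ℝ (Fin d), ∫ y, ⟪x, y⟫ ∂σ = ⟪x, ∫ y, y ∂σ⟫ := fun x =>
      integral_inner (𝕜 := ℝ) (integrable_of_continuous_of_ae_le hσ continuous_id) x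
    simp_rw [h2]
    simp_rw [real_inner_comm (∫ y, y ∂σ)]
    exact integral_inner (𝕜 := ℝ) (integrable_of_continuous_of_ae_le hρ continuous_id) _
  simp_rw [norm_sub_sq_real]
  rw [integral_add (hc (by fun_prop)) (hc (by fun_prop)),
    integral_sub (hc (by fun_prop)) (hc (by fun_prop)), integral_const_mul, h1,
    integral_fun_fst (fun x => ‖x‖ ^ 2), integral_fun_snd (fun x => ‖x‖ ^ 2)]
  simp

/-- The pure squares cancel because the masses agree, and the mixed term only sees the difference of
the means. -/
lemma quadForm_norm_sub_sq (hρ : ∀ᵐ x ∂ρ, ‖x‖ ≤ R) (hσ : ∀ᵐ x ∂σ, ‖x‖ ≤ R)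
    (hmean : ∫ x, x ∂ρ = ∫ x, x ∂σ) : quadForm ρ σ (fun p => ‖p.1 - p.2‖ ^ 2) = 0 := by
  have hc := integrable_pair_of_continuous hρ hσ (f := fun p => ‖p.1 - p.2‖ ^ 2) (by fun_prop)
  rw [quadForm_eq _ _ hc.1 hc.2, integral_prod_norm_sub_sq hρ hρ, integral_prod_norm_sub_sq hσ hσ,
    integral_prod_norm_sub_sq hρ hσ, integral_prod_norm_sub_sq hσ hρ, hmean]
  ring

lemma integral_prod_inner_sub_pow_four (hρ : ∀ᵐ x ∂ρ, ‖x‖ ≤ R) (hσ : ∀ᵐ x ∂σ, ‖x‖ ≤ R)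
    (k : EuclideanSpace ℝ (Fin d)) :
    ∫ p, ⟪k, p.1 - p.2⟫ ^ 4 ∂(ρ.prod σ) =
      ∫ x, ⟪x, k⟫ ^ 4 ∂ρ - 4 * (∫ x, ⟪x, k⟫ ^ 3 ∂ρ) * (∫ x, ⟪x, k⟫ ∂σ) +
      6 * (∫ x, ⟪x, k⟫ ^ 2 ∂ρ) * (∫ x, ⟪x, k⟫ ^ 2 ∂σ) -
      4 * (∫ x, ⟪x, k⟫ ∂ρ) * (∫ x, ⟪x, k⟫ ^ 3 ∂σ) + ∫ x, ⟪x, k⟫ ^ 4 ∂σ := by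
  have hc := fun {f : EuclideanSpace ℝ (Fin d) × EuclideanSpace ℝ (Fin d) → ℝ}
    (hf : Continuous f) => integrable_prod_of_continuous hρ hσ hf
  have h1 : ∀ p : EuclideanSpace ℝ (Fin d) × EuclideanSpace ℝ (Fin d),
      ⟪k, p.1 - p.2⟫ ^ 4 = ⟪p.1, k⟫ ^ 4 - 4 * (⟪p.1, k⟫ ^ 3 * ⟪p.2, k⟫) +
        6 * (⟪p.1, k⟫ ^ 2 * ⟪p.2, k⟫ ^ 2) - 4 * (⟪p.1, k⟫ * ⟪p.2, k⟫ ^ 3) + ⟪p.2, k⟫ ^ 4 := by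
    intro p
    rw [inner_sub_right, real_inner_comm, real_inner_comm p.2]
    ring
  simp_rw [h1]
  rw [integral_add (hc (by fun_prop)) (hc (by fun_prop)),
    integral_sub (hc (by fun_prop)) (hc (by fun_prop)),
    integral_add (hc (by fun_prop)) (hc (by fun_prop)),
    integral_sub (hc (by fun_prop)) (hc (by fun_prop)),
    integral_const_mul, integral_const_mul, integral_const_mul,
    integral_fun_fst (fun x => ⟪x, k⟫ ^ 4), integral_fun_snd (fun x => ⟪x, k⟫ ^ 4),
    integral_prod_mul (fun x => ⟪x, k⟫ ^ 3) (fun x => ⟪x, k⟫),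
    integral_prod_mul (fun x => ⟪x, k⟫ ^ 2) (fun x => ⟪x, k⟫ ^ 2),
    integral_prod_mul (fun x => ⟪x, k⟫) (fun x => ⟪x, k⟫ ^ 3)]
  simp only [probReal_univ, one_smul]
  ring

/-- In the binomial expansion equal masses kill the pure fourth powers and equal means kill the odd
terms; only the middle coefficient 6 survives. -/
lemma quadForm_inner_sub_pow_four (hρ : ∀ᵐ x ∂ρ, ‖x‖ ≤ R) (hσ : ∀ᵐ x ∂σ, ‖x‖ ≤ R)
    (hmean : ∫ x, x ∂ρ = ∫ x, x ∂σ) (k : EuclideanSpace ℝ (Fin d)) :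
    quadForm ρ σ (fun p => ⟪k, p.1 - p.2⟫ ^ 4) = 6 * momentDiff ρ σ k ^ 2 := by
  have hc := integrable_pair_of_continuous hρ hσ (f := fun p => ⟪k, p.1 - p.2⟫ ^ 4) (by fun_prop)
  have h1 : ∫ x, ⟪x, k⟫ ∂ρ = ∫ x, ⟪x, k⟫ ∂σ := by
    have hi : ∀ (τ : Measure (EuclideanSpace ℝ (Fin d))), IsProbabilityMeasure τ →
        (∀ᵐ x ∂τ, ‖x‖ ≤ R) → ∫ x, ⟪x, k⟫ ∂τ = ⟪k, ∫ x, x ∂τ⟫ := by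
      intro τ _ hτ
      simp_rw [real_inner_comm k]
      exact integral_inner (𝕜 := ℝ) (integrable_of_continuous_of_ae_le hτ continuous_id) k
    rw [hi ρ inferInstance hρ, hi σ inferInstance hσ, hmean]
  rw [quadForm_eq _ _ hc.1 hc.2, integral_prod_inner_sub_pow_four hρ hρ,
    integral_prod_inner_sub_pow_four hσ hσ, integral_prod_inner_sub_pow_four hρ hσ,
    integral_prod_inner_sub_pow_four hσ hρ, h1, momentDiff]
  ring

/-- The quadratic form of the quartic kernel on measures with the same mean. -/
lemma quadForm_norm_sub_pow_four (hρ : ∀ᵐ x ∂ρ, ‖x‖ ≤ R) (hσ : ∀ᵐ x ∂σ, ‖x‖ ≤ R)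
    (hmean : ∫ x, x ∂ρ = ∫ x, x ∂σ) :
    Integrable (fun ξ => momentDiff ρ σ ξ ^ 2) (gaussMeasure d) ∧
    quadForm ρ σ (fun p => ‖p.1 - p.2‖ ^ 4) =
      (∫ ξ, momentDiff ρ σ ξ ^ 2 ∂(gaussMeasure d)) / 2 := by
  have hi : ∀ τ : Measure (EuclideanSpace ℝ (Fin d) × EuclideanSpace ℝ (Fin d)),
      IsFiniteMeasure τ → (∀ᵐ p ∂τ, ‖p.1‖ ≤ R ∧ ‖p.2‖ ≤ R) →
      Integrable (Function.uncurry fun (ξ : EuclideanSpace ℝ (Fin d))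
      (p : EuclideanSpace ℝ (Fin d) × EuclideanSpace ℝ (Fin d)) =>
      ⟪ξ, p.1 - p.2⟫ ^ 4) ((gaussMeasure d).prod τ) := by
    intro τ _ hτ
    refine Integrable.mono' (((integrable_norm_pow_gaussMeasure d 4).comp_fst τ).mul_const
      ((2 * R) ^ 4)) (Continuous.aestronglyMeasurable ?_) ?_
    · simp only [Function.uncurry_def]
      fun_prop
    · filter_upwards [Measure.quasiMeasurePreserving_snd.ae hτ] with q hq
      simp only [Function.uncurry_def, norm_pow]
      rw [← mul_pow]
      refine pow_le_pow_left₀ (norm_nonneg _) ((norm_inner_le_norm _ _).trans ?_) 4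
      gcongr
      exact (norm_sub_le _ _).trans (by linarith [hq.1, hq.2])
  obtain ⟨hP, hN⟩ := ae_pair_norm_le hρ hσ
  -- The quartic kernel is a Gaussian average of fourth powers of linear forms, with fourth moment
  -- constant 12; the ratio 6 / 12 is the final 1 / 2.
  obtain ⟨h1, h2⟩ := quadForm_swap ρ σ (hi _ inferInstance hP) (hi _ inferInstance hN)
  simp_rw [quadForm_inner_sub_pow_four hρ hσ hmean, integral_inner_pow_four_gaussMeasure] at h1 h2
  constructor
  · simpa using h1.const_mul (1 / 6)
  · rw [integral_const_mul] at h2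
    have h3 : quadForm ρ σ (fun p => 12 * ‖p.1 - p.2‖ ^ 4) =
        12 * quadForm ρ σ (fun p => ‖p.1 - p.2‖ ^ 4) := by
      simp only [quadForm, integral_const_mul]
      ring
    rw [h3] at h2
    linarith

/-! ### The attractive part -/

/-- The constant and quadratic Taylor terms are invisible to a difference with zero mass and zero
mean. -/
lemma quadForm_expRemainder (hρ : ∀ᵐ x ∂ρ, ‖x‖ ≤ R) (hσ : ∀ᵐ x ∂σ, ‖x‖ ≤ R)
    (hmean : ∫ x, x ∂ρ = ∫ x, x ∂σ) (t : ℝ) :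
    quadForm ρ σ (fun p => expRemainder (t * ‖p.1 - p.2‖ ^ 2)) =
      t ^ 2 / 2 * quadForm ρ σ (fun p => ‖p.1 - p.2‖ ^ 4) - gaussForm ρ σ t := by
  have h2 := quadForm_norm_sub_sq hρ hσ hmean
  have h0 := quadForm_const ρ σ 1
  have hc := fun {f : EuclideanSpace ℝ (Fin d) × EuclideanSpace ℝ (Fin d) → ℝ}
    (hf : Continuous f) => integrable_pair_of_continuous hρ hσ hf
  have he : ∀ τ : Measure (EuclideanSpace ℝ (Fin d) × EuclideanSpace ℝ (Fin d)),
      (∀ {f : EuclideanSpace ℝ (Fin d) × EuclideanSpace ℝ (Fin d) → ℝ}, Continuous f →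
        Integrable f τ) →
      ∫ p, expRemainder (t * ‖p.1 - p.2‖ ^ 2) ∂τ = ∫ _, (1 : ℝ) ∂τ -
        t * ∫ p, ‖p.1 - p.2‖ ^ 2 ∂τ + t ^ 2 / 2 * ∫ p, ‖p.1 - p.2‖ ^ 4 ∂τ -
        ∫ p, Real.exp (-t * ‖p.1 - p.2‖ ^ 2) ∂τ := by
    intro τ hτ
    rw [← integral_const_mul, ← integral_const_mul, ← integral_sub (hτ (by fun_prop))
      (hτ (by fun_prop)), ← integral_add (hτ (by fun_prop)) (hτ (by fun_prop)),
      ← integral_sub (hτ (by fun_prop)) (hτ (by fun_prop))]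
    congr 1
    ext p
    rw [expRemainder]
    ring_nf
  rw [quadForm, he _ fun hf => (hc hf).1, he _ fun hf => (hc hf).2]
  simp only [gaussForm, quadForm] at h2 h0 ⊢
  linear_combination h0 - t * h2

lemma integrable_uncurry_of_integral {α β : Type*} [MeasurableSpace α] [MeasurableSpace β]
    {ν : Measure α} {τ : Measure β} [SFinite ν] [SFinite τ] {F : α → β → ℝ} {g : β → ℝ}
    (hm : AEStronglyMeasurable (Function.uncurry F) (ν.prod τ))
    (h0 : ∀ᵐ p ∂τ, ∀ᵐ t ∂ν, 0 ≤ F t p)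
    (h1 : ∀ᵐ p ∂τ, Integrable (fun t => F t p) ν)
    (h2 : ∀ᵐ p ∂τ, ∫ t, F t p ∂ν = g p) (hg : Integrable g τ) :
    Integrable (Function.uncurry F) (ν.prod τ) := by
  rw [integrable_prod_iff' hm]
  refine ⟨h1, hg.congr ?_⟩
  filter_upwards [h0, h2] with p hp0 hp2
  rw [← hp2]
  apply integral_congr_ae
  filter_upwards [hp0] with t ht
  simp [Real.norm_of_nonneg ht]

/-- The mixture formula integrated against the pair measures. The two terms stay under one integral
because `t ^ (1 - a / 2)` alone is not integrable at 0. -/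
lemma quadForm_norm_sub_rpow {a : ℝ} (ha : 4 < a) (ha' : a < 5)
    (hρ : ∀ᵐ x ∂ρ, ‖x‖ ≤ R) (hσ : ∀ᵐ x ∂σ, ‖x‖ ≤ R) (hmean : ∫ x, x ∂ρ = ∫ x, x ∂σ) :
    IntegrableOn (fun t => t ^ (-a / 2 - 1) *
      (t ^ 2 / 2 * quadForm ρ σ (fun p => ‖p.1 - p.2‖ ^ 4) - gaussForm ρ σ t)) (Ioi 0) ∧
    attractionConst a * quadForm ρ σ (fun p => ‖p.1 - p.2‖ ^ a) =
      ∫ t in Ioi (0 : ℝ), t ^ (-a / 2 - 1) *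
      (t ^ 2 / 2 * quadForm ρ σ (fun p => ‖p.1 - p.2‖ ^ 4) - gaussForm ρ σ t) := by
  have hi : ∀ τ : Measure (EuclideanSpace ℝ (Fin d) × EuclideanSpace ℝ (Fin d)),
      IsFiniteMeasure τ → (∀ {f : EuclideanSpace ℝ (Fin d) × EuclideanSpace ℝ (Fin d) → ℝ},
        Continuous f → Integrable f τ) →
      Integrable (Function.uncurry fun (t : ℝ)
      (p : EuclideanSpace ℝ (Fin d) × EuclideanSpace ℝ (Fin d)) =>
      t ^ (-a / 2 - 1) * expRemainder (t * ‖p.1 - p.2‖ ^ 2))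
      ((volume.restrict (Ioi (0 : ℝ))).prod τ) := by
    intro τ _ hτ
    refine integrable_uncurry_of_integral (g := fun p => attractionConst a * ‖p.1 - p.2‖ ^ a)
      ?_ ?_ ?_ ?_ ?_
    · have := continuous_expRemainder.measurable
      refine Measurable.aestronglyMeasurable ?_
      simp only [Function.uncurry_def]
      fun_prop
    · refine ae_of_all _ fun p => ae_restrict_of_forall_mem measurableSet_Ioi fun t ht => ?_
      have ht : (0 : ℝ) < t := ht
      exact mul_nonneg (Real.rpow_nonneg ht.le _) (expRemainder_nonneg (by positivity))
    · exact ae_of_all _ fun p => integrableOn_attraction_mixture ha (by linarith) (norm_nonneg _)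
    · exact ae_of_all _ fun p => integral_attraction_mixture ha (norm_nonneg _)
    · refine (hτ ?_).const_mul _
      exact Continuous.rpow_const (by fun_prop) fun _ => Or.inr (by linarith)
  have hc := fun {f : EuclideanSpace ℝ (Fin d) × EuclideanSpace ℝ (Fin d) → ℝ}
    (hf : Continuous f) => integrable_pair_of_continuous hρ hσ hf
  obtain ⟨h1, h2⟩ := quadForm_swap ρ σ (hi _ inferInstance fun hf => (hc hf).1)
    (hi _ inferInstance fun hf => (hc hf).2)
  have h3 : ∀ t : ℝ, quadForm ρ σ (fun p => t ^ (-a / 2 - 1) *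
      expRemainder (t * ‖p.1 - p.2‖ ^ 2)) = t ^ (-a / 2 - 1) *
      (t ^ 2 / 2 * quadForm ρ σ (fun p => ‖p.1 - p.2‖ ^ 4) - gaussForm ρ σ t) := by
    intro t
    rw [← quadForm_expRemainder hρ hσ hmean]
    simp only [quadForm, integral_const_mul]
    ring
  simp_rw [h3] at h1 h2
  refine ⟨h1, ?_⟩
  rw [h2]
  simp_rw [integral_attraction_mixture ha (norm_nonneg _)]
  simp only [quadForm, integral_const_mul]
  ring

end

/-! ### The repulsive part -/

/-- The integrand of the Gaussian mixture that represents `powerProfile b L - powerProfile b r`. -/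
def repKernel (b L t r : ℝ) : ℝ :=
  mixtureConst b * t ^ (-b / 2 - 1) * (Real.exp (-t * r ^ 2) - Real.exp (-t * L ^ 2))

lemma repKernel_nonneg {b L t r : ℝ} (hb : b < 2) (ht : 0 ≤ t) (hr : 0 ≤ r) (hrL : r ≤ L) :
    0 ≤ repKernel b L t r := by
  have h := mixtureConst_pos hb
  have h2 : Real.exp (-t * L ^ 2) ≤ Real.exp (-t * r ^ 2) := by
    apply Real.exp_le_exp.2
    have : r ^ 2 ≤ L ^ 2 := by gcongr
    nlinarith
  have h3 : 0 ≤ t ^ (-b / 2 - 1) := Real.rpow_nonneg ht _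
  exact mul_nonneg (mul_nonneg h.le h3) (sub_nonneg.2 h2)

lemma measurable_repKernel (b L : ℝ) :
    Measurable (fun q : ℝ × ℝ => repKernel b L q.1 q.2) := by
  unfold repKernel
  fun_prop

/-- The Gaussian mixture of `powerProfile b L - powerProfile b r`, with its value `∞` at `r = 0` if
`b ≤ 0`. -/
def repWeight (b L r : ℝ) : ENNReal := ∫⁻ t in Ioi (0 : ℝ), ENNReal.ofReal (repKernel b L t r)

lemma measurable_repWeight (b L : ℝ) : Measurable (repWeight b L) := by
  unfold repWeight
  exact ((measurable_repKernel b L).comp measurable_swap).ennreal_ofReal.lintegral_prod_right'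

lemma repWeight_eq {b : ℝ} (hb : b < 2) {r L : ℝ} (hr : 0 ≤ r) (hrL : r ≤ L) (hL : 0 < L) :
    repWeight b L r =
      if r = 0 ∧ b ≤ 0 then ⊤ else ENNReal.ofReal (powerProfile b L - powerProfile b r) :=
  lintegral_mixture hb hr hrL hL

/-- Since `repWeight` is infinite on the diagonal when `b ≤ 0`, one finite integral rules out mass
there; nonnegativity and Tonelli then give the rest. -/
lemma repWeight_data {b L : ℝ} (hb : b < 2) (hL : 0 < L)
    {τ : Measure (EuclideanSpace ℝ (Fin d) × EuclideanSpace ℝ (Fin d))} [IsFiniteMeasure τ]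
    (hτ : ∀ᵐ p ∂τ, ‖p.1 - p.2‖ ≤ L) (hfin : ∫⁻ p, repWeight b L ‖p.1 - p.2‖ ∂τ ≠ ⊤) :
    (∀ᵐ p ∂τ, ¬(‖p.1 - p.2‖ = 0 ∧ b ≤ 0)) ∧
    Integrable (fun p => powerProfile b ‖p.1 - p.2‖) τ ∧
    Integrable (Function.uncurry fun (t : ℝ)
      (p : EuclideanSpace ℝ (Fin d) × EuclideanSpace ℝ (Fin d)) => repKernel b L t ‖p.1 - p.2‖)
      ((volume.restrict (Ioi (0 : ℝ))).prod τ) ∧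
    ∀ᵐ p ∂τ, ∫ t in Ioi (0 : ℝ), repKernel b L t ‖p.1 - p.2‖ =
      powerProfile b L - powerProfile b ‖p.1 - p.2‖ := by
  have hmp := measurable_powerProfile b
  have hmw := measurable_repWeight b L
  have hmk := measurable_repKernel b L
  have hlt := ae_lt_top (μ := τ) (f := fun p => repWeight b L ‖p.1 - p.2‖) (by fun_prop) hfin
  have hdiag : ∀ᵐ p ∂τ, ¬(‖p.1 - p.2‖ = 0 ∧ b ≤ 0) := by
    filter_upwards [hτ, hlt] with p hp hpt h
    rw [repWeight_eq hb (norm_nonneg _) hp hL, if_pos h] at hpt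
    exact lt_irrefl _ hpt
  have hle : ∀ᵐ p ∂τ, 0 ≤ powerProfile b L - powerProfile b ‖p.1 - p.2‖ := by
    filter_upwards [hτ, hdiag] with p hp hpd
    rcases (norm_nonneg (p.1 - p.2)).eq_or_lt with h0 | h0
    · have hb0 : 0 < b := by
        by_contra h
        exact hpd ⟨h0.symm, not_lt.1 h⟩
      rw [← h0, powerProfile_zero, powerProfile_of_ne_zero hb0.ne']
      have := Real.rpow_nonneg hL.le b
      simp only [sub_zero]
      positivity
    · exact sub_nonneg.2 (powerProfile_mono b h0 hp)
  have hval : ∀ᵐ p ∂τ, repWeight b L ‖p.1 - p.2‖ =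
      ENNReal.ofReal (powerProfile b L - powerProfile b ‖p.1 - p.2‖) := by
    filter_upwards [hτ, hdiag] with p hp hpd
    rw [repWeight_eq hb (norm_nonneg _) hp hL, if_neg hpd]
  have hnn : ∀ᵐ p ∂τ, ∀ᵐ t ∂(volume.restrict (Ioi (0 : ℝ))),
      0 ≤ repKernel b L t ‖p.1 - p.2‖ := by
    filter_upwards [hτ] with p hp
    refine ae_restrict_of_forall_mem measurableSet_Ioi fun t ht => ?_
    exact repKernel_nonneg hb (le_of_lt ht) (norm_nonneg _) hp
  have hgi : Integrable (fun p => powerProfile b L - powerProfile b ‖p.1 - p.2‖) τ := by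
    rw [← lintegral_ofReal_ne_top_iff_integrable (Measurable.aestronglyMeasurable (by fun_prop)) hle]
    rwa [← lintegral_congr_ae hval]
  have hint : ∀ᵐ p ∂τ, Integrable (fun t => repKernel b L t ‖p.1 - p.2‖)
      (volume.restrict (Ioi (0 : ℝ))) := by
    filter_upwards [hlt, hnn] with p hp hpn
    rw [← lintegral_ofReal_ne_top_iff_integrable (Measurable.aestronglyMeasurable (by fun_prop)) hpn]
    exact hp.ne
  have hintval : ∀ᵐ p ∂τ, ∫ t in Ioi (0 : ℝ), repKernel b L t ‖p.1 - p.2‖ =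
      powerProfile b L - powerProfile b ‖p.1 - p.2‖ := by
    filter_upwards [hnn, hint, hval, hle] with p hpn hpi hpv hpl
    rw [integral_eq_lintegral_of_nonneg_ae hpn hpi.aestronglyMeasurable]
    rw [repWeight] at hpv
    rw [hpv, ENNReal.toReal_ofReal hpl]
  refine ⟨hdiag, ?_, ?_, hintval⟩
  · exact ((integrable_const (powerProfile b L)).sub hgi).congr (ae_of_all _ fun p => by simp)
  · refine integrable_uncurry_of_integral ?_ hnn hint hintval hgi
    refine Measurable.aestronglyMeasurable ?_
    simp only [Function.uncurry_def]
    fun_prop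

section
variable {ρ σ : Measure (EuclideanSpace ℝ (Fin d))} [IsProbabilityMeasure ρ]
  [IsProbabilityMeasure σ] {R : ℝ}

lemma integrable_repKernel {b L t : ℝ} (ht : 0 ≤ t)
    (τ : Measure (EuclideanSpace ℝ (Fin d) × EuclideanSpace ℝ (Fin d))) [IsFiniteMeasure τ] :
    Integrable (fun p => repKernel b L t ‖p.1 - p.2‖) τ :=
  ((integrable_exp_neg_sq ht τ).sub (integrable_const _)).const_mul _

lemma quadForm_repKernel {b L t : ℝ} (ht : 0 ≤ t) :
    quadForm ρ σ (fun p => repKernel b L t ‖p.1 - p.2‖) =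
      mixtureConst b * t ^ (-b / 2 - 1) * gaussForm ρ σ t := by
  have h0 := quadForm_const ρ σ (Real.exp (-t * L ^ 2))
  simp only [gaussForm, quadForm, repKernel, integral_const_mul] at h0 ⊢
  rw [integral_sub (integrable_exp_neg_sq ht _) (integrable_const _),
    integral_sub (integrable_exp_neg_sq ht _) (integrable_const _)]
  linear_combination - mixtureConst b * t ^ (-b / 2 - 1) * h0

lemma ae_pair_norm_sub_le (hρ : ∀ᵐ x ∂ρ, ‖x‖ ≤ R) (hσ : ∀ᵐ x ∂σ, ‖x‖ ≤ R) :
    (∀ᵐ p ∂(pairPos ρ σ), ‖p.1 - p.2‖ ≤ 2 * R) ∧ (∀ᵐ p ∂(pairNeg ρ σ), ‖p.1 - p.2‖ ≤ 2 * R) := by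
  obtain ⟨h1, h2⟩ := ae_pair_norm_le hρ hσ
  constructor
  · filter_upwards [h1] with p hp
    exact (norm_sub_le _ _).trans (by linarith [hp.1, hp.2])
  · filter_upwards [h2] with p hp
    exact (norm_sub_le _ _).trans (by linarith [hp.1, hp.2])

/-- Positive definiteness at each `t`. Finite self-energies therefore make the mutual energies
finite, so that differences can be formed legitimately. -/
lemma lintegral_repWeight_pairNeg_le {b : ℝ} (hb : b < 2)
    (hρ : ∀ᵐ x ∂ρ, ‖x‖ ≤ R) (hσ : ∀ᵐ x ∂σ, ‖x‖ ≤ R) :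
    ∫⁻ p, repWeight b (2 * R) ‖p.1 - p.2‖ ∂(pairNeg ρ σ) ≤
      ∫⁻ p, repWeight b (2 * R) ‖p.1 - p.2‖ ∂(pairPos ρ σ) := by
  obtain ⟨hP, hN⟩ := ae_pair_norm_sub_le hρ hσ
  have hmk := measurable_repKernel b (2 * R)
  have hm : Measurable (Function.uncurry
      fun (p : EuclideanSpace ℝ (Fin d) × EuclideanSpace ℝ (Fin d)) (t : ℝ) =>
        ENNReal.ofReal (repKernel b (2 * R) t ‖p.1 - p.2‖)) := by
    simp only [Function.uncurry_def]
    fun_prop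
  unfold repWeight
  rw [lintegral_lintegral_swap hm.aemeasurable, lintegral_lintegral_swap hm.aemeasurable]
  refine setLIntegral_mono' measurableSet_Ioi fun t ht => ?_
  have ht0 : (0 : ℝ) ≤ t := le_of_lt ht
  have h := quadForm_repKernel (ρ := ρ) (σ := σ) (b := b) (L := 2 * R) ht0
  have hG := gaussForm_nonneg ρ σ ht0
  have hC := mixtureConst_pos hb
  have ht1 : 0 ≤ t ^ (-b / 2 - 1) := Real.rpow_nonneg ht0 _
  have h1 : 0 ≤ quadForm ρ σ (fun p => repKernel b (2 * R) t ‖p.1 - p.2‖) := by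
    rw [h]; positivity
  rw [← ofReal_integral_eq_lintegral_ofReal (integrable_repKernel ht0 _),
    ← ofReal_integral_eq_lintegral_ofReal (integrable_repKernel ht0 _)]
  · exact ENNReal.ofReal_le_ofReal (sub_nonneg.1 h1)
  · filter_upwards [hP] with p hp
    exact repKernel_nonneg hb ht0 (norm_nonneg _) hp
  · filter_upwards [hN] with p hp
    exact repKernel_nonneg hb ht0 (norm_nonneg _) hp

/-- The energy of `ρ - σ` with respect to the repulsive kernel of exponent `b`. -/
def repEnergy (b : ℝ) (ρ σ : Measure (EuclideanSpace ℝ (Fin d))) : ℝ :=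
  ∫ t in Ioi (0 : ℝ), t ^ (-b / 2 - 1) * gaussForm ρ σ t

/-- Constants have zero form, so the truncation at `L = 2 * R` leaves no trace. -/
lemma quadForm_powerProfile {b : ℝ} (hb : b < 2) (hR : 0 < R)
    (hρ : ∀ᵐ x ∂ρ, ‖x‖ ≤ R) (hσ : ∀ᵐ x ∂σ, ‖x‖ ≤ R)
    (hfin : ∫⁻ p, repWeight b (2 * R) ‖p.1 - p.2‖ ∂(pairPos ρ σ) ≠ ⊤) :
    IntegrableOn (fun t => t ^ (-b / 2 - 1) * gaussForm ρ σ t) (Ioi 0) ∧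
    quadForm ρ σ (fun p => powerProfile b ‖p.1 - p.2‖) = - mixtureConst b * repEnergy b ρ σ := by
  obtain ⟨hP, hN⟩ := ae_pair_norm_sub_le hρ hσ
  obtain ⟨-, p1, p2, p3⟩ := repWeight_data hb (by linarith : 0 < 2 * R) hP hfin
  obtain ⟨-, n1, n2, n3⟩ := repWeight_data hb (by linarith : 0 < 2 * R) hN
    (ne_top_of_le_ne_top hfin (lintegral_repWeight_pairNeg_le hb hρ hσ))
  obtain ⟨h1, h2⟩ := quadForm_swap ρ σ p2 n2
  have hC := mixtureConst_pos hb
  have h3 : IntegrableOn (fun t => mixtureConst b * (t ^ (-b / 2 - 1) * gaussForm ρ σ t))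
      (Ioi 0) := by
    refine (integrableOn_congr_fun (fun t ht => ?_) measurableSet_Ioi).1 h1
    rw [quadForm_repKernel (le_of_lt ht), mul_assoc]
  constructor
  · have := h3.const_mul (mixtureConst b)⁻¹
    refine this.congr (ae_of_all _ fun t => ?_)
    field_simp
  · have h4 : ∫ t in Ioi (0 : ℝ), quadForm ρ σ (fun p => repKernel b (2 * R) t ‖p.1 - p.2‖) =
        mixtureConst b * repEnergy b ρ σ := by
      rw [repEnergy, ← integral_const_mul]
      refine setIntegral_congr_fun measurableSet_Ioi fun t ht => ?_
      rw [quadForm_repKernel (le_of_lt ht), mul_assoc]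
    rw [h4] at h2
    have h5 := quadForm_const ρ σ (powerProfile b (2 * R))
    simp only [quadForm] at h2 h5 ⊢
    rw [integral_congr_ae p3, integral_congr_ae n3, integral_sub (integrable_const _) p1,
      integral_sub (integrable_const _) n1] at h2
    linarith

end

/-! ### The repulsive energy controls the negative Sobolev norm -/

section
variable (ρ σ : Measure (EuclideanSpace ℝ (Fin d)))
  [IsProbabilityMeasure ρ] [IsProbabilityMeasure σ]

/-- Rescaling frequencies by `√t` moves the time dependence into the density, so that `t` can be
integrated out at fixed frequency. -/
lemma ofReal_gaussForm {t : ℝ} (ht : 0 < t) :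
    ENNReal.ofReal (gaussForm ρ σ t) = ∫⁻ k, ENNReal.ofReal
      (t ^ (-(d / 2 : ℝ)) * gaussDensity d ((√t)⁻¹ • k) * ‖charDiff ρ σ k‖ ^ 2) := by
  have hs : 0 < √t := Real.sqrt_pos.2 ht
  have hDm := measurable_charDiff ρ σ
  set f : EuclideanSpace ℝ (Fin d) → ℝ := fun k =>
    gaussDensity d ((√t)⁻¹ • k) * ‖charDiff ρ σ k‖ ^ 2 with hf
  have hf0 : ∀ k, 0 ≤ f k := fun k => mul_nonneg (gaussDensity_pos d _).le (by positivity)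
  have hgi : Integrable (gaussDensity d) := by
    have h : Integrable (fun _ => (1 : ℝ)) (gaussMeasure d) := integrable_const _
    rw [gaussMeasure, integrable_withDensity_iff_integrable_smul'
      (continuous_gaussDensity d).measurable.ennreal_ofReal (by simp)] at h
    simpa [ENNReal.toReal_ofReal (gaussDensity_pos d _).le] using h
  have hfi : Integrable f := by
    have h := (hgi.comp_smul (inv_ne_zero hs.ne')).mul_const 4
    refine Integrable.mono' h ?_ (ae_of_all _ fun k => ?_)
    · have := (continuous_gaussDensity d).measurable
      exact Measurable.aestronglyMeasurable (by fun_prop)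
    · rw [Real.norm_of_nonneg (hf0 k)]
      have := gaussDensity_pos d ((√t)⁻¹ • k)
      have := norm_charDiff_le ρ σ k
      simp only [hf]
      gcongr
      nlinarith [norm_nonneg (charDiff ρ σ k)]
  have h1 : gaussForm ρ σ t = ∫ k, t ^ (-(d / 2 : ℝ)) * f k := by
    rw [gaussForm_eq_integral ρ σ ht.le, integral_gaussMeasure, integral_const_mul]
    have h2 := Measure.integral_comp_smul volume f (√t)
    have h3 : ∀ ξ, f (√t • ξ) = gaussDensity d ξ • ‖charDiff ρ σ (√t • ξ)‖ ^ 2 := by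
      intro ξ
      simp only [hf, smul_smul, inv_mul_cancel₀ hs.ne', one_smul, smul_eq_mul]
    simp_rw [← h3]
    rw [h2, smul_eq_mul, abs_of_nonneg (by positivity), finrank_euclideanSpace_fin,
      Real.rpow_neg ht.le, Real.sqrt_eq_rpow, ← Real.rpow_natCast, ← Real.rpow_mul ht.le]
    congr 3
    ring
  rw [h1, ofReal_integral_eq_lintegral_ofReal (hfi.const_mul _)]
  · simp only [hf, mul_assoc]
  · exact ae_of_all _ fun k => mul_nonneg (Real.rpow_nonneg ht.le _) (hf0 k)

/-- The time integral is a Riesz symbol of size `‖k‖ ^ (-(b + d))`. Times between `u = 1 + ‖k‖ ^ 2`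
and `2 * u`, where the Gaussian is bounded below, already give `u ^ (-(b + d) / 2)`, which dominates
`u ^ (-(d + 1))`. -/
lemma exists_le_lintegral_gaussDensity {b : ℝ} (hb : -(d : ℝ) < b) (hb2 : b < 2) :
    ∃ c : ℝ, 0 < c ∧ ∀ k : EuclideanSpace ℝ (Fin d),
      ENNReal.ofReal (c * ((1 + ‖k‖ ^ 2) ^ (d + 1))⁻¹) ≤
      ∫⁻ t in Ioi (0 : ℝ), ENNReal.ofReal
        (t ^ (-b / 2 - 1) * (t ^ (-(d / 2 : ℝ)) * gaussDensity d ((√t)⁻¹ • k))) := by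
  set e : ℝ := -(b + d) / 2 - 1 with he
  have he0 : e ≤ 0 := by rw [he]; linarith
  refine ⟨2 ^ e * ((4 * Real.pi) ^ (-(d / 2 : ℝ)) * Real.exp (-(1 / 4))), by positivity,
    fun k => ?_⟩
  set u : ℝ := 1 + ‖k‖ ^ 2 with hu
  have hu1 : 1 ≤ u := by rw [hu]; nlinarith [sq_nonneg ‖k‖]
  have hu0 : 0 < u := by linarith
  have hpt : ∀ t ∈ Ioc u (2 * u), (2 * u) ^ e *
      ((4 * Real.pi) ^ (-(d / 2 : ℝ)) * Real.exp (-(1 / 4))) ≤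
      t ^ (-b / 2 - 1) * (t ^ (-(d / 2 : ℝ)) * gaussDensity d ((√t)⁻¹ • k)) := by
    intro t ht
    have ht0 : 0 < t := hu0.trans ht.1
    rw [← mul_assoc (t ^ (-b / 2 - 1)), ← Real.rpow_add ht0,
      show -b / 2 - 1 + -(d / 2 : ℝ) = e by rw [he]; ring, gaussDensity]
    have h1 : ‖(√t)⁻¹ • k‖ ^ 2 ≤ 1 := by
      rw [norm_smul, mul_pow, norm_inv, Real.norm_of_nonneg (Real.sqrt_nonneg t), inv_pow,
        Real.sq_sqrt ht0.le, inv_mul_le_iff₀ ht0]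
      have := ht.1
      rw [hu] at this
      linarith
    have h2 : (2 * u) ^ e ≤ t ^ e := Real.rpow_le_rpow_of_nonpos ht0 ht.2 he0
    gcongr
    linarith
  calc ENNReal.ofReal (2 ^ e * ((4 * Real.pi) ^ (-(d / 2 : ℝ)) * Real.exp (-(1 / 4))) *
        (u ^ (d + 1))⁻¹)
      ≤ ENNReal.ofReal ((2 * u) ^ e *
        ((4 * Real.pi) ^ (-(d / 2 : ℝ)) * Real.exp (-(1 / 4))) * u) := by
        apply ENNReal.ofReal_le_ofReal
        rw [Real.mul_rpow zero_le_two hu0.le]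
        have h1 : (u ^ (d + 1))⁻¹ ≤ u ^ e * u := by
          rw [← Real.rpow_add_one hu0.ne', ← Real.rpow_natCast, ← Real.rpow_neg hu0.le]
          apply Real.rpow_le_rpow_of_exponent_le hu1
          rw [he]
          push_cast
          have : (0 : ℝ) ≤ d := d.cast_nonneg
          linarith
        calc _ ≤ 2 ^ e * ((4 * Real.pi) ^ (-(d / 2 : ℝ)) * Real.exp (-(1 / 4))) *
              (u ^ e * u) := by gcongr
          _ = _ := by ring
    _ = ∫⁻ t in Ioc u (2 * u), ENNReal.ofReal ((2 * u) ^ e *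
        ((4 * Real.pi) ^ (-(d / 2 : ℝ)) * Real.exp (-(1 / 4)))) := by
        rw [setLIntegral_const, Real.volume_Ioc, ENNReal.ofReal_mul (by positivity)]
        ring_nf
    _ ≤ ∫⁻ t in Ioc u (2 * u), ENNReal.ofReal
        (t ^ (-b / 2 - 1) * (t ^ (-(d / 2 : ℝ)) * gaussDensity d ((√t)⁻¹ • k))) :=
        setLIntegral_mono' measurableSet_Ioc fun t ht => ENNReal.ofReal_le_ofReal (hpt t ht)
    _ ≤ _ := lintegral_mono_set fun t ht => hu0.trans ht.1

lemma exists_sobolevSq_le_repEnergy {b : ℝ} (hb : -(d : ℝ) < b) (hb2 : b < 2) :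
    ∃ C : ℝ, 0 < C ∧ ∀ (ρ σ : Measure (EuclideanSpace ℝ (Fin d))), IsProbabilityMeasure ρ →
      IsProbabilityMeasure σ →
      IntegrableOn (fun t => t ^ (-b / 2 - 1) * gaussForm ρ σ t) (Ioi 0) →
      sobolevSq ρ σ ≤ C * repEnergy b ρ σ := by
  obtain ⟨c, hc, h⟩ := exists_le_lintegral_gaussDensity hb hb2
  refine ⟨c⁻¹, by positivity, fun ρ σ _ _ hint => ?_⟩
  have hDm := measurable_charDiff ρ σ
  have hgm := (continuous_gaussDensity d).measurable
  have hnn : ∀ t ∈ Ioi (0 : ℝ), 0 ≤ t ^ (-b / 2 - 1) * gaussForm ρ σ t := fun t ht =>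
    mul_nonneg (Real.rpow_nonneg (le_of_lt ht) _) (gaussForm_nonneg ρ σ (le_of_lt ht))
  have hE : 0 ≤ repEnergy b ρ σ := setIntegral_nonneg measurableSet_Ioi hnn
  have key : ENNReal.ofReal (c * sobolevSq ρ σ) ≤ ENNReal.ofReal (repEnergy b ρ σ) := by
    calc ENNReal.ofReal (c * sobolevSq ρ σ)
        = ∫⁻ k, ENNReal.ofReal (c * (((1 + ‖k‖ ^ 2) ^ (d + 1))⁻¹ * ‖charDiff ρ σ k‖ ^ 2)) := by
          rw [sobolevSq, ← integral_const_mul, ofReal_integral_eq_lintegral_ofReal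
            ((integrable_sobolevSq ρ σ).const_mul c) (ae_of_all _ fun k => by positivity)]
      _ ≤ ∫⁻ k, ∫⁻ t in Ioi (0 : ℝ), ENNReal.ofReal (t ^ (-b / 2 - 1) *
          (t ^ (-(d / 2 : ℝ)) * gaussDensity d ((√t)⁻¹ • k) * ‖charDiff ρ σ k‖ ^ 2)) := by
          refine lintegral_mono fun k => ?_
          rw [← mul_assoc, ENNReal.ofReal_mul (by positivity)]
          refine (mul_le_mul_left (h k) _).trans ?_
          rw [← lintegral_mul_const _ (by fun_prop)]
          refine setLIntegral_mono' measurableSet_Ioi fun t ht => ?_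
          have ht0 : (0 : ℝ) < t := ht
          rw [← ENNReal.ofReal_mul (mul_nonneg (Real.rpow_nonneg ht0.le _)
            (mul_nonneg (Real.rpow_nonneg ht0.le _) (gaussDensity_pos d _).le)), mul_assoc]
      _ = ∫⁻ t in Ioi (0 : ℝ), ∫⁻ k, ENNReal.ofReal (t ^ (-b / 2 - 1) *
          (t ^ (-(d / 2 : ℝ)) * gaussDensity d ((√t)⁻¹ • k) * ‖charDiff ρ σ k‖ ^ 2)) := by
          refine lintegral_lintegral_swap (Measurable.aemeasurable ?_)
          simp only [Function.uncurry_def]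
          fun_prop
      _ = ∫⁻ t in Ioi (0 : ℝ), ENNReal.ofReal (t ^ (-b / 2 - 1) * gaussForm ρ σ t) := by
          refine setLIntegral_congr_fun measurableSet_Ioi fun t ht => ?_
          have ht0 : (0 : ℝ) < t := ht
          have h1 := Real.rpow_nonneg ht0.le (-b / 2 - 1)
          rw [ENNReal.ofReal_mul h1, ofReal_gaussForm ρ σ ht0, ← lintegral_const_mul _ (by fun_prop)]
          simp_rw [← ENNReal.ofReal_mul h1]
      _ = _ := by
          rw [repEnergy, ofReal_integral_eq_lintegral_ofReal hint
            (ae_restrict_of_forall_mem measurableSet_Ioi hnn)]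
  rw [ENNReal.ofReal_le_ofReal_iff hE] at key
  rw [inv_mul_eq_div, le_div_iff₀ hc]
  linarith

end

/-! ### Small times -/

lemma integrable_one_add_norm_pow_gaussMeasure (d n : ℕ) :
    Integrable (fun x => (1 + ‖x‖) ^ n) (gaussMeasure d) := by
  have h0 : MemLp (fun x : EuclideanSpace ℝ (Fin d) => ‖x‖) n (gaussMeasure d) :=
    (memLp_id_gaussMeasure d n).norm
  have h1 : MemLp (fun _ : EuclideanSpace ℝ (Fin d) => (1 : ℝ)) n (gaussMeasure d) :=
    memLp_const 1
  have h : MemLp (fun x : EuclideanSpace ℝ (Fin d) => 1 + ‖x‖) n (gaussMeasure d) := h1.add h0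
  have h2 := h.integrable_norm_pow'
  have h3 : ∀ x : EuclideanSpace ℝ (Fin d), ‖1 + ‖x‖‖ = 1 + ‖x‖ := fun x =>
    Real.norm_of_nonneg (by positivity)
  simpa only [h3] using h2

lemma momentDiff_smul (ρ σ : Measure (EuclideanSpace ℝ (Fin d))) (s : ℝ)
    (k : EuclideanSpace ℝ (Fin d)) : momentDiff ρ σ (s • k) = s ^ 2 * momentDiff ρ σ k := by
  simp only [momentDiff, real_inner_smul_right, mul_pow, integral_const_mul]
  ring

/-- Square the Taylor estimate with `S` the Sobolev norm and `s = √t`. The second moment bound makes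
the cross term quadratic in `S` and of order `κ ^ 5`; the square of the error, of order `κ ^ 6`, is
weakened to match. -/
lemma sq_le_of_le_taylor (n : ℕ) {z m C S s x κ : ℝ} (hz : 0 ≤ z) (hC : 0 ≤ C) (hS : 0 ≤ S)
    (hs : 0 ≤ s) (hs1 : s ≤ 1) (hx : 0 ≤ x) (hκ : κ = s * x)
    (h1 : z ≤ C * κ ^ 3 * (1 + κ) ^ n * S + |m| / 2) (h2 : |m| ≤ C * κ ^ 2 * S) :
    z ^ 2 ≤ m ^ 2 / 4 + 2 * C ^ 2 * S ^ 2 * s ^ 5 * (1 + x) ^ (2 * n + 6) := by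
  have hκ0 : 0 ≤ κ := by rw [hκ]; positivity
  have hκx : κ ≤ x := by
    rw [hκ]
    exact mul_le_of_le_one_left hx hs1
  set q := C * κ ^ 3 * (1 + κ) ^ n * S with hq
  have hq0 : 0 ≤ q := by positivity
  set P := C ^ 2 * S ^ 2 * κ ^ 5 with hP
  have hP0 : 0 ≤ P := by positivity
  have e1 : q ^ 2 ≤ P * (1 + κ) ^ (2 * n + 1) := by
    calc q ^ 2 = P * ((1 + κ) ^ (2 * n) * κ) := by
          rw [hq, hP, mul_comm 2 n, pow_mul]
          ring
      _ ≤ P * ((1 + κ) ^ (2 * n) * (1 + κ)) := by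
          gcongr
          linarith
      _ = _ := by ring
  have e2 : q * |m| ≤ P * (1 + κ) ^ (2 * n + 1) := by
    calc q * |m| ≤ q * (C * κ ^ 2 * S) := by gcongr
      _ = P * (1 + κ) ^ n := by rw [hq, hP]; ring
      _ ≤ _ := by
          gcongr
          · linarith
          · omega
  have e3 : κ ^ 5 * (1 + κ) ^ (2 * n + 1) ≤ s ^ 5 * (1 + x) ^ (2 * n + 6) := by
    have hk5 : κ ^ 5 ≤ s ^ 5 * (1 + x) ^ 5 := by
      rw [hκ, mul_pow]
      gcongr
      linarith
    calc κ ^ 5 * (1 + κ) ^ (2 * n + 1)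
        ≤ (s ^ 5 * (1 + x) ^ 5) * (1 + x) ^ (2 * n + 1) := by gcongr
      _ = _ := by ring
  have e4 : P * (1 + κ) ^ (2 * n + 1) ≤ C ^ 2 * S ^ 2 * (s ^ 5 * (1 + x) ^ (2 * n + 6)) := by
    rw [hP, mul_assoc (C ^ 2 * S ^ 2)]
    gcongr
  calc z ^ 2 ≤ (q + |m| / 2) ^ 2 := by gcongr
    _ = m ^ 2 / 4 + (q ^ 2 + q * |m|) := by
        rw [← sq_abs m]
        ring
    _ ≤ m ^ 2 / 4 + 2 * (C ^ 2 * S ^ 2 * (s ^ 5 * (1 + x) ^ (2 * n + 6))) := by linarith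
    _ = _ := by ring

/-- The leading term is exactly the quartic one, since both are Gaussian averages of squared second
moments. The error `t ^ (5 / 2)` is integrable against `t ^ (-a / 2 - 1)` for `a < 5`. -/
lemma exists_gaussForm_le (d : ℕ) {R : ℝ} (hR : 0 < R) :
    ∃ C : ℝ, 0 ≤ C ∧ ∀ (ρ σ : Measure (EuclideanSpace ℝ (Fin d))), IsProbabilityMeasure ρ →
      IsProbabilityMeasure σ → (∀ᵐ x ∂ρ, ‖x‖ ≤ R) → (∀ᵐ x ∂σ, ‖x‖ ≤ R) →
      ∫ x, x ∂ρ = ∫ x, x ∂σ → ∀ t : ℝ, 0 ≤ t → t ≤ 1 →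
      gaussForm ρ σ t ≤ t ^ 2 / 2 * quadForm ρ σ (fun p => ‖p.1 - p.2‖ ^ 4) +
        C * sobolevSq ρ σ * √t ^ 5 := by
  obtain ⟨C, hC0, hC⟩ := exists_taylor_charDiff d hR
  have hpi := integrable_one_add_norm_pow_gaussMeasure d (2 * (d + 1) + 6)
  refine ⟨2 * C ^ 2 * ∫ ξ, (1 + ‖ξ‖) ^ (2 * (d + 1) + 6) ∂(gaussMeasure d),
    mul_nonneg (by positivity) (integral_nonneg fun _ => by positivity),
    fun ρ σ _ _ hρ hσ hmean t ht0 ht1 => ?_⟩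
  obtain ⟨hMi, hM⟩ := quadForm_norm_sub_pow_four hρ hσ hmean
  have hS : 0 ≤ sobolevSq ρ σ := integral_nonneg fun k => by positivity
  have hpt : ∀ ξ, ‖charDiff ρ σ (√t • ξ)‖ ^ 2 ≤ t ^ 2 / 4 * momentDiff ρ σ ξ ^ 2 +
      2 * C ^ 2 * sobolevSq ρ σ * √t ^ 5 * (1 + ‖ξ‖) ^ (2 * (d + 1) + 6) := by
    intro ξ
    obtain ⟨h1, h2⟩ := hC ρ σ inferInstance inferInstance hρ hσ hmean (√t • ξ)
    have h4 := norm_sub_le (charDiff ρ σ (√t • ξ) + (momentDiff ρ σ (√t • ξ) / 2 : ℝ))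
      ((momentDiff ρ σ (√t • ξ) / 2 : ℝ) : ℂ)
    rw [add_sub_cancel_right, Complex.norm_real, Real.norm_eq_abs, abs_div, abs_two] at h4
    have h5 := sq_le_of_le_taylor (d + 1) (norm_nonneg _) hC0 (Real.sqrt_nonneg (sobolevSq ρ σ))
      (Real.sqrt_nonneg t) (Real.sqrt_le_one.2 ht1) (norm_nonneg ξ)
      (by rw [norm_smul, Real.norm_of_nonneg (Real.sqrt_nonneg t)])
      (h4.trans (add_le_add h1 le_rfl)) h2
    rw [Real.sq_sqrt hS, momentDiff_smul, Real.sq_sqrt ht0] at h5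
    refine h5.trans (le_of_eq ?_)
    ring
  have hi1 := hMi.const_mul (t ^ 2 / 4)
  have hi2 := hpi.const_mul (2 * C ^ 2 * sobolevSq ρ σ * √t ^ 5)
  have hi : Integrable (fun ξ => t ^ 2 / 4 * momentDiff ρ σ ξ ^ 2 +
      2 * C ^ 2 * sobolevSq ρ σ * √t ^ 5 * (1 + ‖ξ‖) ^ (2 * (d + 1) + 6)) (gaussMeasure d) :=
    hi1.add hi2
  have hD : 0 ≤ᵐ[gaussMeasure d] fun ξ => ‖charDiff ρ σ (√t • ξ)‖ ^ 2 :=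
    ae_of_all _ fun ξ => sq_nonneg _
  have hle := integral_mono_of_nonneg hD hi (ae_of_all _ hpt)
  rw [integral_add hi1 hi2, integral_const_mul, integral_const_mul] at hle
  rw [gaussForm_eq_integral ρ σ ht0, hM]
  refine hle.trans (le_of_eq ?_)
  ring

/-! ### Positivity of the energy of a difference of measures -/

lemma eq_of_sobolevSq_eq_zero {ρ σ : Measure (EuclideanSpace ℝ (Fin d))} [IsProbabilityMeasure ρ]
    [IsProbabilityMeasure σ] (h : sobolevSq ρ σ = 0) : ρ = σ := by
  have h1 := (integral_eq_zero_iff_of_nonneg (fun k => by positivity)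
    (integrable_sobolevSq ρ σ)).1 h
  have h2 : charDiff ρ σ =ᵐ[volume] fun _ => 0 := by
    filter_upwards [h1] with k hk
    have h3 : ((1 + ‖k‖ ^ 2) ^ (d + 1))⁻¹ ≠ 0 := by positivity
    simpa [h3] using hk
  have hc : Continuous (charDiff ρ σ) := continuous_charFun.sub continuous_charFun
  have h3 := (hc.ae_eq_iff_eq volume continuous_const).1 h2
  apply Measure.ext_of_charFun
  ext k
  exact sub_eq_zero.1 (congrFun h3 k)

lemma le_quadForm_norm_sub_rpow {a b C S R : ℝ} (ha : 4 < a) (ha' : a ≤ 9 / 2) (hb2 : b < 2)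
    {ρ σ : Measure (EuclideanSpace ℝ (Fin d))} [IsProbabilityMeasure ρ] [IsProbabilityMeasure σ]
    (hρ : ∀ᵐ x ∂ρ, ‖x‖ ≤ R) (hσ : ∀ᵐ x ∂σ, ‖x‖ ≤ R) (hmean : ∫ x, x ∂ρ = ∫ x, x ∂σ)
    (hCS : 0 ≤ C * S)
    (hint : IntegrableOn (fun t => t ^ (-b / 2 - 1) * gaussForm ρ σ t) (Ioi 0))
    (hG : ∀ t : ℝ, 0 ≤ t → t ≤ 1 →
      gaussForm ρ σ t ≤ t ^ 2 / 2 * quadForm ρ σ (fun p => ‖p.1 - p.2‖ ^ 4) + C * S * √t ^ 5) :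
    -(4 * (C * S) + repEnergy b ρ σ) ≤
      attractionConst a * quadForm ρ σ (fun p => ‖p.1 - p.2‖ ^ a) := by
  obtain ⟨h1, h2⟩ := quadForm_norm_sub_rpow ha (by linarith) hρ hσ hmean
  have hA4 : 0 ≤ quadForm ρ σ (fun p => ‖p.1 - p.2‖ ^ 4) := by
    rw [(quadForm_norm_sub_pow_four hρ hσ hmean).2]
    have : 0 ≤ ∫ ξ, momentDiff ρ σ ξ ^ 2 ∂(gaussMeasure d) := integral_nonneg fun _ => sq_nonneg _
    linarith
  have hex : -1 < (3 - a) / 2 := by linarith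
  have hi1 : IntegrableOn (fun t : ℝ => C * S * t ^ ((3 - a) / 2)) (Ioc 0 1) := by
    apply Integrable.const_mul
    exact (intervalIntegrable_iff_integrableOn_Ioc_of_le zero_le_one).1
      (intervalIntegral.intervalIntegrable_rpow' hex)
  have hi2 : IntegrableOn ((Ioc (0 : ℝ) 1).indicator fun t : ℝ => C * S * t ^ ((3 - a) / 2))
      (Ioi 0) := (hi1.integrable_indicator measurableSet_Ioc).integrableOn
  have hv : ∫ t in Ioi (0 : ℝ), (Ioc (0 : ℝ) 1).indicator
      (fun t : ℝ => C * S * t ^ ((3 - a) / 2)) t ≤ 4 * (C * S) := by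
    rw [setIntegral_indicator measurableSet_Ioc, inter_eq_self_of_subset_right
      (Ioc_subset_Ioi_self : Ioc (0 : ℝ) 1 ⊆ Ioi 0), integral_const_mul,
      ← intervalIntegral.integral_of_le zero_le_one, integral_rpow (Or.inl hex), Real.one_rpow,
      Real.zero_rpow (by linarith), mul_comm 4]
    refine mul_le_mul_of_nonneg_left ?_ hCS
    -- The integral over `(0, 1]` is `2 / (5 - a)`, at most 4 because `a ≤ 9 / 2`.
    rw [div_le_iff₀ (by linarith)]
    linarith
  have hpt : ∀ t ∈ Ioi (0 : ℝ), -((Ioc (0 : ℝ) 1).indicator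
      (fun t : ℝ => C * S * t ^ ((3 - a) / 2)) t + t ^ (-b / 2 - 1) * gaussForm ρ σ t) ≤
      t ^ (-a / 2 - 1) *
      (t ^ 2 / 2 * quadForm ρ σ (fun p => ‖p.1 - p.2‖ ^ 4) - gaussForm ρ σ t) := by
    intro t ht
    have ht0 : (0 : ℝ) < t := ht
    have hg := gaussForm_nonneg ρ σ ht0.le
    have hta := Real.rpow_nonneg ht0.le (-a / 2 - 1)
    have htb := Real.rpow_nonneg ht0.le (-b / 2 - 1)
    by_cases ht1 : t ≤ 1
    · rw [indicator_of_mem (show t ∈ Ioc 0 1 from ⟨ht0, ht1⟩)]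
      have h3 : t ^ (-a / 2 - 1) * √t ^ 5 = t ^ ((3 - a) / 2) := by
        rw [Real.sqrt_eq_rpow, ← Real.rpow_natCast, ← Real.rpow_mul ht0.le, ← Real.rpow_add ht0]
        congr 1
        push_cast
        ring
      have h4 := mul_le_mul_of_nonneg_left (hG t ht0.le ht1) hta
      rw [← h3]
      nlinarith [mul_nonneg htb hg]
    · rw [indicator_of_notMem (fun h => ht1 h.2)]
      -- For large times the quartic term is dropped and the Gaussian form is absorbed into the
      -- repulsive energy, as `b < a`.
      have h3 : t ^ (-a / 2 - 1) ≤ t ^ (-b / 2 - 1) :=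
        Real.rpow_le_rpow_of_exponent_le (not_le.1 ht1).le (by linarith)
      have h4 := mul_le_mul_of_nonneg_right h3 hg
      have h5 : 0 ≤ t ^ (-a / 2 - 1) * (t ^ 2 / 2 * quadForm ρ σ (fun p => ‖p.1 - p.2‖ ^ 4)) := by
        positivity
      rw [mul_sub]
      linarith
  rw [h2]
  have h3 := setIntegral_mono_on (hi2.add hint).neg h1 measurableSet_Ioi hpt
  refine le_trans ?_ h3
  simp only [Pi.neg_apply, Pi.add_apply]
  rw [integral_neg, integral_add hi2 hint]
  have : ∫ t in Ioi (0 : ℝ), t ^ (-b / 2 - 1) * gaussForm ρ σ t = repEnergy b ρ σ := rfl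
  rw [this]
  linarith

/-- For `a` slightly larger than `4`, the interaction energy is strictly positive on differences of
probability measures on a fixed ball with the same mean. -/
theorem exists_eq_of_quadForm_nonpos {b : ℝ} (hb : -(d : ℝ) < b) (hb2 : b < 2) {R : ℝ}
    (hR : 0 < R) :
    ∃ δ : ℝ, 0 < δ ∧ δ ≤ 1 / 2 ∧ ∀ a : ℝ, 4 < a → a < 4 + δ →
      ∀ (ρ σ : Measure (EuclideanSpace ℝ (Fin d))), IsProbabilityMeasure ρ →
      IsProbabilityMeasure σ → (∀ᵐ x ∂ρ, ‖x‖ ≤ R) → (∀ᵐ x ∂σ, ‖x‖ ≤ R) →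
      ∫ x, x ∂ρ = ∫ x, x ∂σ →
      ∫⁻ p, repWeight b (2 * R) ‖p.1 - p.2‖ ∂(pairPos ρ σ) ≠ ⊤ →
      quadForm ρ σ (fun p => powerProfile a ‖p.1 - p.2‖ - powerProfile b ‖p.1 - p.2‖) ≤ 0 →
      ρ = σ := by
  obtain ⟨C1, hC1, h1⟩ := exists_gaussForm_le d hR
  obtain ⟨C2, hC2, h2⟩ := exists_sobolevSq_le_repEnergy hb hb2
  have hCb := mixtureConst_pos hb2
  -- The first summand accounts for small times, the 1 for large times.
  set K : ℝ := 4 * (C1 * C2) + 1 with hK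
  have hK0 : 0 < K := by positivity
  -- The first bound keeps `a` below `9 / 2`; the second lets the attraction consume at most half of
  -- the repulsive coefficient `mixtureConst b`.
  refine ⟨min (1 / 2) (mixtureConst b / (2 * K)), lt_min (by norm_num) (by positivity),
    min_le_left _ _, fun a ha ha' ρ σ _ _ hρ hσ hmean hfin hle => ?_⟩
  have ha1 : a < 4 + 1 / 2 := ha'.trans_le (by gcongr; exact min_le_left _ _)
  have ha2 : a < 4 + mixtureConst b / (2 * K) := ha'.trans_le (by gcongr; exact min_le_right _ _)
  obtain ⟨hint, hQb⟩ := quadForm_powerProfile hb2 hR hρ hσ hfin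
  obtain ⟨hP, hN⟩ := ae_pair_norm_sub_le hρ hσ
  have p1 := (repWeight_data hb2 (by linarith : 0 < 2 * R) hP hfin).2.1
  have n1 := (repWeight_data hb2 (by linarith : 0 < 2 * R) hN
    (ne_top_of_le_ne_top hfin (lintegral_repWeight_pairNeg_le hb2 hρ hσ))).2.1
  have hS := h2 ρ σ inferInstance inferInstance hint
  have hS0 : 0 ≤ sobolevSq ρ σ := integral_nonneg fun k => by positivity
  have hE0 : 0 ≤ repEnergy b ρ σ := nonneg_of_mul_nonneg_right (hS0.trans hS) hC2
  have hA := le_quadForm_norm_sub_rpow ha (by linarith) hb2 hρ hσ hmean (mul_nonneg hC1 hS0) hint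
    (h1 ρ σ inferInstance inferInstance hρ hσ hmean)
  have hI := le_attractionConst ha (by linarith)
  have hI0 := attractionConst_pos ha (by linarith)
  have hsplit : quadForm ρ σ (fun p => powerProfile a ‖p.1 - p.2‖ - powerProfile b ‖p.1 - p.2‖) =
      quadForm ρ σ (fun p => ‖p.1 - p.2‖ ^ a) / a + mixtureConst b * repEnergy b ρ σ := by
    have hca : Continuous fun p : EuclideanSpace ℝ (Fin d) × EuclideanSpace ℝ (Fin d) =>
        ‖p.1 - p.2‖ ^ a / a :=
      (Continuous.rpow_const (by fun_prop) fun _ => Or.inr (by linarith)).div_const a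
    have hci := integrable_pair_of_continuous hρ hσ hca
    simp_rw [powerProfile_of_ne_zero (by linarith : a ≠ 0)]
    simp only [quadForm] at hQb ⊢
    rw [integral_sub hci.1 p1, integral_sub hci.2 n1, integral_div, integral_div]
    linear_combination -hQb
  set Q := quadForm ρ σ (fun p => ‖p.1 - p.2‖ ^ a) with hQ
  set E := repEnergy b ρ σ with hE
  have hQ1 : -(K * E) ≤ attractionConst a * Q := by
    refine le_trans ?_ hA
    have : C1 * sobolevSq ρ σ ≤ C1 * (C2 * E) := by gcongr
    rw [hK]
    linarith
  have ha4 : 0 < a - 4 := by linarith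
  have hIa : 1 ≤ attractionConst a * (4 * (a - 4)) := by
    rw [div_le_iff₀ (by positivity)] at hI
    exact hI
  have hQ2 : -(K * E * (4 * (a - 4))) ≤ Q := by
    by_contra hlt
    push Not at hlt
    have h3 : attractionConst a * Q < attractionConst a * -(K * E * (4 * (a - 4))) := by gcongr
    have h4 : K * E ≤ K * E * (attractionConst a * (4 * (a - 4))) :=
      le_mul_of_one_le_right (by positivity) hIa
    nlinarith
  -- Division by `a > 4` absorbs the factor 4 from the normalization bound.
  have hQ3 : -(K * E * (a - 4)) ≤ Q / a := by
    rw [le_div_iff₀ (by linarith)]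
    refine le_trans ?_ hQ2
    have : 0 ≤ K * E * (a - 4) := by positivity
    nlinarith
  have hKa : K * (a - 4) ≤ mixtureConst b / 2 := by
    have : a - 4 ≤ mixtureConst b / (2 * K) := by linarith
    calc K * (a - 4) ≤ K * (mixtureConst b / (2 * K)) := by gcongr
      _ = _ := by field_simp
  have hEz : E ≤ 0 := by
    by_contra hlt
    push Not at hlt
    rw [hsplit] at hle
    have h5 : K * (a - 4) * E ≤ mixtureConst b / 2 * E := by gcongr
    have h6 : 0 < mixtureConst b / 2 * E := by positivity
    nlinarith
  have hE1 : E = 0 := le_antisymm hEz hE0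
  rw [hE1, mul_zero] at hS
  exact eq_of_sobolevSq_eq_zero (le_antisymm hS hS0)

/-! ### Energies of nonnegative kernels -/

/-- The mutual interaction of two measures for a nonnegative kernel. -/
def interaction (w : EuclideanSpace ℝ (Fin d) → ENNReal)
    (ρ σ : Measure (EuclideanSpace ℝ (Fin d))) : ENNReal :=
  ∫⁻ p, w (p.1 - p.2) ∂(ρ.prod σ)

section
variable {w : EuclideanSpace ℝ (Fin d) → ENNReal} (hw : Measurable w)
include hw

lemma measurable_kernel_sub :
    Measurable (fun p : EuclideanSpace ℝ (Fin d) × EuclideanSpace ℝ (Fin d) => w (p.1 - p.2)) :=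
  hw.comp (measurable_fst.sub measurable_snd)

lemma interaction_eq_lintegral (ρ σ : Measure (EuclideanSpace ℝ (Fin d))) [SFinite σ] :
    interaction w ρ σ = ∫⁻ x, ∫⁻ y, w (x - y) ∂σ ∂ρ :=
  lintegral_prod _ (measurable_kernel_sub hw).aemeasurable

lemma measurable_lintegral_kernel_sub (σ : Measure (EuclideanSpace ℝ (Fin d))) [SFinite σ] :
    Measurable (fun x => ∫⁻ y, w (x - y) ∂σ) :=
  (measurable_kernel_sub hw).lintegral_prod_right'

lemma interaction_comm (hev : ∀ x, w (-x) = w x) (ρ σ : Measure (EuclideanSpace ℝ (Fin d)))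
    [SFinite ρ] [SFinite σ] : interaction w ρ σ = interaction w σ ρ := by
  unfold interaction
  rw [← Measure.prod_swap, lintegral_map (measurable_kernel_sub hw) measurable_swap]
  refine lintegral_congr fun p => ?_
  rw [← hev]
  simp

lemma interaction_map_add (ρ : Measure (EuclideanSpace ℝ (Fin d))) [SFinite ρ]
    (v : EuclideanSpace ℝ (Fin d)) :
    interaction w (ρ.map (fun x => x + v)) (ρ.map (fun x => x + v)) = interaction w ρ ρ := by
  have hm : Measurable (fun x : EuclideanSpace ℝ (Fin d) => x + v) := measurable_id.add_const v
  unfold interaction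
  rw [Measure.map_prod_map _ _ hm hm,
    lintegral_map (measurable_kernel_sub hw) (hm.prodMap hm)]
  simp

lemma interaction_convex_combination (hev : ∀ x, w (-x) = w x)
    (ρ σ : Measure (EuclideanSpace ℝ (Fin d)))
    [IsFiniteMeasure ρ] [IsFiniteMeasure σ] (c e : NNReal) :
    interaction w (c • ρ + e • σ) (c • ρ + e • σ) =
      c ^ 2 * interaction w ρ ρ + 2 * c * e * interaction w ρ σ + e ^ 2 * interaction w σ σ := by
  have key : ∀ μ : Measure (EuclideanSpace ℝ (Fin d)), IsFiniteMeasure μ →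
      interaction w μ (c • ρ + e • σ) = c * interaction w μ ρ + e * interaction w μ σ := by
    intro μ hμ
    rw [interaction_eq_lintegral hw, interaction_eq_lintegral hw, interaction_eq_lintegral hw]
    simp only [lintegral_add_measure, lintegral_smul_measure, ENNReal.smul_def, smul_eq_mul]
    rw [lintegral_add_left ((measurable_lintegral_kernel_sub hw ρ).const_mul _),
      lintegral_const_mul _ (measurable_lintegral_kernel_sub hw ρ),
      lintegral_const_mul _ (measurable_lintegral_kernel_sub hw σ)]
  rw [key _ inferInstance, interaction_comm hw hev _ ρ, interaction_comm hw hev _ σ,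
    key _ inferInstance, key _ inferInstance, interaction_comm hw hev σ ρ]
  ring

end

/-! ### First variation and the Euler–Lagrange equation. -/

/-- A measure of finite energy with the least energy among probability measures. -/
structure IsInteractionMinimizer (w : EuclideanSpace ℝ (Fin d) → ENNReal)
    (ρ : Measure (EuclideanSpace ℝ (Fin d))) : Prop where
  isProbabilityMeasure : IsProbabilityMeasure ρ
  ne_top : interaction w ρ ρ ≠ ⊤
  le : ∀ σ : Measure (EuclideanSpace ℝ (Fin d)), IsProbabilityMeasure σ →
    interaction w ρ ρ ≤ interaction w σ σ

lemma le_of_forall_convex_combination {A X S : ℝ} (hA : 0 ≤ A) (hX : 0 ≤ X) (hS : 0 ≤ S)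
    (h : ∀ ε : ℝ, 0 < ε → ε < 1 →
      A ≤ (1 - ε) ^ 2 * A + 2 * (1 - ε) * ε * X + ε ^ 2 * S) : A ≤ X := by
  by_contra! hlt
  have hD : 0 < A + S + 1 := by linarith
  have h0 : 0 < (A - X) / (A + S + 1) := div_pos (by linarith) hD
  -- With this `ε` the second order term `ε * (A + S - 2 * X)` is at most `A - X`, less than the
  -- first order gain `2 * (A - X)`.
  have h1 : (A - X) / (A + S + 1) < 1 := by rw [div_lt_one hD]; linarith
  have h2 := h _ h0 h1
  set ε := (A - X) / (A + S + 1)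
  have h3 : ε * (A + S + 1) = A - X := div_mul_cancel₀ _ hD.ne'
  have h4 : 0 ≤ ε * (ε * (A + S - 2 * X) - 2 * (A - X)) := by nlinarith
  have h5 : 0 ≤ ε * (A + S - 2 * X) - 2 * (A - X) := nonneg_of_mul_nonneg_right h4 h0
  nlinarith

namespace IsInteractionMinimizer

variable {w : EuclideanSpace ℝ (Fin d) → ENNReal} {ρ : Measure (EuclideanSpace ℝ (Fin d))}

lemma le_interaction (hρ : IsInteractionMinimizer w ρ) (hw : Measurable w)
    (hev : ∀ x, w (-x) = w x) {σ : Measure (EuclideanSpace ℝ (Fin d))} [IsProbabilityMeasure σ]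
    (hσ : interaction w σ σ ≠ ⊤) : interaction w ρ ρ ≤ interaction w ρ σ := by
  have := hρ.isProbabilityMeasure
  by_cases hX : interaction w ρ σ = ⊤
  · simp [hX]
  rw [← ENNReal.toReal_le_toReal hρ.ne_top hX]
  refine le_of_forall_convex_combination ENNReal.toReal_nonneg ENNReal.toReal_nonneg
    (S := (interaction w σ σ).toReal) ENNReal.toReal_nonneg fun ε h0 h1 => ?_
  obtain ⟨e, he⟩ : ∃ e : NNReal, (e : ℝ) = ε := ⟨⟨ε, h0.le⟩, rfl⟩
  obtain ⟨c, hc⟩ : ∃ c : NNReal, (c : ℝ) = 1 - ε := ⟨⟨1 - ε, by linarith⟩, rfl⟩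
  have hce : (c : ENNReal) + e = 1 := by
    rw [← ENNReal.coe_add, ENNReal.coe_eq_one]
    ext
    rw [NNReal.coe_add, he, hc]
    simp
  have hP : IsProbabilityMeasure (c • ρ + e • σ) := ⟨by
    rw [Measure.add_apply, Measure.smul_apply, Measure.smul_apply, measure_univ, measure_univ,
      ENNReal.smul_def, ENNReal.smul_def, smul_eq_mul, smul_eq_mul, mul_one, mul_one, hce]⟩
  have h := hρ.le _ hP
  rw [interaction_convex_combination hw hev] at h
  have hA := hρ.ne_top
  have h' := ENNReal.toReal_mono (by finiteness) h
  rw [ENNReal.toReal_add (by finiteness) (by finiteness),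
    ENNReal.toReal_add (by finiteness) (by finiteness)] at h'
  simpa [he, hc] using h'

/-- If the potential were below the energy on a set of positive mass, conditioning `ρ` on that set
would give a competitor of finite energy violating the first variation. So the potential is at least
its own average, hence equal to it almost everywhere. -/
lemma ae_lintegral_eq (hρ : IsInteractionMinimizer w ρ) (hw : Measurable w)
    (hev : ∀ x, w (-x) = w x) : ∀ᵐ x ∂ρ, ∫⁻ y, w (x - y) ∂ρ = interaction w ρ ρ := by
  have := hρ.isProbabilityMeasure
  set A := interaction w ρ ρ with hA
  set φ : EuclideanSpace ℝ (Fin d) → ENNReal := fun x => ∫⁻ y, w (x - y) ∂ρ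
  have hφ : Measurable φ := measurable_lintegral_kernel_sub hw ρ
  have hAφ : A = ∫⁻ x, φ x ∂ρ := interaction_eq_lintegral hw ρ ρ
  have hB : MeasurableSet {x | φ x < A} := measurableSet_lt hφ measurable_const
  have hge : ∀ᵐ x ∂ρ, A ≤ φ x := by
    by_contra hcon
    have hB0 : ρ {x | φ x < A} ≠ 0 := by
      intro h
      apply hcon
      rw [ae_iff]
      simpa using h
    have hP := ProbabilityTheory.cond_isProbabilityMeasure hB0
    set σ := ProbabilityTheory.cond ρ {x | φ x < A} with hσ
    have hle : σ ≤ (ρ {x | φ x < A})⁻¹ • ρ := by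
      rw [hσ, ProbabilityTheory.cond]
      gcongr
      exact Measure.restrict_le_self
    have hc : (ρ {x | φ x < A})⁻¹ ≠ ⊤ := by simpa using hB0
    have hfin : interaction w σ σ ≠ ⊤ := by
      have h1 : interaction w σ σ ≤ (ρ {x | φ x < A})⁻¹ * ((ρ {x | φ x < A})⁻¹ * A) := by
        rw [interaction_eq_lintegral hw]
        calc ∫⁻ x, ∫⁻ y, w (x - y) ∂σ ∂σ
            ≤ ∫⁻ x, (ρ {x | φ x < A})⁻¹ * φ x ∂((ρ {x | φ x < A})⁻¹ • ρ) := by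
              refine lintegral_mono' hle fun x => ?_
              refine (lintegral_mono' hle le_rfl).trans ?_
              rw [lintegral_smul_measure, smul_eq_mul]
          _ = _ := by
              rw [lintegral_smul_measure, lintegral_const_mul _ hφ, smul_eq_mul, ← hAφ]
      have hAt := hρ.ne_top
      exact ne_top_of_le_ne_top (ENNReal.mul_ne_top hc (ENNReal.mul_ne_top hc hAt)) h1
    have h2 : A ≤ ∫⁻ x, φ x ∂σ := by
      rw [← interaction_eq_lintegral hw, ← interaction_comm hw hev]
      exact hρ.le_interaction hw hev hfin
    have h3 : ∀ᵐ x ∂σ, φ x < A := ProbabilityTheory.ae_cond_mem hB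
    have h4 : ∫⁻ x, φ x ∂σ ≤ A := by
      refine (lintegral_mono_ae (h3.mono fun x hx => hx.le)).trans ?_
      simp
    have h5 : φ =ᵐ[σ] fun _ => A :=
      ae_eq_of_ae_le_of_lintegral_le (h3.mono fun x hx => hx.le)
        (ne_top_of_le_ne_top hρ.ne_top h4) aemeasurable_const (by simpa using h2)
    obtain ⟨x, hx1, hx2⟩ := (h3.and h5).exists
    exact hx1.ne hx2
  have h6 : (fun _ => A) =ᵐ[ρ] φ :=
    ae_eq_of_ae_le_of_lintegral_le hge (by simpa using hρ.ne_top) hφ.aemeasurable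
      (by simp [← hAφ])
  exact h6.mono fun x hx => hx.symm

/-- As `w` dominates the norm, the constant potential bounds the mean distance from almost every `x`
to `ρ`, hence by Jensen the distance from `x` to the mean. -/
lemma ae_norm_sub_mean_le (hρ : IsInteractionMinimizer w ρ) (hw : Measurable w)
    (hev : ∀ x, w (-x) = w x) (hlow : ∀ x, ‖x‖ₑ ≤ w x) :
    Integrable (fun x => x) ρ ∧
      ∀ᵐ x ∂ρ, ‖x - ∫ y, y ∂ρ‖ ≤ (interaction w ρ ρ).toReal := by
  have := hρ.isProbabilityMeasure
  have hae := hρ.ae_lintegral_eq hw hev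
  have hb : ∀ x, ∫⁻ y, w (x - y) ∂ρ = interaction w ρ ρ →
      ∫⁻ y, ‖x - y‖ₑ ∂ρ ≤ interaction w ρ ρ := fun x hx =>
    (lintegral_mono fun y => hlow (x - y)).trans hx.le
  have hint : Integrable (fun x => x) ρ := by
    obtain ⟨x, hx⟩ := hae.exists
    have h1 : Integrable (fun y => x - y) ρ :=
      ⟨(measurable_const.sub measurable_id).aestronglyMeasurable,
        lt_of_le_of_lt (hb x hx) hρ.ne_top.lt_top⟩
    convert! (integrable_const x).sub h1 using 1
    funext y
    simp
  refine ⟨hint, hae.mono fun x hx => ?_⟩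
  have h1 : x - ∫ y, y ∂ρ = ∫ y, (x - y) ∂ρ := by
    rw [integral_sub (integrable_const x) hint]
    simp
  rw [h1]
  refine (norm_integral_le_lintegral_norm _).trans ?_
  refine ENNReal.toReal_mono hρ.ne_top ?_
  simpa only [ofReal_norm] using hb x hx

lemma map_add (hρ : IsInteractionMinimizer w ρ) (hw : Measurable w)
    (v : EuclideanSpace ℝ (Fin d)) : IsInteractionMinimizer w (ρ.map (fun x => x + v)) := by
  have := hρ.isProbabilityMeasure
  refine ⟨Measure.isProbabilityMeasure_map (by fun_prop), ?_, ?_⟩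
  · rw [interaction_map_add hw]
    exact hρ.ne_top
  · rw [interaction_map_add hw]
    exact hρ.le

end IsInteractionMinimizer

/-! ### Existence of minimizers by the direct method. -/

lemma lowerSemicontinuous_interaction {w : EuclideanSpace ℝ (Fin d) → ENNReal}
    (hw : Continuous w) :
    LowerSemicontinuous (fun ν : ProbabilityMeasure (EuclideanSpace ℝ (Fin d)) =>
      interaction w (ν : Measure (EuclideanSpace ℝ (Fin d))) ν) := by
  -- Truncating at height `N` gives bounded continuous kernels with weakly continuous energies; the
  -- energy is their supremum.
  have hcont : ∀ N : ℕ, Continuous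
      (fun p : EuclideanSpace ℝ (Fin d) × EuclideanSpace ℝ (Fin d) =>
        (min (w (p.1 - p.2)) N).toNNReal) := by
    intro N
    refine ENNReal.continuousOn_toNNReal.comp_continuous (by fun_prop) fun p => ?_
    exact ((min_le_right _ _).trans_lt (ENNReal.natCast_lt_top N)).ne
  have hle : ∀ (N : ℕ) (p : EuclideanSpace ℝ (Fin d) × EuclideanSpace ℝ (Fin d)),
      (min (w (p.1 - p.2)) N).toNNReal ≤ (N : NNReal) := by
    intro N p
    exact ENNReal.toNNReal_mono (ENNReal.natCast_ne_top N) (min_le_right _ _)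
  let f : ℕ → BoundedContinuousFunction
      (EuclideanSpace ℝ (Fin d) × EuclideanSpace ℝ (Fin d)) NNReal := fun N =>
    BoundedContinuousFunction.mkOfBound ⟨_, hcont N⟩ N fun p q => by
      rw [NNReal.dist_eq, abs_sub_le_iff]
      have h1 := NNReal.coe_le_coe.2 (hle N p)
      have h2 := NNReal.coe_le_coe.2 (hle N q)
      have h3 := NNReal.coe_nonneg (min (w (p.1 - p.2)) N).toNNReal
      have h4 := NNReal.coe_nonneg (min (w (q.1 - q.2)) N).toNNReal
      rw [NNReal.coe_natCast] at h1 h2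
      constructor <;> simp only [ContinuousMap.coe_mk] <;> linarith
  have hf : ∀ N p, ((f N p : NNReal) : ENNReal) = min (w (p.1 - p.2)) N := by
    intro N p
    exact ENNReal.coe_toNNReal ((min_le_right _ _).trans_lt (ENNReal.natCast_lt_top N)).ne
  have hsup : (fun ν : ProbabilityMeasure (EuclideanSpace ℝ (Fin d)) =>
      interaction w (ν : Measure (EuclideanSpace ℝ (Fin d))) ν) =
      fun ν : ProbabilityMeasure (EuclideanSpace ℝ (Fin d)) => ⨆ N, ∫⁻ p, f N p ∂((ν : Measure (EuclideanSpace ℝ (Fin d))).prod ν) := by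
    funext ν
    rw [← lintegral_iSup]
    · refine lintegral_congr fun p => ?_
      simp only [hf]
      rw [← inf_iSup_eq, ENNReal.iSup_natCast, inf_top_eq]
    · exact fun N => ((f N).continuous.measurable).coe_nnreal_ennreal
    · intro N M hNM p
      simp only [hf]
      gcongr
  rw [hsup]
  refine lowerSemicontinuous_iSup fun N => Continuous.lowerSemicontinuous ?_
  exact (ProbabilityMeasure.continuous_lintegral_boundedContinuousFunction (f N)).comp
    (ProbabilityMeasure.continuous_prod.comp (continuous_id.prodMk continuous_id))

lemma isTightMeasureSet_of_lintegral_enorm_le {M : ENNReal} (hM : M ≠ ⊤)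
    {S : Set (Measure (EuclideanSpace ℝ (Fin d)))} (hS : ∀ μ ∈ S, ∫⁻ x, ‖x‖ₑ ∂μ ≤ M) :
    IsTightMeasureSet S := by
  refine isTightMeasureSet_of_tendsto_measure_norm_gt ?_
  have hlim : Tendsto (fun r : ℝ => M / ENNReal.ofReal r) atTop (𝓝 0) := by
    have h := ENNReal.Tendsto.const_div (a := M) (ENNReal.tendsto_ofReal_atTop) (Or.inr hM)
    simpa using h
  refine tendsto_of_tendsto_of_tendsto_of_le_of_le' tendsto_const_nhds hlim
    (Eventually.of_forall fun r => bot_le) ?_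
  filter_upwards [eventually_gt_atTop 0] with r hr
  refine iSup₂_le fun μ hμ => ?_
  rw [ENNReal.le_div_iff_mul_le (Or.inl (by simpa using hr)) (Or.inl ENNReal.ofReal_ne_top),
    mul_comm]
  refine le_trans ?_ ((mul_meas_ge_le_lintegral (μ := μ)
    (f := fun x : EuclideanSpace ℝ (Fin d) => ‖x‖ₑ) (by fun_prop) (ENNReal.ofReal r)).trans
      (hS μ hμ))
  gcongr
  intro hx
  rw [← ofReal_norm]
  exact ENNReal.ofReal_le_ofReal hx.le

theorem exists_isInteractionMinimizer {w : EuclideanSpace ℝ (Fin d) → ENNReal}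
    (hw : Continuous w) (hlow : ∀ x, ‖x‖ₑ ≤ w x)
    {ρ₀ : Measure (EuclideanSpace ℝ (Fin d))} [IsProbabilityMeasure ρ₀]
    (h₀ : interaction w ρ₀ ρ₀ ≠ ⊤) : ∃ ρ, IsInteractionMinimizer w ρ := by
  have hwm := hw.measurable
  set M := interaction w ρ₀ ρ₀ with hM
  let S : Set (ProbabilityMeasure (EuclideanSpace ℝ (Fin d))) :=
    {ν | ∫⁻ x, ‖x‖ₑ ∂(ν : Measure (EuclideanSpace ℝ (Fin d))) ≤ M}
  have htrans : ∀ σ : Measure (EuclideanSpace ℝ (Fin d)), IsProbabilityMeasure σ →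
      interaction w σ σ ≤ M → ∃ ν ∈ S,
        interaction w (ν : Measure (EuclideanSpace ℝ (Fin d))) ν = interaction w σ σ := by
    intro σ hσ hle
    -- Tightness can hold only up to translation. Some point has potential at most the average;
    -- moving it to the origin bounds the first moment by the energy.
    obtain ⟨x, hx⟩ := exists_le_lintegral (μ := σ)
      (measurable_lintegral_kernel_sub hwm σ).aemeasurable
    rw [← interaction_eq_lintegral hwm] at hx
    have hm : Measurable (fun y : EuclideanSpace ℝ (Fin d) => y + -x) := by fun_prop
    refine ⟨⟨σ.map (fun y => y + -x), Measure.isProbabilityMeasure_map hm.aemeasurable⟩, ?_,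
      interaction_map_add hwm σ (-x)⟩
    change ∫⁻ y, ‖y‖ₑ ∂(σ.map (fun y => y + -x)) ≤ M
    rw [lintegral_map (by fun_prop) hm]
    refine le_trans (lintegral_mono fun y => ?_) (hx.trans hle)
    rw [← sub_eq_add_neg, enorm_sub_rev]
    exact hlow _
  have htight : IsTightMeasureSet
      {((μ : ProbabilityMeasure (EuclideanSpace ℝ (Fin d))) :
        Measure (EuclideanSpace ℝ (Fin d))) | μ ∈ S} := by
    refine isTightMeasureSet_of_lintegral_enorm_le h₀ ?_
    rintro _ ⟨ν, hν, rfl⟩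
    exact hν
  obtain ⟨ν₀, hν₀, hν₀e⟩ := htrans ρ₀ inferInstance le_rfl
  -- Membership of the minimizer in `S` itself is not needed: minimality over the compact closure
  -- suffices.
  obtain ⟨ν, -, hν⟩ := LowerSemicontinuousOn.exists_isMinOn ⟨ν₀, subset_closure hν₀⟩
    (isCompact_closure_of_isTightMeasureSet htight)
    ((lowerSemicontinuous_interaction hw).lowerSemicontinuousOn _)
  rw [isMinOn_iff] at hν
  have hνM : interaction w (ν : Measure (EuclideanSpace ℝ (Fin d))) ν ≤ M :=
    (hν ν₀ (subset_closure hν₀)).trans hν₀e.le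
  refine ⟨ν, inferInstance, ne_top_of_le_ne_top h₀ hνM, fun σ hσ => ?_⟩
  by_cases hle : interaction w σ σ ≤ M
  · obtain ⟨ν', hν', he⟩ := htrans σ hσ hle
    exact (hν ν' (subset_closure hν')).trans he.le
  · exact hνM.trans (not_le.1 hle).le

/-! ### Extended integrals of functions that are bounded from below -/

lemma toENNReal_add_const {K : NNReal} {z : EReal} (hz : -((K : ℝ) : EReal) ≤ z) :
    z.toENNReal + K = (z + ((K : ℝ) : EReal)).toENNReal + (-z).toENNReal ∧
      (-z).toENNReal ≤ K := by
  induction z with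
  | bot => exact absurd hz (by rw [← EReal.coe_neg]; simp)
  | top => simp
  | coe r =>
    have hz' : -(K : ℝ) ≤ r := by exact_mod_cast hz
    rw [← EReal.coe_neg, ← EReal.coe_add, EReal.real_coe_toENNReal, EReal.real_coe_toENNReal,
      EReal.real_coe_toENNReal, ← ENNReal.ofReal_coe_nnreal]
    refine ⟨?_, ENNReal.ofReal_le_ofReal (by linarith)⟩
    rcases le_total 0 r with h | h
    · rw [ENNReal.ofReal_of_nonpos (by linarith : -r ≤ 0), add_zero,
        ENNReal.ofReal_add h K.coe_nonneg]
    · rw [ENNReal.ofReal_of_nonpos h, zero_add, ← ENNReal.ofReal_add (by linarith) (by linarith)]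
      congr 1
      ring

/-- A lower bound keeps the negative part finite, so the extended integral becomes a Lebesgue
integral of a nonnegative function minus a constant. -/
lemma extIntegral_eq_lintegral_sub {α : Type*} [MeasurableSpace α] {μ : Measure α}
    [IsProbabilityMeasure μ] {f : α → EReal} (hf : Measurable f) {K : NNReal}
    (hK : ∀ x, -((K : ℝ) : EReal) ≤ f x) :
    extIntegral μ f =
      ((∫⁻ x, (f x + ((K : ℝ) : EReal)).toENNReal ∂μ : ENNReal) : EReal) - ((K : ℝ) : EReal) := by
  have hm : Measurable fun x => (-f x).toENNReal := hf.neg.ereal_toENNReal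
  have h1 : ∫⁻ x, (f x).toENNReal ∂μ + K =
      ∫⁻ x, (f x + ((K : ℝ) : EReal)).toENNReal ∂μ + ∫⁻ x, (-f x).toENNReal ∂μ := by
    rw [← lintegral_add_right _ hm, ← lintegral_congr fun x => (toENNReal_add_const (hK x)).1,
      lintegral_add_right _ measurable_const]
    simp
  have h2 : ∫⁻ x, (-f x).toENNReal ∂μ ≤ K := by
    refine (lintegral_mono fun x => (toENNReal_add_const (hK x)).2).trans ?_
    simp
  unfold extIntegral
  lift ∫⁻ x, (-f x).toENNReal ∂μ to NNReal using ne_top_of_le_ne_top ENNReal.coe_ne_top h2 with N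
  generalize ∫⁻ x, (f x).toENNReal ∂μ = P at h1 ⊢
  generalize ∫⁻ x, (f x + ((K : ℝ) : EReal)).toENNReal ∂μ = Q at h1 ⊢
  induction P with
  | top =>
    have hQ : Q = ⊤ := by simpa using h1.symm
    rw [hQ]
    simp
  | coe P =>
    lift Q to NNReal using by
      rintro rfl
      simp [← ENNReal.coe_add] at h1
    have h3 : (P : ℝ) + K = Q + N := by exact_mod_cast h1
    have h4 : (P : ℝ) - N = Q - K := by linarith
    change ((P : ℝ) : EReal) - ((N : ℝ) : EReal) = ((Q : ℝ) : EReal) - ((K : ℝ) : EReal)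
    rw [← EReal.coe_sub, ← EReal.coe_sub, h4]

/-! ### The shifted kernel -/

/-- A constant such that `powerPotential d a b` is at least its opposite for `4 < a < 5`. -/
def kernelShift (b : ℝ) : NNReal := ‖1 / b‖₊ + 2

lemma coe_kernelShift (b : ℝ) : (kernelShift b : ℝ) = |1 / b| + 2 := by
  simp [kernelShift]

/-- The kernel `powerPotential d a b`, shifted to be nonnegative. -/
def shiftedKernel (d : ℕ) (a b : ℝ) (x : EuclideanSpace ℝ (Fin d)) : ENNReal :=
  (powerPotential d a b x + ((kernelShift b : ℝ) : EReal)).toENNReal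

lemma powerPotential_eq {a b : ℝ} (ha : a ≠ 0) (x : EuclideanSpace ℝ (Fin d)) :
    powerPotential d a b x = if ‖x‖ = 0 ∧ b ≤ 0 then ⊤ else
      ((powerProfile a ‖x‖ - powerProfile b ‖x‖ : ℝ) : EReal) := by
  unfold powerPotential
  by_cases hx : x = 0
  · subst hx
    by_cases hb : b ≤ 0
    · simp [hb]
    · have hb0 : b ≠ 0 := by rintro rfl; exact hb le_rfl
      simp [hb, powerProfile, ha, hb0, Real.zero_rpow]
  · simp [hx]

lemma shiftedKernel_eq {a b : ℝ} (ha : a ≠ 0) (x : EuclideanSpace ℝ (Fin d)) :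
    shiftedKernel d a b x = if ‖x‖ = 0 ∧ b ≤ 0 then ⊤ else
      ENNReal.ofReal (powerProfile a ‖x‖ - powerProfile b ‖x‖ + kernelShift b) := by
  rw [shiftedKernel, powerPotential_eq ha]
  split_ifs
  · simp
  · rw [← EReal.coe_add, EReal.real_coe_toENNReal]

lemma norm_le_powerProfile_sub {a b : ℝ} (ha : 4 < a) (ha' : a < 5) (hb : b < 2)
    (x : EuclideanSpace ℝ (Fin d)) (hx : ¬(‖x‖ = 0 ∧ b ≤ 0)) :
    ‖x‖ ≤ powerProfile a ‖x‖ - powerProfile b ‖x‖ + kernelShift b := by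
  rw [coe_kernelShift]
  rcases (norm_nonneg x).eq_or_lt with h | h
  · have hb0 : b ≠ 0 := by rintro rfl; exact hx ⟨h.symm, le_rfl⟩
    rw [← h, powerProfile_of_ne_zero (by linarith : a ≠ 0), powerProfile_of_ne_zero hb0,
      Real.zero_rpow (by linarith), Real.zero_rpow hb0]
    simp only [zero_div, sub_zero, zero_add]
    positivity
  · linarith [le_powerProfile_sub ha ha' hb.le h]

lemma enorm_le_shiftedKernel {a b : ℝ} (ha : 4 < a) (ha' : a < 5) (hb : b < 2)
    (x : EuclideanSpace ℝ (Fin d)) : ‖x‖ₑ ≤ shiftedKernel d a b x := by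
  rw [shiftedKernel_eq (by linarith)]
  split_ifs with h
  · exact le_top
  · rw [← ofReal_norm]
    exact ENNReal.ofReal_le_ofReal (norm_le_powerProfile_sub ha ha' hb x h)

lemma neg_kernelShift_le_powerPotential {a b : ℝ} (ha : 4 < a) (ha' : a < 5) (hb : b < 2)
    (x : EuclideanSpace ℝ (Fin d)) :
    -((kernelShift b : ℝ) : EReal) ≤ powerPotential d a b x := by
  rw [powerPotential_eq (by linarith)]
  split_ifs with h
  · exact le_top
  · rw [← EReal.coe_neg, EReal.coe_le_coe_iff]
    linarith [norm_le_powerProfile_sub ha ha' hb x h, norm_nonneg x]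

lemma shiftedKernel_neg (a b : ℝ) (x : EuclideanSpace ℝ (Fin d)) :
    shiftedKernel d a b (-x) = shiftedKernel d a b x := by
  simp [shiftedKernel, powerPotential]

lemma continuous_powerProfile {s : ℝ} (hs : 0 < s) : Continuous (powerProfile s) := by
  have : powerProfile s = fun t => t ^ s / s := funext (powerProfile_of_ne_zero hs.ne')
  rw [this]
  exact (Real.continuous_rpow_const hs.le).div_const s

lemma tendsto_powerProfile_atBot {s : ℝ} (hs : s ≤ 0) :
    Tendsto (powerProfile s) (𝓝[>] 0) atBot := by
  rcases hs.eq_or_lt with rfl | hs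
  · exact Real.tendsto_log_nhdsGT_zero.congr fun t => by simp [powerProfile]
  · have h1 : Tendsto (fun t : ℝ => t⁻¹ ^ (-s)) (𝓝[>] 0) atTop :=
      (tendsto_rpow_atTop (neg_pos.2 hs)).comp tendsto_inv_nhdsGT_zero
    refine (h1.atTop_div_const_of_neg hs).congr' ?_
    filter_upwards [self_mem_nhdsWithin] with t ht
    rw [powerProfile_of_ne_zero hs.ne, Real.inv_rpow (le_of_lt ht), Real.rpow_neg (le_of_lt ht),
      inv_inv]

lemma powerProfile_nonneg {s t : ℝ} (hs : 0 < s) (ht : 0 ≤ t) : 0 ≤ powerProfile s t := by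
  rw [powerProfile_of_ne_zero hs.ne']
  positivity

/-- Continuity holds in `[0, ∞]`, at the origin too: for `b ≤ 0` the repulsion tends to infinity
there, matching the assigned value. -/
lemma continuous_shiftedKernel {a : ℝ} (ha : 0 < a) (b : ℝ) :
    Continuous (shiftedKernel d a b) := by
  by_cases hb : 0 < b
  · have : shiftedKernel d a b = fun x =>
        ENNReal.ofReal (powerProfile a ‖x‖ - powerProfile b ‖x‖ + kernelShift b) := by
      funext x
      rw [shiftedKernel_eq ha.ne', if_neg fun h => absurd h.2 (not_le.2 hb)]
    rw [this]
    have h1 := continuous_powerProfile ha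
    have h2 := continuous_powerProfile hb
    exact ENNReal.continuous_ofReal.comp (by fun_prop)
  rw [continuous_iff_continuousAt]
  intro x
  by_cases hx : x = 0
  · subst hx
    have h0 : shiftedKernel d a b 0 = ⊤ := by
      rw [shiftedKernel_eq ha.ne', if_pos ⟨norm_zero, not_lt.1 hb⟩]
    rw [ContinuousAt, h0, ENNReal.tendsto_nhds_top_iff_nat]
    intro n
    have h1 := (tendsto_powerProfile_atBot (not_lt.1 hb)).eventually_lt_atBot (-(n : ℝ))
    rw [eventually_nhdsWithin_iff] at h1
    have h2 : Tendsto (fun x : EuclideanSpace ℝ (Fin d) => ‖x‖) (𝓝 0) (𝓝 0) := tendsto_norm_zero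
    filter_upwards [h2.eventually h1] with x hx
    rw [shiftedKernel_eq ha.ne']
    split_ifs with h
    · exact ENNReal.natCast_lt_top n
    · have hx0 : 0 < ‖x‖ := (norm_nonneg x).lt_of_ne fun h' => h ⟨h'.symm, not_lt.1 hb⟩
      have h3 := hx hx0
      have h4 := powerProfile_nonneg ha (norm_nonneg x)
      have h5 := (kernelShift b).coe_nonneg
      rw [← ENNReal.ofReal_natCast, ENNReal.ofReal_lt_ofReal_iff] <;>
      linarith [Nat.cast_nonneg (α := ℝ) n]
  · have hn : 0 < ‖x‖ := norm_pos_iff.2 hx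
    have h1 : ∀ s, ContinuousAt (fun y : EuclideanSpace ℝ (Fin d) => powerProfile s ‖y‖) x :=
      fun s => ((hasDerivAt_powerProfile s hn).continuousAt).comp
        (f := fun y : EuclideanSpace ℝ (Fin d) => ‖y‖) continuous_norm.continuousAt
    have h2 : ContinuousAt (fun y : EuclideanSpace ℝ (Fin d) =>
        ENNReal.ofReal (powerProfile a ‖y‖ - powerProfile b ‖y‖ + kernelShift b)) x :=
      ENNReal.continuous_ofReal.continuousAt.comp
        (((h1 a).sub (h1 b)).add continuousAt_const)
    refine h2.congr ?_
    filter_upwards [isOpen_ne.mem_nhds hx] with y hy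
    rw [shiftedKernel_eq ha.ne', if_neg fun h => hy (norm_eq_zero.1 h.1)]

lemma measurable_powerPotential {a : ℝ} (ha : a ≠ 0) (b : ℝ) :
    Measurable (powerPotential d a b) := by
  have : powerPotential d a b = fun x => if ‖x‖ = 0 ∧ b ≤ 0 then ⊤ else
      ((powerProfile a ‖x‖ - powerProfile b ‖x‖ : ℝ) : EReal) := funext (powerPotential_eq ha)
  rw [this]
  have h1 := measurable_powerProfile a
  have h2 := measurable_powerProfile b
  refine Measurable.ite ?_ measurable_const ?_
  · exact ((measurableSet_singleton (0 : ℝ)).preimage measurable_norm).inter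
      (MeasurableSet.const _)
  · exact measurable_coe_real_ereal.comp
      ((h1.comp measurable_norm).sub (h2.comp measurable_norm))

lemma interactionEnergy_powerPotential {a b : ℝ} (ha : 4 < a) (ha' : a < 5) (hb : b < 2)
    (ρ : Measure (EuclideanSpace ℝ (Fin d))) [IsProbabilityMeasure ρ] :
    interactionEnergy (powerPotential d a b) ρ = ((1 / 2 : ℝ) : EReal) *
      ((interaction (shiftedKernel d a b) ρ ρ : EReal) - ((kernelShift b : ℝ) : EReal)) := by
  rw [interactionEnergy, extIntegral_eq_lintegral_sub
    (f := fun p : EuclideanSpace ℝ (Fin d) × EuclideanSpace ℝ (Fin d) =>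
      powerPotential d a b (p.1 - p.2)) ((measurable_powerPotential (by linarith) b).comp (measurable_fst.sub measurable_snd))
    fun p => neg_kernelShift_le_powerPotential ha ha' hb _]
  rfl

lemma half_mul_sub_le_iff {K : NNReal} {P Q : ENNReal} :
    ((1 / 2 : ℝ) : EReal) * ((P : EReal) - ((K : ℝ) : EReal)) ≤
      ((1 / 2 : ℝ) : EReal) * ((Q : EReal) - ((K : ℝ) : EReal)) ↔ P ≤ Q := by
  have htop : ((1 / 2 : ℝ) : EReal) * (((⊤ : ENNReal) : EReal) - ((K : ℝ) : EReal)) = ⊤ := by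
    rw [EReal.coe_ennreal_top, EReal.top_sub_coe, EReal.coe_mul_top_of_pos (by norm_num)]
  have hcoe : ∀ P : NNReal, ((1 / 2 : ℝ) : EReal) * (((P : ENNReal) : EReal) - ((K : ℝ) : EReal)) =
      ((1 / 2 * (P - K) : ℝ) : EReal) := by
    intro P
    push_cast
    rfl
  induction Q with
  | top =>
    rw [htop]
    exact iff_of_true le_top le_top
  | coe Q =>
    induction P with
    | top =>
      rw [htop, hcoe]
      exact iff_of_false (EReal.coe_lt_top _).not_ge ENNReal.coe_lt_top.not_ge
    | coe P =>
      rw [hcoe, hcoe, EReal.coe_le_coe_iff, ENNReal.coe_le_coe, ← NNReal.coe_le_coe]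
      constructor <;> intro h <;> linarith

/-- The two energies differ by an increasing affine map; the trial measure `ρ₀` excludes minimizers
of infinite energy. -/
lemma isEnergyMinimizer_iff {a b : ℝ} (ha : 4 < a) (ha' : a < 5) (hb : b < 2)
    {ρ₀ : Measure (EuclideanSpace ℝ (Fin d))} [IsProbabilityMeasure ρ₀]
    (h₀ : interaction (shiftedKernel d a b) ρ₀ ρ₀ ≠ ⊤) (ρ : Measure (EuclideanSpace ℝ (Fin d))) :
    IsEnergyMinimizer (powerPotential d a b) ρ ↔
      IsInteractionMinimizer (shiftedKernel d a b) ρ := by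
  have key : ∀ ρ σ : Measure (EuclideanSpace ℝ (Fin d)), IsProbabilityMeasure ρ →
      IsProbabilityMeasure σ → (interactionEnergy (powerPotential d a b) ρ ≤
        interactionEnergy (powerPotential d a b) σ ↔
      interaction (shiftedKernel d a b) ρ ρ ≤ interaction (shiftedKernel d a b) σ σ) := by
    intro ρ σ hρ hσ
    rw [interactionEnergy_powerPotential ha ha' hb, interactionEnergy_powerPotential ha ha' hb,
      half_mul_sub_le_iff]
  constructor
  · rintro ⟨hP, h⟩
    have h' := fun σ hσ => (key ρ σ hP hσ).1 (h σ hσ)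
    exact ⟨hP, ne_top_of_le_ne_top h₀ (h' ρ₀ inferInstance), h'⟩
  · rintro ⟨hP, -, h⟩
    exact ⟨hP, fun σ hσ => (key ρ σ hP hσ).2 (h σ hσ)⟩

/-! ### A uniform bound on the least energy -/

/-- The singularity is locally integrable because `-b < d`; the logarithm is dominated by `r ^ (-1 /
2)`, and `1 / 2 < d`. -/
lemma exists_neg_powerProfile_le (hd : 1 ≤ d) {b : ℝ} (hb : -(d : ℝ) < b) :
    ∃ C α : ℝ, 0 ≤ C ∧ α < d ∧ ∀ r : ℝ, 0 < r → -powerProfile b r ≤ C * r ^ (-α) := by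
  have hd' : (1 : ℝ) ≤ d := by exact_mod_cast hd
  rcases lt_trichotomy b 0 with h | rfl | h
  · refine ⟨-(1 / b), -b, ?_, by linarith, fun r hr => ?_⟩
    · have := one_div_neg.2 h
      linarith
    · rw [powerProfile_of_ne_zero h.ne, neg_neg]
      exact le_of_eq (by ring)
  · refine ⟨2, 1 / 2, by norm_num, by linarith, fun r hr => ?_⟩
    have h1 := Real.log_le_rpow_div (inv_nonneg.2 hr.le) (by norm_num : (0 : ℝ) < 1 / 2)
    rw [Real.log_inv, Real.inv_rpow hr.le, ← Real.rpow_neg hr.le] at h1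
    rw [powerProfile, if_pos rfl]
    linarith
  · refine ⟨0, 0, le_rfl, by linarith, fun r hr => ?_⟩
    have := powerProfile_nonneg h hr.le
    linarith

/-- The uniform measure on the unit ball serves all `a` at once. Uniformity matters because the
support radius must be fixed before `a` is taken close to 4. -/
lemma exists_interaction_shiftedKernel_le (hd : 1 ≤ d) {b : ℝ} (hb : -(d : ℝ) < b) :
    ∃ ρ₀ : Measure (EuclideanSpace ℝ (Fin d)), IsProbabilityMeasure ρ₀ ∧
      ∃ M : ENNReal, M ≠ ⊤ ∧ ∀ a : ℝ, 4 < a → a < 5 →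
        interaction (shiftedKernel d a b) ρ₀ ρ₀ ≤ M := by
  obtain ⟨C, α, hC, hα, hle⟩ := exists_neg_powerProfile_le hd hb
  have hfr : Module.finrank ℝ (EuclideanSpace ℝ (Fin d)) = d := finrank_euclideanSpace_fin
  have : Nontrivial (EuclideanSpace ℝ (Fin d)) :=
    Module.nontrivial_of_finrank_pos (R := ℝ) (by omega)
  set B : Set (EuclideanSpace ℝ (Fin d)) := Metric.ball 0 1
  have hB0 : volume B ≠ 0 := (Metric.measure_ball_pos volume _ one_pos).ne'
  have hBt : volume B ≠ ⊤ := measure_ball_lt_top.ne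
  set g : EuclideanSpace ℝ (Fin d) → ℝ := fun z => 8 + kernelShift b + C * ‖z‖ ^ (-α)
  have hgm : Measurable g := by fun_prop
  have hgint : IntegrableOn g (Metric.ball 0 2) volume := by
    refine Integrable.add (integrableOn_const measure_ball_lt_top.ne) ?_
    refine integrableOn_ball_of_norm_le_rpow (C := C) (α := α) (by omega) (by rw [hfr]; exact hα)
      (Eventually.of_forall fun x => ?_) (Measurable.aestronglyMeasurable (by fun_prop))
    rw [Real.norm_of_nonneg (by positivity)]
  set G : ENNReal := ∫⁻ z in Metric.ball 0 2, ENNReal.ofReal (g z)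
  have hG : G ≠ ⊤ := hgint.lintegral_lt_top.ne
  refine ⟨ProbabilityTheory.cond volume B,
    ProbabilityTheory.cond_isProbabilityMeasure_of_finite hB0 hBt, (volume B)⁻¹ * G,
    ENNReal.mul_ne_top (by simpa using hB0) hG, fun a ha ha' => ?_⟩
  have hP := ProbabilityTheory.cond_isProbabilityMeasure_of_finite hB0 hBt
  have hwm := (continuous_shiftedKernel (d := d) (by linarith : 0 < a) b).measurable
  have hpt : ∀ z : EuclideanSpace ℝ (Fin d), z ≠ 0 → ‖z‖ ≤ 2 →
      shiftedKernel d a b z ≤ ENNReal.ofReal (g z) := by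
    intro z hz hz2
    have hz0 : 0 < ‖z‖ := norm_pos_iff.2 hz
    rw [shiftedKernel_eq (by linarith), if_neg fun h => hz0.ne' h.1]
    apply ENNReal.ofReal_le_ofReal
    -- Here 8 is `2 ^ 5 / 4`, from `‖z‖ ≤ 2` and `4 < a < 5`.
    have h1 : powerProfile a ‖z‖ ≤ 8 := by
      rw [powerProfile_of_ne_zero (by linarith), div_le_iff₀ (by linarith)]
      calc ‖z‖ ^ a ≤ 2 ^ a := Real.rpow_le_rpow hz0.le hz2 (by linarith)
        _ ≤ 2 ^ (5 : ℝ) := Real.rpow_le_rpow_of_exponent_le (by norm_num) ha'.le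
        _ = 32 := by norm_num
        _ ≤ 8 * a := by linarith
    have h2 := hle ‖z‖ hz0
    simp only [g]
    linarith
  rw [interaction_eq_lintegral hwm]
  have hinner : ∀ x ∈ B, ∫⁻ y, shiftedKernel d a b (x - y) ∂(ProbabilityTheory.cond volume B) ≤
      (volume B)⁻¹ * G := by
    intro x hx
    rw [ProbabilityTheory.cond, lintegral_smul_measure, smul_eq_mul]
    gcongr
    rw [← lintegral_indicator Metric.isOpen_ball.measurableSet]
    have hne : ∀ᵐ y ∂(volume : Measure (EuclideanSpace ℝ (Fin d))), y ≠ x :=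
      compl_mem_ae_iff.2 (measure_singleton x)
    calc ∫⁻ y, B.indicator (fun y => shiftedKernel d a b (x - y)) y
        ≤ ∫⁻ y, (Metric.ball 0 2).indicator (fun z => ENNReal.ofReal (g z)) (x - y) := by
          refine lintegral_mono_ae (hne.mono fun y hy => ?_)
          by_cases hyB : y ∈ B
          · have h2 : ‖x - y‖ < 2 := by
              rw [mem_ball_zero_iff] at hx hyB
              linarith [norm_sub_le x y]
            rw [indicator_of_mem hyB, indicator_of_mem (mem_ball_zero_iff.2 h2)]
            exact hpt _ (sub_ne_zero.2 hy.symm) h2.le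
          · rw [indicator_of_notMem hyB]
            exact bot_le
      _ = G := by
          rw [lintegral_sub_left_eq_self
            (fun z => (Metric.ball 0 2).indicator (fun z => ENNReal.ofReal (g z)) z) x,
            lintegral_indicator Metric.isOpen_ball.measurableSet]
  refine (lintegral_mono_ae ((ProbabilityTheory.ae_cond_mem
    Metric.isOpen_ball.measurableSet).mono hinner)).trans ?_
  simp

/-! ### Uniqueness -/

lemma lintegral_shiftedKernel_eq {a b : ℝ} (ha : 4 < a) (ha' : a < 5) (hb : b < 2)
    {τ : Measure (EuclideanSpace ℝ (Fin d) × EuclideanSpace ℝ (Fin d))} [IsFiniteMeasure τ]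
    (hdiag : ∀ᵐ p ∂τ, ¬(‖p.1 - p.2‖ = 0 ∧ b ≤ 0))
    (hint : Integrable
      (fun p => powerProfile a ‖p.1 - p.2‖ - powerProfile b ‖p.1 - p.2‖ + kernelShift b) τ) :
    ∫⁻ p, shiftedKernel d a b (p.1 - p.2) ∂τ = ENNReal.ofReal
      (∫ p, (powerProfile a ‖p.1 - p.2‖ - powerProfile b ‖p.1 - p.2‖ + kernelShift b) ∂τ) := by
  rw [ofReal_integral_eq_lintegral_ofReal hint]
  · refine lintegral_congr_ae (hdiag.mono fun p hp => ?_)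
    dsimp only
    rw [shiftedKernel_eq (by linarith), if_neg hp]
  · exact hdiag.mono fun p hp => (norm_nonneg _).trans (norm_le_powerProfile_sub ha ha' hb _ hp)

lemma repWeight_le_shiftedKernel {a b L : ℝ} (ha : 0 < a) (hb : b < 2) (hL : 0 < L)
    {x : EuclideanSpace ℝ (Fin d)} (hx : ‖x‖ ≤ L) :
    repWeight b L ‖x‖ ≤ shiftedKernel d a b x + ENNReal.ofReal (powerProfile b L) := by
  rw [repWeight_eq hb (norm_nonneg x) hx hL, shiftedKernel_eq ha.ne']
  split_ifs with h
  · simp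
  · refine le_trans (ENNReal.ofReal_le_ofReal ?_) ENNReal.ofReal_add_le
    have h1 := powerProfile_nonneg ha (norm_nonneg x)
    have h2 := (kernelShift b).coe_nonneg
    linarith

/-- Each minimizer is tested against the other in the first variation inequality, and the two are
added. The remaining work is to pass from Lebesgue to Bochner integrals and to cancel the shift. -/
lemma quadForm_nonpos_of_isInteractionMinimizer {a b R : ℝ} (ha : 4 < a) (ha' : a < 5)
    (hb : b < 2) (hR : 0 < R) {ρ σ : Measure (EuclideanSpace ℝ (Fin d))}
    (hρ : IsInteractionMinimizer (shiftedKernel d a b) ρ)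
    (hσ : IsInteractionMinimizer (shiftedKernel d a b) σ)
    (hρR : ∀ᵐ x ∂ρ, ‖x‖ ≤ R) (hσR : ∀ᵐ x ∂σ, ‖x‖ ≤ R) :
    ∫⁻ p, repWeight b (2 * R) ‖p.1 - p.2‖ ∂(pairPos ρ σ) ≠ ⊤ ∧
      quadForm ρ σ (fun p => powerProfile a ‖p.1 - p.2‖ - powerProfile b ‖p.1 - p.2‖) ≤ 0 := by
  have := hρ.isProbabilityMeasure
  have := hσ.isProbabilityMeasure
  have hwm := (continuous_shiftedKernel (d := d) (by linarith : 0 < a) b).measurable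
  have hev := shiftedKernel_neg (d := d) a b
  have hle : ∫⁻ p, shiftedKernel d a b (p.1 - p.2) ∂(pairPos ρ σ) ≤
      ∫⁻ p, shiftedKernel d a b (p.1 - p.2) ∂(pairNeg ρ σ) := by
    rw [pairPos, pairNeg, lintegral_add_measure, lintegral_add_measure]
    exact add_le_add (hρ.le_interaction hwm hev hσ.ne_top) (hσ.le_interaction hwm hev hρ.ne_top)
  obtain ⟨hPL, hNL⟩ := ae_pair_norm_sub_le hρR hσR
  have hfin : ∫⁻ p, repWeight b (2 * R) ‖p.1 - p.2‖ ∂(pairPos ρ σ) ≠ ⊤ := by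
    refine ne_top_of_le_ne_top ?_ (lintegral_mono_ae (hPL.mono fun p hp =>
      repWeight_le_shiftedKernel (by linarith : 0 < a) hb (by linarith) hp))
    rw [lintegral_add_right _ measurable_const, lintegral_const, pairPos, lintegral_add_measure]
    exact ENNReal.add_ne_top.2 ⟨ENNReal.add_ne_top.2 ⟨hρ.ne_top, hσ.ne_top⟩,
      ENNReal.mul_ne_top ENNReal.ofReal_ne_top (measure_ne_top (pairPos ρ σ) _)⟩
  have hfin' := ne_top_of_le_ne_top hfin (lintegral_repWeight_pairNeg_le hb hρR hσR)
  obtain ⟨hPd, hPi, -⟩ := repWeight_data hb (by linarith) hPL hfin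
  obtain ⟨hNd, hNi, -⟩ := repWeight_data hb (by linarith) hNL hfin'
  have hca := continuous_powerProfile (by linarith : 0 < a)
  obtain ⟨hPa, hNa⟩ := integrable_pair_of_continuous hρR hσR
    (f := fun p => powerProfile a ‖p.1 - p.2‖) (by fun_prop)
  have hPs := hPa.sub hPi
  have hNs := hNa.sub hNi
  have hPk := hPs.add (integrable_const (kernelShift b : ℝ))
  have hNk := hNs.add (integrable_const (kernelShift b : ℝ))
  refine ⟨hfin, ?_⟩
  rw [lintegral_shiftedKernel_eq ha ha' hb hPd hPk, lintegral_shiftedKernel_eq ha ha' hb hNd hNk,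
    ENNReal.ofReal_le_ofReal_iff (integral_nonneg_of_ae (hNd.mono fun p hp =>
      (norm_nonneg _).trans (norm_le_powerProfile_sub ha ha' hb _ hp)))] at hle
  have h1 : ∫ p, (powerProfile a ‖p.1 - p.2‖ - powerProfile b ‖p.1 - p.2‖ + kernelShift b)
      ∂(pairPos ρ σ) = ∫ p, (powerProfile a ‖p.1 - p.2‖ - powerProfile b ‖p.1 - p.2‖)
      ∂(pairPos ρ σ) + ∫ p, (kernelShift b : ℝ) ∂(pairPos ρ σ) :=
    integral_add hPs (integrable_const _)
  have h2 : ∫ p, (powerProfile a ‖p.1 - p.2‖ - powerProfile b ‖p.1 - p.2‖ + kernelShift b)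
      ∂(pairNeg ρ σ) = ∫ p, (powerProfile a ‖p.1 - p.2‖ - powerProfile b ‖p.1 - p.2‖)
      ∂(pairNeg ρ σ) + ∫ p, (kernelShift b : ℝ) ∂(pairNeg ρ σ) :=
    integral_add hNs (integrable_const _)
  have h3 := quadForm_const ρ σ (kernelShift b : ℝ)
  unfold quadForm at h3 ⊢
  linarith

lemma IsInteractionMinimizer.exists_centered {w : EuclideanSpace ℝ (Fin d) → ENNReal}
    {ρ : Measure (EuclideanSpace ℝ (Fin d))} (hρ : IsInteractionMinimizer w ρ)
    (hw : Measurable w) (hev : ∀ x, w (-x) = w x) (hlow : ∀ x, ‖x‖ₑ ≤ w x) :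
    ∃ v : EuclideanSpace ℝ (Fin d), IsInteractionMinimizer w (ρ.map (fun x => x + v)) ∧
      ∫ x, x ∂(ρ.map (fun x => x + v)) = 0 ∧
      ∀ᵐ x ∂(ρ.map (fun x => x + v)), ‖x‖ ≤ (interaction w ρ ρ).toReal := by
  have := hρ.isProbabilityMeasure
  obtain ⟨hint, hae⟩ := hρ.ae_norm_sub_mean_le hw hev hlow
  refine ⟨-∫ x, x ∂ρ, hρ.map_add hw _, ?_, ?_⟩
  · rw [integral_map (by fun_prop) (by fun_prop), integral_add hint (integrable_const _)]
    simp
  · rw [ae_map_iff (by fun_prop) (measurableSet_le (by fun_prop) (by fun_prop))]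
    simpa only [← sub_eq_add_neg] using hae

theorem theorem1p3 (d : ℕ) (hd : 1 ≤ d) (b : ℝ) (hb : -(d : ℝ) < b) (hb2 : b < 2) :
    ∃ aPlus : ℝ, 4 < aPlus ∧ ∀ a : ℝ, 4 < a → a < aPlus →
      (∃ ρ : Measure (EuclideanSpace ℝ (Fin d)), IsEnergyMinimizer (powerPotential d a b) ρ) ∧
      ∀ ρ σ : Measure (EuclideanSpace ℝ (Fin d)),
        IsEnergyMinimizer (powerPotential d a b) ρ →
        IsEnergyMinimizer (powerPotential d a b) σ →
        ∃ v : EuclideanSpace ℝ (Fin d), σ = ρ.map (fun x => x + v) := by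
  obtain ⟨ρ₀, hρ₀, M, hM, hle⟩ := exists_interaction_shiftedKernel_le hd hb
  -- The radius depends only on the uniform energy bound, so `δ` can be chosen before `a`; the 1
  -- makes it positive.
  set R : ℝ := M.toReal + 1
  have hR : 0 < R := by positivity
  obtain ⟨δ, hδ, hδ2, huniq⟩ := exists_eq_of_quadForm_nonpos hb hb2 hR
  refine ⟨4 + δ, by linarith, fun a ha ha4 => ?_⟩
  have ha' : a < 5 := by linarith
  have h₀ : interaction (shiftedKernel d a b) ρ₀ ρ₀ ≠ ⊤ := ne_top_of_le_ne_top hM (hle a ha ha')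
  have hw := continuous_shiftedKernel (d := d) (by linarith : 0 < a) b
  have hev := shiftedKernel_neg (d := d) a b
  have hlow := enorm_le_shiftedKernel (d := d) ha ha' hb2
  simp only [isEnergyMinimizer_iff ha ha' hb2 h₀]
  refine ⟨exists_isInteractionMinimizer hw hlow h₀, fun ρ σ hρ hσ => ?_⟩
  have hbound : ∀ μ : Measure (EuclideanSpace ℝ (Fin d)),
      IsInteractionMinimizer (shiftedKernel d a b) μ →
      (interaction (shiftedKernel d a b) μ μ).toReal ≤ R := by
    intro μ hμ
    have := ENNReal.toReal_mono hM ((hμ.le ρ₀ hρ₀).trans (hle a ha ha'))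
    exact this.trans (by simp [R])
  obtain ⟨v, hv, hv0, hvR⟩ := hρ.exists_centered hw.measurable hev hlow
  obtain ⟨u, hu, hu0, huR⟩ := hσ.exists_centered hw.measurable hev hlow
  have hvR' := hvR.mono fun x hx => hx.trans (hbound ρ hρ)
  have huR' := huR.mono fun x hx => hx.trans (hbound σ hσ)
  obtain ⟨hfin, hq⟩ := quadForm_nonpos_of_isInteractionMinimizer ha ha' hb2 hR hv hu hvR' huR'
  have heq := huniq a ha ha4 _ _ hv.isProbabilityMeasure hu.isProbabilityMeasure hvR' huR'
    (hv0.trans hu0.symm) hfin hq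
  -- The centered measures coincide, so `σ` is obtained from `ρ` by translating by `v` and undoing
  -- the translation by `u`.
  refine ⟨v - u, ?_⟩
  have h1 : (σ.map (fun x => x + u)).map (fun x => x + -u) = σ := by
    rw [Measure.map_map (by fun_prop) (by fun_prop)]
    simp [Function.comp_def]
  rw [← h1, ← heq, Measure.map_map (by fun_prop) (by fun_prop)]
  congr 1
  funext x
  simp only [Function.comp_apply]
  abel

end
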